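/- Let $r\ge 3$ be an integer and $\gamma>0$ a real number. Then there are a real number $\varepsilon\in(0,3/2)$ and an integer $n_0$, both depending only on $r$ and $\gamma$, such that the following holds for every $n\ge n_0$ with $$p:=\frac{(\ln n)^{17r}}{n^{r-1}} .$$ Let $V$ be a set of $n$ vertices and let $\mathcal H$ be an $r$-uniform hypergraph with vertex set $V$ (that is, its set of hyperedges is a set of $r$-element subsets of $V$). For disjoint $T,U\subseteq V$ let $e_{\mathcal H}\big(T,\binom{U}{r-1}\big)$ denote the number of hyperedges $e$ of $\mathcal H$ with $|e\cap T|=1$ and $|e\cap U|=r-1$. Assume that 1. $\mathcal H$ is $(\varepsilon,p)$-pseudorandom, that is: (i) for all disjoint $T,U\subseteq V$ with $|U|\le|T|$, $$e_{\mathcal H}\Big(T,\tbinom{U}{r-1}\Big)\le(1+\varepsilon)\,p\,|T|\tbinom{|U|}{r-1}+|T|(\ln n)^{1+\varepsilon};$$ (ii) for all disjoint $T,U\subseteq V$ with $\varepsilon|U|\le|T|\le|U|\le n/2$ and $|U|\ge\Big(\frac{13\,(r-1)!\,\ln n}{\varepsilon^3p}\Big)^{1/(r-1)}$, $$e_{\mathcal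 H}\Big(T,\tbinom{U}{r-1}\Big)\le(1+\varepsilon)\,p\,|T|\tbinom{|U|}{r-1};$$ 2. any two distinct vertices lie together in at most $2\ln n$ hyperedges of $\mathcal H$, i.e. $\Delta_2(\mathcal H)\le 2\ln n$. Let $H\subseteq\mathcal H$ be a spanning subgraph, that is, a hypergraph with vertex set $V$ all of whose hyperedges are hyperedges of $\mathcal H$, such that every vertex lies in at least $$\Big(\frac1{2^{r-1}}+\gamma\Big)\,p\,\binom{n}{r-1}$$ hyperedges of $H$, i.e. $\delta_1(H)\ge\big(2^{1-r}+\gamma\big)p\binom{n}{r-1}$. Then $H$ contains a Hamilton Berge cycle, that is, a sequence $(v_1,e_1,v_2,e_2,\dots,v_n,e_n)$ in which $v_1,\dots,v_n$ are distinct vertices (hence all vertices of $V$), $e_1,\dots,e_n$ are distinct hyperedges of $H$, $\{v_i,v_{i+1}\}\subseteq e_i$ for $1\le i\le n-1$, and $\{v_n,v_1\}\subseteq e_n$. -/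

import Mathlib

/-- An `r`-uniform hypergraph with (finite) vertex set `V`: a set of hyperedges, each of which is an
`r`-element subset of `V`. -/
@[ext]
structure UniformHypergraph (V : Type*) (r : ℕ) where
  /-- the set of hyperedges -/
  edges : Finset (Finset V)
  /-- every hyperedge has exactly `r` elements -/
  sized : (edges : Set (Finset V)).Sized r

namespace UniformHypergraph

/-- `H` is a spanning subgraph of `G`: both have the vertex set `V`, and every hyperedge of `H` is
a hyperedge of `G`. -/
def IsSpanningSubgraph {V : Type*} {r : ℕ} (H G : UniformHypergraph V r) : Prop :=
  H.edges ⊆ G.edges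

/-- The degree `deg_H(S)` of a set `S` of vertices: the number of hyperedges containing `S`. -/
def setDegree {V : Type*} [DecidableEq V] {r : ℕ} (H : UniformHypergraph V r)
    (S : Finset V) : ℕ :=
  (H.edges.filter (fun e => S ⊆ e)).card

/-- The degree `deg_H(v)` of a vertex: the number of hyperedges containing `v`. -/
def degree {V : Type*} [DecidableEq V] {r : ℕ} (H : UniformHypergraph V r) (v : V) : ℕ :=
  (H.edges.filter (fun e => v ∈ e)).card

/-- The minimum vertex degree `δ_1(H)`. -/
noncomputable def minDegree {V : Type*} [DecidableEq V] {r : ℕ} (H : UniformHypergraph V r) : ℕ :=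
  ⨅ v : V, H.degree v

/-- The maximum `l`-collective degree `Δ_l(H)`: the maximum of `deg_H(S)` over all `l`-element
sets `S` of vertices. -/
def maxCollectiveDegree {V : Type*} [Fintype V] [DecidableEq V] {r : ℕ}
    (H : UniformHypergraph V r) (l : ℕ) : ℕ :=
  (Finset.powersetCard l (Finset.univ : Finset V)).sup H.setDegree

/-- `e_H(T, binom(U, r-1))`: the number of hyperedges that meet `T` in exactly one vertex and `U` in
exactly `r - 1` vertices (used for disjoint `T` and `U`). -/
def crossEdges {V : Type*} [DecidableEq V] {r : ℕ} (H : UniformHypergraph V r)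
    (T U : Finset V) : ℕ :=
  (H.edges.filter (fun e => (e ∩ T).card = 1 ∧ (e ∩ U).card = r - 1)).card

/-- `(ε, p)`-pseudorandomness of an `r`-uniform hypergraph on `n = |V|` vertices; it is only used
for `p > 0` and `0 < ε < 3/2`. -/
structure IsPseudorandom {V : Type*} [Fintype V] [DecidableEq V] {r : ℕ}
    (G : UniformHypergraph V r) (ε p : ℝ) : Prop where
  /-- upper bound on the number of crossing hyperedges when `|U| ≤ |T|` -/
  upper_small : ∀ T U : Finset V, Disjoint T U → U.card ≤ T.card →
    (G.crossEdges T U : ℝ) ≤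
      (1 + ε) * p * (T.card : ℝ) * (U.card.choose (r - 1) : ℝ)
        + (T.card : ℝ) * Real.log (Fintype.card V : ℝ) ^ (1 + ε)
  /-- upper bound when `ε|U| ≤ |T| ≤ |U| ≤ n/2` and `U` is not too small -/
  upper_large : ∀ T U : Finset V, Disjoint T U →
    ε * (U.card : ℝ) ≤ (T.card : ℝ) → T.card ≤ U.card →
    (U.card : ℝ) ≤ (Fintype.card V : ℝ) / 2 →
    (13 * ((r - 1).factorial : ℝ) * Real.log (Fintype.card V : ℝ) / (ε ^ 3 * p))
        ^ (1 / ((r : ℝ) - 1)) ≤ (U.card : ℝ) →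
    (G.crossEdges T U : ℝ) ≤ (1 + ε) * p * (T.card : ℝ) * (U.card.choose (r - 1) : ℝ)

/-- `(v 0, e 0, v 1, e 1, …, v (k-1), e (k-1))` is a Berge cycle of `H`: the vertices are distinct,
the `e i` are distinct hyperedges of `H`, and each `e i` contains `v i` and its cyclic successor
(`finRotate k` is `i ↦ i + 1` modulo `k`). -/
structure IsBergeCycle {V : Type*} {r : ℕ} (H : UniformHypergraph V r) (k : ℕ)
    (v : Fin k → V) (e : Fin k → Finset V) : Prop where
  vertices_injective : Function.Injective v
  edges_injective : Function.Injective e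
  edge_mem : ∀ i, e i ∈ H.edges
  left_mem : ∀ i, v i ∈ e i
  right_mem : ∀ i, v (finRotate k i) ∈ e i

/-- `H` contains a Hamilton Berge cycle: a Berge cycle with `n = |V|` vertices (and `n` edges). -/
def HasHamiltonBergeCycle {V : Type*} [Fintype V] {r : ℕ} (H : UniformHypergraph V r) : Prop :=
  ∃ (v : Fin (Fintype.card V) → V) (e : Fin (Fintype.card V) → Finset V),
    H.IsBergeCycle (Fintype.card V) v e

end UniformHypergraph

/-! Colour the vertices with about `(ln n)^8` colours, and let an arc `x → y` (`Arc`) stand for a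
hyperedge through `x` and `y` all of whose vertices except `x` have the colour of `y`, while `x` has
another colour. Since `r ≥ 3`, such a hyperedge determines both its tail `x` and the colour of its
head (`eq_of_arc_edge`). Hence, if no vertex emits two arcs into the same colour (`IsEmission`),
different arcs use different hyperedges. It remains to find a Hamilton cycle in the underlying graph
of such a set of arcs (`hasHamiltonBergeCycle_of_tour`); distinctness of hyperedges is then
automatic.

For a random colouring, McDiarmid's inequality shows that the classes have nearly equal size and
that every vertex keeps its expected share of hyperedges into every class
(`exists_balanced_colouring`). The minimum degree exceeds the fraction `2^(1-r)` of the typical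
degree, which is what a set `U` of half a class would absorb. So if `S` had an out-neighbourhood in
a class that is smaller than `16|S|` and not noticeably more than half of the class, all the
hyperedges leaving `S` would be squeezed into it, contradicting the pseudorandomness of `G`
(`isExpanding_arc`). Thus sets grow until they occupy more than half of a class, and two such sets
in one class intersect.

The Hamilton cycle uses this expansion in three ways. Prescribed pairs of vertices are linked by
disjoint paths of prescribed length through few reserved colours (`exists_linkage`): walks from both
ends expand and meet in a middle class. By Hall's theorem consecutive layers of size `σ` are
perfectly matched, which covers almost all vertices by `σ` paths (`exists_layer_paths`). How these
paths pair up their ends is not controlled, so closing them up could give many cycles. Therefore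
each closing connection runs through a ladder that can be traversed in two ways, using the same
vertices but exchanging two exits. Switching suitable ladders merges all cycles into one
(`exists_switching`, `hasHamiltonTour_of_ladders`). The remainder of `n` modulo `σ` is absorbed by
making some connections one vertex longer. -/

/-! ### Linking prescribed pairs of vertices through fresh colour classes -/

/-- The vertices of colour `j` that receive an arc of `R` from `S`. -/
noncomputable def outNbrs {V J : Type*} [Fintype V] (c : V → J) (R : V → V → Prop) (j : J)
    (S : Finset V) : Finset V :=
  open Classical in Finset.univ.filter fun y => c y = j ∧ ∃ x ∈ S, R x y

/-- The colour class of `j`. -/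
noncomputable def colourClass {V J : Type*} [Fintype V] (c : V → J) (j : J) : Finset V :=
  open Classical in Finset.univ.filter fun y => c y = j

/-- Every set of vertices avoiding a colour class either expands by a factor of `16` into that class,
or reaches noticeably more than half of it. -/
structure IsExpanding {V J : Type*} [Fintype V] (c : V → J) (R : V → V → Prop) (σ β : ℕ) :
    Prop where
  card_class_le : ∀ j, (colourClass c j).card ≤ σ
  expand : ∀ j (S : Finset V), (∀ x ∈ S, c x ≠ j) →
    16 * S.card ≤ (outNbrs c R j S).card ∨ σ + 2 * β ≤ 2 * (outNbrs c R j S).card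

/-- A subrelation of `R` with heads coloured in `C`, in which every vertex has at most one
out-neighbour of each colour. -/
structure IsEmission {V J : Type*} (c : V → J) (R : V → V → Prop) (C : Finset J)
    (E : V → V → Prop) : Prop where
  le : ∀ x y, E x y → R x y
  mem : ∀ x y, E x y → c y ∈ C
  functional : ∀ x y y', E x y → E x y' → c y = c y' → y = y'

/-- The symmetrisation of a relation. -/
def SymmOf {V : Type*} (E : V → V → Prop) (x y : V) : Prop := E x y ∨ E y x

/-- The lists `l i`, for `i ∈ s`, are the interiors of disjoint paths from `a i` to `b i` through
the colours in `C`, with arcs (in either direction) from `E`. -/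
structure IsLinkage {V J ι : Type*} (c : V → J) (R : V → V → Prop) (a b : ι → V) (s : Finset ι)
    (len : ι → ℕ) (C : Finset J) (E : V → V → Prop) (l : ι → List V) : Prop where
  emission : IsEmission c R C E
  chain : ∀ i ∈ s, List.IsChain (SymmOf E) (a i :: (l i ++ [b i]))
  length : ∀ i ∈ s, (l i).length = len i
  colour : ∀ i ∈ s, ∀ x ∈ l i, c x ∈ C
  nodup : ∀ i ∈ s, (l i).Nodup
  disjoint : ∀ i ∈ s, ∀ i' ∈ s, i ≠ i' → List.Disjoint (l i) (l i')

/-! ### Gluing emissions and linkages that use disjoint sets of colours. -/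

section Linkage

variable {V J ι : Type*}

lemma SymmOf.symm {E : V → V → Prop} {x y : V} (h : SymmOf E x y) : SymmOf E y x := Or.symm h

lemma SymmOf.mono {E E' : V → V → Prop} (h : ∀ x y, E x y → E' x y) {x y : V}
    (hxy : SymmOf E x y) : SymmOf E' x y := hxy.imp (h _ _) (h _ _)

/-- The colour of the head tells which of the two relations an arc comes from, so two arcs into the
same colour come from the same one. -/
lemma IsEmission.union [DecidableEq J] {c : V → J} {R : V → V → Prop} {C C' : Finset J}
    {E E' : V → V → Prop} (h : IsEmission c R C E) (h' : IsEmission c R C' E')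
    (hd : Disjoint C C') : IsEmission c R (C ∪ C') (fun x y => E x y ∨ E' x y) where
  le x y := fun hxy => hxy.elim (h.le x y) (h'.le x y)
  mem x y := fun hxy => Finset.mem_union.2 (hxy.imp (h.mem x y) (h'.mem x y))
  functional x y y' := by
    rintro (h1 | h1) (h2 | h2) hc
    · exact h.functional x y y' h1 h2 hc
    · exact absurd (hc ▸ h.mem _ _ h1) (Finset.disjoint_right.1 hd (h'.mem _ _ h2))
    · exact absurd (hc ▸ h'.mem _ _ h1) (Finset.disjoint_left.1 hd (h.mem _ _ h2))
    · exact h'.functional x y y' h1 h2 hc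

lemma isEmission_false (c : V → J) (R : V → V → Prop) (C : Finset J) :
    IsEmission c R C (fun _ _ => False) where
  le _ _ h := h.elim
  mem _ _ h := h.elim
  functional _ _ _ h := h.elim

lemma isLinkage_empty (c : V → J) (R : V → V → Prop) (a b : ι → V) (len : ι → ℕ) (C : Finset J) :
    IsLinkage c R a b ∅ len C (fun _ _ => False) (fun _ => []) where
  emission := isEmission_false c R C
  chain := by simp
  length := by simp
  colour := by simp
  nodup := by simp
  disjoint := by simp

lemma IsLinkage.union [DecidableEq J] [DecidableEq ι] {c : V → J} {R : V → V → Prop} {a b : ι → V}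
    {s s' : Finset ι} {len : ι → ℕ} {C C' : Finset J} {E E' : V → V → Prop} {l l' : ι → List V}
    (h : IsLinkage c R a b s len C E l) (h' : IsLinkage c R a b s' len C' E' l')
    (hs : Disjoint s s') (hd : Disjoint C C') :
    IsLinkage c R a b (s ∪ s') len (C ∪ C') (fun x y => E x y ∨ E' x y)
      (fun i => if i ∈ s then l i else l' i) := by
  have key : ∀ i ∈ s ∪ s', (i ∈ s ∧ (if i ∈ s then l i else l' i) = l i) ∨
      (i ∈ s' ∧ (if i ∈ s then l i else l' i) = l' i) := by
    intro i hi
    rcases Finset.mem_union.1 hi with hi | hi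
    · exact Or.inl ⟨hi, if_pos hi⟩
    · exact Or.inr ⟨hi, if_neg (Finset.disjoint_right.1 hs hi)⟩
  refine ⟨h.emission.union h'.emission hd, ?_, ?_, ?_, ?_, ?_⟩
  · intro i hi
    rcases key i hi with ⟨hi, e⟩ | ⟨hi, e⟩ <;> simp only [e]
    · exact (h.chain i hi).imp fun _ _ => SymmOf.mono fun _ _ => Or.inl
    · exact (h'.chain i hi).imp fun _ _ => SymmOf.mono fun _ _ => Or.inr
  · intro i hi
    rcases key i hi with ⟨hi, e⟩ | ⟨hi, e⟩ <;> simp only [e]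
    · exact h.length i hi
    · exact h'.length i hi
  · intro i hi
    rcases key i hi with ⟨hi, e⟩ | ⟨hi, e⟩ <;> simp only [e] <;> intro x hx
    · exact Finset.mem_union_left _ (h.colour i hi x hx)
    · exact Finset.mem_union_right _ (h'.colour i hi x hx)
  · intro i hi
    rcases key i hi with ⟨hi, e⟩ | ⟨hi, e⟩ <;> simp only [e]
    · exact h.nodup i hi
    · exact h'.nodup i hi
  · intro i hi i' hi' hne
    rcases key i hi with ⟨hi, e⟩ | ⟨hi, e⟩ <;> rcases key i' hi' with ⟨hi', e'⟩ | ⟨hi', e'⟩ <;>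
      simp only [e, e']
    · exact h.disjoint i hi i' hi' hne
    · intro x hx hx'
      exact Finset.disjoint_left.1 hd (h.colour i hi x hx) (h'.colour i' hi' x hx')
    · intro x hx hx'
      exact Finset.disjoint_left.1 hd (h.colour i' hi' x hx') (h'.colour i hi x hx)
    · exact h'.disjoint i hi i' hi' hne

end Linkage

/-! ### Growth of reachable sets under expansion. -/

section Reach

variable {V J : Type*} [Fintype V]

lemma mem_outNbrs {c : V → J} {R : V → V → Prop} {j : J} {S : Finset V} {y : V} :
    y ∈ outNbrs c R j S ↔ c y = j ∧ ∃ x ∈ S, R x y := by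
  classical
  simp [outNbrs]

lemma mem_colourClass {c : V → J} {j : J} {y : V} : y ∈ colourClass c j ↔ c y = j := by
  classical
  simp [colourClass]

variable [DecidableEq V]

/-- The vertices reached from `S` by walks of `R` whose colours are those of `Γ` and which avoid
`B`. -/
noncomputable def reach (c : V → J) (R : V → V → Prop) (B : Finset V) :
    List J → Finset V → Finset V
  | [], S => S
  | j :: Γ, S => reach c R B Γ (outNbrs c R j S \ B)

lemma outNbrs_biUnion {α : Type*} [DecidableEq α] (c : V → J) (R : V → V → Prop) (j : J)
    (B : Finset V) (f : α → Finset V) (A : Finset α) :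
    A.biUnion (fun a => outNbrs c R j (f a) \ B) = outNbrs c R j (A.biUnion f) \ B := by
  ext y
  simp only [Finset.mem_biUnion, Finset.mem_sdiff, mem_outNbrs]
  constructor
  · rintro ⟨a, ha, ⟨h1, x, hx, hR⟩, h2⟩
    exact ⟨⟨h1, x, ⟨a, ha, hx⟩, hR⟩, h2⟩
  · rintro ⟨⟨h1, x, ⟨a, ha, hx⟩, hR⟩, h2⟩
    exact ⟨a, ha, ⟨h1, x, hx, hR⟩, h2⟩

lemma exists_walk_of_mem_reach (c : V → J) (R : V → V → Prop) (B : Finset V) (μ : J) :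
    ∀ (Γ : List J) (S : Finset V) (y : V), y ∈ reach c R B (Γ ++ [μ]) S →
      ∃ x ∈ S, ∃ l : List V, l.map c = Γ ∧ c y = μ ∧ List.IsChain R (x :: (l ++ [y])) ∧
        (∀ z ∈ l, z ∉ B) ∧ y ∉ B := by
  intro Γ
  induction Γ with
  | nil =>
    intro S y hy
    simp only [List.nil_append, reach, Finset.mem_sdiff, mem_outNbrs] at hy
    obtain ⟨⟨h1, x, hx, hR⟩, h2⟩ := hy
    exact ⟨x, hx, [], rfl, h1, by simpa using hR, by simp, h2⟩
  | cons j Γ ih =>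
    intro S y hy
    obtain ⟨x, hx, l, hl, hy, hch, hB, hyB⟩ := ih _ y hy
    simp only [Finset.mem_sdiff, mem_outNbrs] at hx
    obtain ⟨⟨h1, w, hw, hR⟩, h2⟩ := hx
    refine ⟨w, hw, x :: l, by simp [h1, hl], hy, ?_, ?_, hyB⟩
    · simpa using ⟨hR, hch⟩
    · simpa using ⟨h2, hB⟩

/-- While the walks advance one colour, the family of starting sets is halved, keeping the half
whose union is larger. Expansion outweighs this loss, so the union of the reached sets still at
least doubles in each step, or already fills more than half a class. When only one member is left,
it alone reaches more than half of the last class. The exponent `e` counts the doublings already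
made. -/
lemma exists_large_reach [DecidableEq J] {c : V → J} {R : V → V → Prop} {σ β : ℕ}
    (hE : IsExpanding c R σ β) (hβ : β ≤ σ) {B : Finset V} {u : ℕ} (hu : u ≤ β)
    {α : Type*} [DecidableEq α] :
    ∀ (Γ : List J), Γ.Nodup → (∀ j ∈ Γ, (B ∩ colourClass c j).card < β ∧
        (B ∩ colourClass c j).card ≤ u) →
      ∀ (f : α → Finset V) (A : Finset α) (e : ℕ), A.card ≤ 2 ^ Γ.length →
      (∀ a ∈ A, ∀ x ∈ f a, c x ∉ Γ) → u ≤ 4 * (A.biUnion f).card →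
      (2 ^ e ≤ (A.biUnion f).card ∨ σ < 2 * (A.biUnion f).card) → σ < 2 ^ (e + Γ.length) →
      ∃ a ∈ A, σ < 2 * (reach c R B Γ (f a)).card := by
  intro Γ
  induction Γ with
  | nil =>
    intro _ _ f A e hA hc hux hx hσ
    have h2 : σ < 2 * (A.biUnion f).card := by
      rcases hx with h | h
      · simp only [List.length_nil, add_zero] at hσ; omega
      · exact h
    simp only [List.length_nil, pow_zero] at hA
    rcases A.eq_empty_or_nonempty with rfl | ⟨a, ha⟩
    · simp at h2
    · have : A = {a} := by
        have : Nonempty α := ⟨a⟩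
        obtain ⟨b, hb⟩ := Finset.card_le_one_iff_subset_singleton.1 hA
        have hab : a = b := by simpa using hb ha
        subst hab
        exact Finset.Subset.antisymm hb (by simpa using ha)
      subst this
      exact ⟨a, ha, by simpa [reach] using h2⟩
  | cons j Γ ih =>
    intro hnd hB f A e hA hc hux hx hσ
    obtain ⟨A', hA', hcard, hbig⟩ : ∃ A' ⊆ A, A'.card ≤ 2 ^ Γ.length ∧
        (A.biUnion f).card ≤ 2 * (A'.biUnion f).card := by
      obtain ⟨A1, hA1, hA1c⟩ := Finset.exists_subset_card_eq (s := A) (n := A.card / 2) (by omega)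
      have hun : A.biUnion f ⊆ A1.biUnion f ∪ (A \ A1).biUnion f := by
        rw [← Finset.union_biUnion, Finset.union_sdiff_of_subset hA1]
      have h1 := (Finset.card_le_card hun).trans (Finset.card_union_le _ _)
      have h2 := Finset.card_sdiff_add_card_eq_card hA1
      simp only [List.length_cons, pow_succ] at hA
      rcases le_total (A1.biUnion f).card ((A \ A1).biUnion f).card with h | h
      · exact ⟨A \ A1, Finset.sdiff_subset, by omega, by omega⟩
      · exact ⟨A1, hA1, by omega, by omega⟩
    rw [List.nodup_cons] at hnd
    obtain ⟨hb1, hb2⟩ := hB j (by simp)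
    set S := A'.biUnion f with hS
    have hSj : ∀ x ∈ S, c x ≠ j := by
      intro x hx hxj
      obtain ⟨a, ha, hxa⟩ := Finset.mem_biUnion.1 hx
      exact hc a (hA' ha) x hxa (by simp [hxj])
    have hN : (outNbrs c R j S).card ≤
        (outNbrs c R j S \ B).card + (B ∩ colourClass c j).card := by
      have : outNbrs c R j S ⊆ (outNbrs c R j S \ B) ∪ (B ∩ colourClass c j) := by
        intro y hy
        by_cases hyB : y ∈ B
        · exact Finset.mem_union_right _
            (Finset.mem_inter.2 ⟨hyB, mem_colourClass.2 (mem_outNbrs.1 hy).1⟩)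
        · exact Finset.mem_union_left _ (Finset.mem_sdiff.2 ⟨hy, hyB⟩)
      exact (Finset.card_le_card this).trans (Finset.card_union_le _ _)
    have hnew : A'.biUnion (fun a => outNbrs c R j (f a) \ B) = outNbrs c R j S \ B :=
      outNbrs_biUnion c R j B f A'
    -- The retained sets have at least half of the old union, so the factor `16` yields `8` times
    -- the old union. Blocked vertices cost at most `u`, hence at most `4` times the old union, and
    -- a factor `4` survives. In the other alternative fewer than `β` vertices are lost, which
    -- leaves more than `σ / 2`.
    obtain ⟨a, ha, hlarge⟩ := ih hnd.2 (fun j' hj' => hB j' (by simp [hj']))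
      (fun a => outNbrs c R j (f a) \ B) A' (e + 1) hcard
      (by
        intro a ha x hx hxΓ
        rw [Finset.mem_sdiff, mem_outNbrs] at hx
        rw [hx.1.1] at hxΓ
        exact hnd.1 hxΓ)
      (by
        rw [hnew]
        rcases hE.expand j S hSj with h | h <;> omega)
      (by
        rw [hnew]
        rcases hE.expand j S hSj with h | h
        · rcases hx with hx | hx
          · left; rw [pow_succ]; omega
          · right; omega
        · right; omega)
      (by simpa [List.length_cons, add_assoc, add_comm, add_left_comm] using hσ)
    exact ⟨a, hA' ha, hlarge⟩

/-- If a quarter of the starting vertices were bad, `exists_large_reach` applied to the bad ones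
alone would produce a bad vertex with large reach. -/
lemma card_small_reach_lt [DecidableEq J] {c : V → J} {R : V → V → Prop} {σ β : ℕ}
    (hE : IsExpanding c R σ β) (hβ : β ≤ σ) {B : Finset V} {ι : Type*} [DecidableEq ι]
    {a : ι → V} {U : Finset ι} (ha : Set.InjOn a U) (hU : U.card ≤ β) (hU0 : U.Nonempty)
    {Γ : List J} (hΓ : Γ.Nodup) (haΓ : ∀ i ∈ U, c (a i) ∉ Γ)
    (hB : ∀ j ∈ Γ, (B ∩ colourClass c j).card < β ∧ (B ∩ colourClass c j).card ≤ U.card)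
    (hσ : σ < 2 ^ Γ.length) :
    4 * (U.filter fun i => 2 * (reach c R B Γ {a i}).card ≤ σ).card < U.card := by
  by_contra! hcon
  set A := U.filter fun i => 2 * (reach c R B Γ {a i}).card ≤ σ with hA
  have hAU : A ⊆ U := Finset.filter_subset _ _
  have himg : (A.biUnion fun i => ({a i} : Finset V)).card = A.card := by
    rw [Finset.biUnion_singleton, Finset.card_image_of_injOn (ha.mono (by exact_mod_cast hAU))]
  have hU1 := hU0.card_pos
  obtain ⟨i, hi, hlarge⟩ := exists_large_reach hE hβ hU Γ hΓ hB (fun i => {a i}) A 0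
    (by have := Finset.card_le_card hAU; omega)
    (by
      intro i hi x hx
      rw [Finset.mem_singleton.1 hx]
      exact haΓ i (hAU hi))
    (by rw [himg]; exact hcon) (by left; rw [himg, pow_zero]; omega) (by simpa using hσ)
  have := (Finset.mem_filter.1 hi).2
  omega

end Reach

/-! ### Walks from both ends meeting in a middle colour. -/

section Web

variable {V J ι : Type*}

/-- Disjoint directed walks from `a i` (through the colours `Γ₁`) and from `b i` (through the colours
`Γ₂`), for `i ∈ s`, meeting in a vertex `m i` of colour `μ`. -/
structure IsWeb (c : V → J) (R : V → V → Prop) (a b : ι → V) (s : Finset ι) (Γ₁ Γ₂ : List J)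
    (μ : J) (f g : ι → List V) (m : ι → V) : Prop where
  fst : ∀ i ∈ s, List.IsChain R (a i :: (f i ++ [m i]))
  snd : ∀ i ∈ s, List.IsChain R (b i :: (g i ++ [m i]))
  map_fst : ∀ i ∈ s, (f i).map c = Γ₁
  map_snd : ∀ i ∈ s, (g i).map c = Γ₂
  colour_mid : ∀ i ∈ s, c (m i) = μ
  disjoint : ∀ i ∈ s, ∀ i' ∈ s, i ≠ i' →
    List.Disjoint (f i ++ m i :: g i) (f i' ++ m i' :: g i')

lemma eq_or_mem_of_pair_infix {p x y : V} {q : List V} (h : [x, y] <:+: p :: q) :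
    (x = p ∨ x ∈ q) ∧ y ∈ q := by
  rcases List.infix_cons_iff.1 h with h | h
  · obtain ⟨t, ht⟩ := h
    simp only [List.cons_append, List.nil_append, List.cons.injEq] at ht
    obtain ⟨rfl, rfl⟩ := ht
    exact ⟨Or.inl rfl, by simp⟩
  · exact ⟨Or.inr (h.subset (by simp)), h.subset (by simp)⟩

/-- A vertex lies on the walks of one index only, and along these the colours are pairwise distinct.
Only consecutive pairs of the walks are kept as arcs, so two arcs from one vertex into one colour
have the same head. -/
lemma IsWeb.isEmission [DecidableEq J] {c : V → J} {R : V → V → Prop} {a b : ι → V} {s : Finset ι}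
    {Γ₁ Γ₂ : List J} {μ : J} {f g : ι → List V} {m : ι → V} (h : IsWeb c R a b s Γ₁ Γ₂ μ f g m)
    (ha : Set.InjOn a s) (hb : Set.InjOn b s) (hab : ∀ i ∈ s, ∀ i' ∈ s, a i ≠ b i')
    (hΓ : (Γ₁ ++ μ :: Γ₂).Nodup) (haΓ : ∀ i ∈ s, c (a i) ∉ Γ₁ ++ μ :: Γ₂)
    (hbΓ : ∀ i ∈ s, c (b i) ∉ Γ₁ ++ μ :: Γ₂) :
    IsEmission c R (Γ₁ ++ μ :: Γ₂).toFinset (fun x y => ∃ i ∈ s,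
      [x, y] <:+: a i :: (f i ++ [m i]) ∨ [x, y] <:+: b i :: (g i ++ [m i])) := by
  have hcol : ∀ i ∈ s, ∀ x ∈ f i ++ m i :: g i, c x ∈ Γ₁ ++ μ :: Γ₂ := by
    intro i hi x hx
    have := List.mem_map_of_mem (f := c) hx
    simpa only [List.map_append, List.map_cons, h.map_fst i hi, h.map_snd i hi,
      h.colour_mid i hi] using this
  have hnd : ∀ i ∈ s, ((f i ++ m i :: g i).map c).Nodup := by
    intro i hi
    simpa only [List.map_append, List.map_cons, h.map_fst i hi, h.map_snd i hi,
      h.colour_mid i hi] using hΓ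
  have hinj : ∀ i ∈ s, ∀ x ∈ f i ++ m i :: g i, ∀ y ∈ f i ++ m i :: g i, c x = c y → x = y :=
    fun i hi x hx y hy hxy => List.inj_on_of_nodup_map (hnd i hi) hx hy hxy
  have hfin : ∀ x y i, i ∈ s → [x, y] <:+: a i :: (f i ++ [m i]) →
      (x = a i ∨ x ∈ f i ++ m i :: g i) ∧ y ∈ f i ++ [m i] := by
    intro x y i _ hxy
    obtain ⟨h1, h2⟩ := eq_or_mem_of_pair_infix hxy
    refine ⟨h1.imp_right ?_, h2⟩
    simp; tauto
  have hgin : ∀ x y i, i ∈ s → [x, y] <:+: b i :: (g i ++ [m i]) →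
      (x = b i ∨ x ∈ f i ++ m i :: g i) ∧ y ∈ g i ++ [m i] := by
    intro x y i _ hxy
    obtain ⟨h1, h2⟩ := eq_or_mem_of_pair_infix hxy
    refine ⟨h1.imp_right ?_, h2⟩
    simp; tauto
  have hfsub : ∀ i, ∀ y ∈ f i ++ [m i], y ∈ f i ++ m i :: g i := by intro i y; simp; tauto
  have hgsub : ∀ i, ∀ y ∈ g i ++ [m i], y ∈ f i ++ m i :: g i := by intro i y; simp; tauto
  have hin : ∀ x i i', i ∈ s → i' ∈ s → (x = a i ∨ x ∈ f i ++ m i :: g i) →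
      (x = a i' ∨ x ∈ f i' ++ m i' :: g i') → i = i' := by
    intro x i i' hi hi' h1 h2
    rcases h1 with rfl | h1 <;> rcases h2 with h2 | h2
    · exact ha hi hi' h2
    · exact absurd (hcol i' hi' _ h2) (haΓ i hi)
    · subst h2; exact absurd (hcol i hi _ h1) (haΓ i' hi')
    · by_contra hne; exact h.disjoint i hi i' hi' hne h1 h2
  have hin' : ∀ x i i', i ∈ s → i' ∈ s → (x = b i ∨ x ∈ f i ++ m i :: g i) →
      (x = b i' ∨ x ∈ f i' ++ m i' :: g i') → i = i' := by
    intro x i i' hi hi' h1 h2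
    rcases h1 with rfl | h1 <;> rcases h2 with h2 | h2
    · exact hb hi hi' h2
    · exact absurd (hcol i' hi' _ h2) (hbΓ i hi)
    · subst h2; exact absurd (hcol i hi _ h1) (hbΓ i' hi')
    · by_contra hne; exact h.disjoint i hi i' hi' hne h1 h2
  have hin'' : ∀ x i i', i ∈ s → i' ∈ s → (x = a i ∨ x ∈ f i ++ m i :: g i) →
      (x = b i' ∨ x ∈ f i' ++ m i' :: g i') → i = i' := by
    intro x i i' hi hi' h1 h2
    rcases h1 with rfl | h1 <;> rcases h2 with h2 | h2
    · exact absurd h2 (hab i hi i' hi')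
    · exact absurd (hcol i' hi' _ h2) (haΓ i hi)
    · subst h2; exact absurd (hcol i hi _ h1) (hbΓ i' hi')
    · by_contra hne; exact h.disjoint i hi i' hi' hne h1 h2
  refine ⟨?_, ?_, ?_⟩
  · rintro x y ⟨i, hi, hxy | hxy⟩
    · exact List.isChain_pair.1 ((h.fst i hi).infix hxy)
    · exact List.isChain_pair.1 ((h.snd i hi).infix hxy)
  · rintro x y ⟨i, hi, hxy | hxy⟩
    · exact List.mem_toFinset.2 (hcol i hi y (hfsub i y (hfin x y i hi hxy).2))
    · exact List.mem_toFinset.2 (hcol i hi y (hgsub i y (hgin x y i hi hxy).2))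
  · rintro x y y' ⟨i, hi, hxy | hxy⟩ ⟨i', hi', hxy' | hxy'⟩ hc
    · obtain ⟨h1, h2⟩ := hfin x y i hi hxy
      obtain ⟨h1', h2'⟩ := hfin x y' i' hi' hxy'
      obtain rfl := hin x i i' hi hi' h1 h1'
      exact hinj i hi y (hfsub i y h2) y' (hfsub i y' h2') hc
    · obtain ⟨h1, h2⟩ := hfin x y i hi hxy
      obtain ⟨h1', h2'⟩ := hgin x y' i' hi' hxy'
      obtain rfl := hin'' x i i' hi hi' h1 h1'
      exact hinj i hi y (hfsub i y h2) y' (hgsub i y' h2') hc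
    · obtain ⟨h1, h2⟩ := hgin x y i hi hxy
      obtain ⟨h1', h2'⟩ := hfin x y' i' hi' hxy'
      obtain rfl := hin'' x i' i hi' hi h1' h1
      exact hinj _ hi y (hgsub _ y h2) y' (hfsub _ y' h2') hc
    · obtain ⟨h1, h2⟩ := hgin x y i hi hxy
      obtain ⟨h1', h2'⟩ := hgin x y' i' hi' hxy'
      obtain rfl := hin' x i i' hi hi' h1 h1'
      exact hinj i hi y (hgsub i y h2) y' (hgsub i y' h2') hc

lemma IsWeb.isLinkage [DecidableEq J] {c : V → J} {R : V → V → Prop} {a b : ι → V} {s : Finset ι}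
    {Γ₁ Γ₂ : List J} {μ : J} {f g : ι → List V} {m : ι → V} (h : IsWeb c R a b s Γ₁ Γ₂ μ f g m)
    (ha : Set.InjOn a s) (hb : Set.InjOn b s) (hab : ∀ i ∈ s, ∀ i' ∈ s, a i ≠ b i')
    (hΓ : (Γ₁ ++ μ :: Γ₂).Nodup) (haΓ : ∀ i ∈ s, c (a i) ∉ Γ₁ ++ μ :: Γ₂)
    (hbΓ : ∀ i ∈ s, c (b i) ∉ Γ₁ ++ μ :: Γ₂) :
    ∃ E l, IsLinkage c R a b s (fun _ => Γ₁.length + 1 + Γ₂.length)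
      (Γ₁ ++ μ :: Γ₂).toFinset E l := by
  have hmap : ∀ i ∈ s, (f i ++ m i :: g i).map c = Γ₁ ++ μ :: Γ₂ := by
    intro i hi
    simp only [List.map_append, List.map_cons, h.map_fst i hi, h.map_snd i hi, h.colour_mid i hi]
  have hperm : ∀ i, List.Perm (f i ++ m i :: (g i).reverse) (f i ++ m i :: g i) := fun i =>
    (List.Perm.cons _ (List.reverse_perm _)).append_left _
  refine ⟨_, fun i => f i ++ m i :: (g i).reverse, h.isEmission ha hb hab hΓ haΓ hbΓ,
    ?_, ?_, ?_, ?_, ?_⟩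
  · intro i hi
    -- The walk from `b i` is run backwards after the meeting point; this is why the arcs have to be
    -- symmetrised.
    have e : a i :: (f i ++ m i :: (g i).reverse ++ [b i]) =
        a i :: (f i ++ m i :: ((g i).reverse ++ [b i])) := by simp
    rw [e, List.isChain_cons_split]
    constructor
    · exact (List.isChain_isInfix _).imp fun x y hxy => Or.inl ⟨i, hi, Or.inl hxy⟩
    · have e2 : m i :: ((g i).reverse ++ [b i]) = (b i :: (g i ++ [m i])).reverse := by simp
      rw [e2, List.isChain_reverse]
      exact (List.isChain_isInfix _).imp fun x y hxy => Or.inr ⟨i, hi, Or.inr hxy⟩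
  · intro i hi
    have := congrArg List.length (hmap i hi)
    simp only [List.length_map, List.length_append, List.length_cons] at this
    simp only [List.length_append, List.length_cons, List.length_reverse]
    omega
  · intro i hi x hx
    rw [List.mem_toFinset, ← hmap i hi]
    exact List.mem_map_of_mem ((hperm i).mem_iff.1 hx)
  · intro i hi
    rw [(hperm i).nodup_iff]
    exact List.Nodup.of_map c (by rw [hmap i hi]; exact hΓ)
  · intro i hi i' hi' hne x hx hx'
    exact h.disjoint i hi i' hi' hne ((hperm i).mem_iff.1 hx) ((hperm i').mem_iff.1 hx')

/-- Each finished path visits every colour at most once. Hence the blocked part of a class is no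
larger than the number of finished paths. -/
lemma IsWeb.card_used_le [Fintype V] [DecidableEq V] {c : V → J} {R : V → V → Prop}
    {a b : ι → V} {s : Finset ι}
    {Γ₁ Γ₂ : List J} {μ : J} {f g : ι → List V} {m : ι → V} (h : IsWeb c R a b s Γ₁ Γ₂ μ f g m)
    (hΓ : (Γ₁ ++ μ :: Γ₂).Nodup) (j : J) :
    (s.biUnion (fun i => (f i ++ m i :: g i).toFinset) ∩ colourClass c j).card ≤ s.card := by
  classical
  rw [Finset.biUnion_inter]
  refine (Finset.card_biUnion_le_card_mul _ _ 1 fun i hi => ?_).trans (by simp)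
  rw [Finset.card_le_one]
  intro x hx y hy
  rw [Finset.mem_inter, List.mem_toFinset, mem_colourClass] at hx hy
  refine List.inj_on_of_nodup_map (f := c) (l := f i ++ m i :: g i) ?_ hx.1 hy.1
    (hx.2.trans hy.2.symm)
  simpa only [List.map_append, List.map_cons, h.map_fst i hi, h.map_snd i hi,
      h.colour_mid i hi] using hΓ

/-- As long as fewer than half of the pairs are linked, the blocked vertices in each class are fewer
than the waiting pairs, and the expansion estimate applies to these. -/
lemma IsWeb.extend [Fintype V] [DecidableEq V] [DecidableEq J] [DecidableEq ι]
    {c : V → J} {R : V → V → Prop} {σ β : ℕ} (hE : IsExpanding c R σ β) (hβ : β ≤ σ)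
    {a b : ι → V} {s I₀ : Finset ι}
    {Γ₁ Γ₂ : List J} {μ : J} {f g : ι → List V} {m : ι → V} (h : IsWeb c R a b s Γ₁ Γ₂ μ f g m)
    (ha : Set.InjOn a I₀) (hb : Set.InjOn b I₀)
    (hΓ : (Γ₁ ++ μ :: Γ₂).Nodup) (haΓ : ∀ i ∈ I₀, c (a i) ∉ Γ₁ ++ μ :: Γ₂)
    (hbΓ : ∀ i ∈ I₀, c (b i) ∉ Γ₁ ++ μ :: Γ₂) (hs : s ⊆ I₀) (hs2 : 2 * s.card < I₀.card)
    (hI : I₀.card ≤ β) (h1 : σ < 2 ^ (Γ₁.length + 1)) (h2 : σ < 2 ^ (Γ₂.length + 1)) :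
    ∃ i ∈ I₀, i ∉ s ∧ ∃ f' g' m', IsWeb c R a b (insert i s) Γ₁ Γ₂ μ f' g' m' := by
  set U := I₀ \ s with hU
  have hUc : U.card + s.card = I₀.card := Finset.card_sdiff_add_card_eq_card hs
  have hUsub : U ⊆ I₀ := Finset.sdiff_subset
  have hU0 : U.Nonempty := by rw [← Finset.card_pos]; omega
  set B := s.biUnion (fun i => (f i ++ m i :: g i).toFinset) with hB
  have hBc : ∀ j, (B ∩ colourClass c j).card < β ∧ (B ∩ colourClass c j).card ≤ U.card := by
    intro j
    have : (B ∩ colourClass c j).card ≤ s.card := h.card_used_le hΓ j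
    constructor <;> omega
  have hΓ1 : (Γ₁ ++ [μ]).Nodup := by
    refine hΓ.sublist ?_
    simp
  have hΓ2 : (Γ₂ ++ [μ]).Nodup := by
    have : (μ :: Γ₂).Nodup := hΓ.sublist (by simp)
    rw [List.nodup_append_comm]; simpa using this
  have hba := card_small_reach_lt hE hβ (B := B) (ha.mono (by exact_mod_cast hUsub))
    (by omega) hU0 hΓ1
    (fun i hi hmem => haΓ i (hUsub hi) (by simp at hmem ⊢; tauto)) (fun j _ => hBc j)
    (by simpa using h1)
  have hbb := card_small_reach_lt hE hβ (B := B) (hb.mono (by exact_mod_cast hUsub))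
    (by omega) hU0 hΓ2
    (fun i hi hmem => hbΓ i (hUsub hi) (by simp at hmem ⊢; tauto)) (fun j _ => hBc j)
    (by simpa using h2)
  -- Fewer than a quarter of the waiting indices fail on the `a` side, and likewise on the `b` side.
  obtain ⟨i, hiU, hia, hib⟩ : ∃ i ∈ U, σ < 2 * (reach c R B (Γ₁ ++ [μ]) {a i}).card ∧
      σ < 2 * (reach c R B (Γ₂ ++ [μ]) {b i}).card := by
    by_contra! hcon
    have hsub : U ⊆ (U.filter fun i => 2 * (reach c R B (Γ₁ ++ [μ]) {a i}).card ≤ σ) ∪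
        (U.filter fun i => 2 * (reach c R B (Γ₂ ++ [μ]) {b i}).card ≤ σ) := by
      intro i hi
      rw [Finset.mem_union, Finset.mem_filter, Finset.mem_filter]
      by_cases hh : 2 * (reach c R B (Γ₁ ++ [μ]) {a i}).card ≤ σ
      · exact Or.inl ⟨hi, hh⟩
      · exact Or.inr ⟨hi, hcon i hi (not_le.1 hh)⟩
    have := (Finset.card_le_card hsub).trans (Finset.card_union_le _ _)
    omega
  have hiI : i ∈ I₀ := hUsub hiU
  have his : i ∉ s := (Finset.mem_sdiff.1 hiU).2
  -- Both reached sets exceed `σ / 2` inside one class of at most `σ` vertices, so they intersect.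
  obtain ⟨y, hya, hyb⟩ : ∃ y, y ∈ reach c R B (Γ₁ ++ [μ]) {a i} ∧
      y ∈ reach c R B (Γ₂ ++ [μ]) {b i} := by
    by_contra! hcon
    have hdis : Disjoint (reach c R B (Γ₁ ++ [μ]) {a i}) (reach c R B (Γ₂ ++ [μ]) {b i}) :=
      Finset.disjoint_left.2 hcon
    have hsub : reach c R B (Γ₁ ++ [μ]) {a i} ∪ reach c R B (Γ₂ ++ [μ]) {b i} ⊆
        colourClass c μ := by
      intro y hy
      rw [mem_colourClass]
      rcases Finset.mem_union.1 hy with hy | hy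
      · obtain ⟨_, _, _, _, hc, _⟩ := exists_walk_of_mem_reach c R B μ _ _ _ hy
        exact hc
      · obtain ⟨_, _, _, _, hc, _⟩ := exists_walk_of_mem_reach c R B μ _ _ _ hy
        exact hc
    have hle := (Finset.card_le_card hsub).trans (hE.card_class_le μ)
    rw [Finset.card_union_of_disjoint hdis] at hle
    omega
  obtain ⟨x1, hx1, l1, hl1, hy1, hch1, hB1, hyB⟩ := exists_walk_of_mem_reach c R B μ _ _ _ hya
  obtain ⟨x2, hx2, l2, hl2, hy2, hch2, hB2, -⟩ := exists_walk_of_mem_reach c R B μ _ _ _ hyb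
  obtain rfl := Finset.mem_singleton.1 hx1
  obtain rfl := Finset.mem_singleton.1 hx2
  have hnew : ∀ z ∈ l1 ++ y :: l2, z ∉ B := by
    intro z hz
    rcases List.mem_append.1 hz with hz | hz
    · exact hB1 z hz
    · rcases List.mem_cons.1 hz with rfl | hz
      · exact hyB
      · exact hB2 z hz
  have hnew' : ∀ i' ∈ s, ∀ z ∈ l1 ++ y :: l2, z ∉ f i' ++ m i' :: g i' := fun i' hi' z hz hz' =>
    hnew z hz (Finset.mem_biUnion.2 ⟨i', hi', List.mem_toFinset.2 hz'⟩)
  have hne : ∀ i' ∈ s, i' ≠ i := fun i' hi' e => his (e ▸ hi')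
  refine ⟨i, hiI, his, Function.update f i l1, Function.update g i l2, Function.update m i y,
    ?_, ?_, ?_, ?_, ?_, ?_⟩
  · intro i' hi'
    rcases Finset.mem_insert.1 hi' with rfl | hi'
    · simpa using hch1
    · simpa [Function.update_of_ne (hne i' hi')] using h.fst i' hi'
  · intro i' hi'
    rcases Finset.mem_insert.1 hi' with rfl | hi'
    · simpa using hch2
    · simpa [Function.update_of_ne (hne i' hi')] using h.snd i' hi'
  · intro i' hi'
    rcases Finset.mem_insert.1 hi' with rfl | hi'
    · simpa using hl1
    · simpa [Function.update_of_ne (hne i' hi')] using h.map_fst i' hi'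
  · intro i' hi'
    rcases Finset.mem_insert.1 hi' with rfl | hi'
    · simpa using hl2
    · simpa [Function.update_of_ne (hne i' hi')] using h.map_snd i' hi'
  · intro i' hi'
    rcases Finset.mem_insert.1 hi' with rfl | hi'
    · simpa using hy1
    · simpa [Function.update_of_ne (hne i' hi')] using h.colour_mid i' hi'
  · intro i1 hi1 i2 hi2 h12
    rcases Finset.mem_insert.1 hi1 with rfl | hi1' <;> rcases Finset.mem_insert.1 hi2 with rfl | hi2'
    · exact absurd rfl h12
    · simp only [Function.update_self, Function.update_of_ne (hne i2 hi2')]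
      exact fun z hz hz' => hnew' i2 hi2' z hz hz'
    · simp only [Function.update_self, Function.update_of_ne (hne i1 hi1')]
      exact fun z hz hz' => hnew' i1 hi1' z hz' hz
    · simp only [Function.update_of_ne (hne i1 hi1'), Function.update_of_ne (hne i2 hi2')]
      exact h.disjoint i1 hi1' i2 hi2' h12

/-- One round of linking: at least half of the pairs can be linked. -/
lemma exists_linkage_half [Fintype V] [DecidableEq V] [DecidableEq J] [DecidableEq ι]
    {c : V → J} {R : V → V → Prop} {σ β : ℕ} (hE : IsExpanding c R σ β) (hβ : β ≤ σ)
    {a b : ι → V} {I₀ : Finset ι} {Γ₁ Γ₂ : List J} {μ : J}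
    (ha : Set.InjOn a I₀) (hb : Set.InjOn b I₀) (hab : ∀ i ∈ I₀, ∀ i' ∈ I₀, a i ≠ b i')
    (hΓ : (Γ₁ ++ μ :: Γ₂).Nodup) (haΓ : ∀ i ∈ I₀, c (a i) ∉ Γ₁ ++ μ :: Γ₂)
    (hbΓ : ∀ i ∈ I₀, c (b i) ∉ Γ₁ ++ μ :: Γ₂)
    (hI : I₀.card ≤ β) (h1 : σ < 2 ^ (Γ₁.length + 1)) (h2 : σ < 2 ^ (Γ₂.length + 1)) :
    ∃ s ⊆ I₀, I₀.card ≤ 2 * s.card ∧ ∃ E l, IsLinkage c R a b s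
      (fun _ => Γ₁.length + 1 + Γ₂.length) (Γ₁ ++ μ :: Γ₂).toFinset E l := by
  have key : ∀ k, 2 * k ≤ I₀.card + 1 → ∃ s ⊆ I₀, s.card = k ∧
      ∃ f g m, IsWeb c R a b s Γ₁ Γ₂ μ f g m := by
    intro k
    induction k with
    | zero =>
      intro _
      exact ⟨∅, by simp, by simp, fun _ => [], fun _ => [], a, by constructor <;> simp⟩
    | succ k ih =>
      intro hk
      obtain ⟨s, hs, hsc, f, g, m, hw⟩ := ih (by omega)
      obtain ⟨i, hi, his, f', g', m', hw'⟩ := hw.extend hE hβ ha hb hΓ haΓ hbΓ hs (by omega) hI h1 h2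
      exact ⟨insert i s, Finset.insert_subset hi hs, by rw [Finset.card_insert_of_notMem his, hsc],
        f', g', m', hw'⟩
  obtain ⟨s, hs, hsc, f, g, m, hw⟩ := key ((I₀.card + 1) / 2) (by omega)
  exact ⟨s, hs, by omega, hw.isLinkage (ha.mono (by exact_mod_cast hs))
    (hb.mono (by exact_mod_cast hs))
    (fun i hi i' hi' => hab i (hs hi) i' (hs hi')) hΓ (fun i hi => haΓ i (hs hi))
    (fun i hi => hbΓ i (hs hi))⟩

end Web

/-! ### Linking all pairs, in rounds and in batches. -/

section Batches

variable {V J ι : Type*}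

lemma exists_nodup_split {C : Finset J} [DecidableEq J] {p q : ℕ} (h : p + 1 + q ≤ C.card) :
    ∃ Γ₁ μ Γ₂, (Γ₁ ++ μ :: Γ₂).Nodup ∧ Γ₁.length = p ∧ Γ₂.length = q ∧
      (Γ₁ ++ μ :: Γ₂).toFinset ⊆ C := by
  obtain ⟨D, hD, hDc⟩ := Finset.exists_subset_card_eq h
  have hlen : D.toList.length = p + 1 + q := by rw [Finset.length_toList, hDc]
  have hp : p < D.toList.length := by omega
  have hsplit : D.toList.take p ++ D.toList[p] :: D.toList.drop (p + 1) = D.toList := by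
    rw [← List.drop_eq_getElem_cons hp, List.take_append_drop]
  refine ⟨D.toList.take p, D.toList[p], D.toList.drop (p + 1), ?_, ?_, ?_, ?_⟩
  · rw [hsplit]; exact D.nodup_toList
  · rw [List.length_take]; omega
  · rw [List.length_drop]; omega
  · rw [hsplit, Finset.toList_toFinset]; exact hD

variable [Fintype V] [DecidableEq V] [DecidableEq J] [DecidableEq ι]

/-- Each round links at least half of the waiting pairs and spends `p + 1 + q` fresh colours, so `k`
rounds exhaust fewer than `2 ^ k` pairs. -/
lemma exists_linkage_batch
    {c : V → J} {R : V → V → Prop} {σ β : ℕ} (hE : IsExpanding c R σ β) (hβ : β ≤ σ)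
    {a b : ι → V} {p q : ℕ} (h1 : σ < 2 ^ (p + 1)) (h2 : σ < 2 ^ (q + 1)) :
    ∀ (k : ℕ) (C : Finset J) (I : Finset ι), Set.InjOn a I → Set.InjOn b I →
      (∀ i ∈ I, ∀ i' ∈ I, a i ≠ b i') → (∀ i ∈ I, c (a i) ∉ C) → (∀ i ∈ I, c (b i) ∉ C) →
      I.card ≤ β → I.card < 2 ^ k → k * (p + 1 + q) ≤ C.card →
      ∃ E l, IsLinkage c R a b I (fun _ => p + 1 + q) C E l := by
  intro k
  induction k with
  | zero =>
    intro C I _ _ _ _ _ _ hI _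
    obtain rfl : I = ∅ := by rw [← Finset.card_eq_zero]; simpa using hI
    exact ⟨_, _, isLinkage_empty c R a b _ C⟩
  | succ k ih =>
    intro C I ha hb hab haC hbC hIβ hI hC
    rw [Nat.succ_mul] at hC
    obtain ⟨Γ₁, μ, Γ₂, hnd, hl1, hl2, hsub⟩ := exists_nodup_split (C := C) (p := p) (q := q)
      (by omega)
    obtain ⟨s, hs, hsc, E, l, hl⟩ := exists_linkage_half hE hβ ha hb hab hnd
      (fun i hi hm => haC i hi (hsub (List.mem_toFinset.2 hm)))
      (fun i hi hm => hbC i hi (hsub (List.mem_toFinset.2 hm))) hIβ (by rwa [hl1]) (by rwa [hl2])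
    have hsI := Finset.card_sdiff_add_card_eq_card hs
    have hcardΓ : (Γ₁ ++ μ :: Γ₂).toFinset.card = p + 1 + q := by
      rw [List.toFinset_card_of_nodup hnd]; simp; omega
    have hCs := Finset.card_sdiff_add_card_eq_card hsub
    have hss : I \ s ⊆ I := Finset.sdiff_subset
    obtain ⟨E', l', hl'⟩ := ih (C \ (Γ₁ ++ μ :: Γ₂).toFinset) (I \ s)
      (ha.mono (by exact_mod_cast hss)) (hb.mono (by exact_mod_cast hss))
      (fun i hi i' hi' => hab i (hss hi) i' (hss hi'))
      (fun i hi hm => haC i (hss hi) (Finset.sdiff_subset hm))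
      (fun i hi hm => hbC i (hss hi) (Finset.sdiff_subset hm))
      (by omega) (by rw [pow_succ] at hI; omega) (by omega)
    rw [hl1, hl2] at hl
    have hfin := hl.union hl' Finset.disjoint_sdiff Finset.disjoint_sdiff
    rw [Finset.union_sdiff_of_subset hs, Finset.union_sdiff_of_subset hsub] at hfin
    exact ⟨_, _, hfin⟩

/-- Any pairs `(a i, b i)` can be linked by disjoint paths through sufficiently many fresh
colours, each path having exactly `p + 1 + q` interior vertices. -/
lemma exists_linkage
    {c : V → J} {R : V → V → Prop} {σ β : ℕ} (hE : IsExpanding c R σ β) (hβ : β ≤ σ)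
    {a b : ι → V} {p q k : ℕ} (h1 : σ < 2 ^ (p + 1)) (h2 : σ < 2 ^ (q + 1)) (hk : β < 2 ^ k) :
    ∀ (B : ℕ) (C : Finset J) (I : Finset ι), Set.InjOn a I → Set.InjOn b I →
      (∀ i ∈ I, ∀ i' ∈ I, a i ≠ b i') → (∀ i ∈ I, c (a i) ∉ C) → (∀ i ∈ I, c (b i) ∉ C) →
      I.card ≤ B * β → B * k * (p + 1 + q) ≤ C.card →
      ∃ E l, IsLinkage c R a b I (fun _ => p + 1 + q) C E l := by
  intro B
  induction B with
  | zero =>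
    intro C I _ _ _ _ _ hI _
    obtain rfl : I = ∅ := by rw [← Finset.card_eq_zero]; simpa using hI
    exact ⟨_, _, isLinkage_empty c R a b _ C⟩
  | succ B ih =>
    intro C I ha hb hab haC hbC hI hC
    rw [Nat.succ_mul, Nat.add_mul] at hC
    rw [Nat.succ_mul] at hI
    -- A batch may contain at most `β` pairs, because the blocked vertices of a class must not use
    -- up the surplus over one half.
    obtain ⟨s, hs, hsc⟩ := Finset.exists_subset_card_eq (s := I) (n := min β I.card)
      (min_le_right _ _)
    obtain ⟨D, hD, hDc⟩ := Finset.exists_subset_card_eq (s := C) (n := k * (p + 1 + q)) (by omega)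
    have hsI := Finset.card_sdiff_add_card_eq_card hs
    have hDI := Finset.card_sdiff_add_card_eq_card hD
    have hss : I \ s ⊆ I := Finset.sdiff_subset
    obtain ⟨E, l, hl⟩ := exists_linkage_batch hE hβ h1 h2 k D s (ha.mono (by exact_mod_cast hs))
      (hb.mono (by exact_mod_cast hs)) (fun i hi i' hi' => hab i (hs hi) i' (hs hi'))
      (fun i hi hm => haC i (hs hi) (hD hm)) (fun i hi hm => hbC i (hs hi) (hD hm))
      (by omega) (by omega) hDc.ge
    obtain ⟨E', l', hl'⟩ := ih (C \ D) (I \ s)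
      (ha.mono (by exact_mod_cast hss)) (hb.mono (by exact_mod_cast hss))
      (fun i hi i' hi' => hab i (hss hi) i' (hss hi'))
      (fun i hi hm => haC i (hss hi) (Finset.sdiff_subset hm))
      (fun i hi hm => hbC i (hss hi) (Finset.sdiff_subset hm))
      (by omega) (by omega)
    have hfin := hl.union hl' Finset.disjoint_sdiff Finset.disjoint_sdiff
    rw [Finset.union_sdiff_of_subset hs, Finset.union_sdiff_of_subset hD] at hfin
    exact ⟨_, _, hfin⟩

end Batches

/-! ### Covering most vertices by matchings between consecutive layers. -/

section Layers

variable {V J : Type*} [Fintype V] [DecidableEq V]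

/-- Two equally large sets containing a colour class each can be matched perfectly. -/
lemma exists_layer_matching {c : V → J} {R : V → V → Prop} {σ β : ℕ} (hE : IsExpanding c R σ β)
    {L L' : Finset V} {j j' : J} (hL : L.card = σ) (hL' : L'.card = σ) (hd : Disjoint L L')
    (hj : colourClass c j ⊆ L) (hj' : colourClass c j' ⊆ L') {I : Type*} [Fintype I]
    {f : I → V} (hf : Function.Injective f) (hfL : ∀ x, x ∈ L ↔ ∃ i, f i = x) :
    ∃ g : I → V, Function.Injective g ∧ (∀ x, x ∈ L' ↔ ∃ i, g i = x) ∧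
      ∀ i, (R (f i) (g i) ∧ c (g i) = j') ∨ (R (g i) (f i) ∧ c (f i) = j) := by
  classical
  set t : I → Finset V := fun i => L'.filter fun y =>
    (R (f i) y ∧ c y = j') ∨ (R y (f i) ∧ c (f i) = j) with ht
  have hall : ∀ S : Finset I, S.card ≤ (S.biUnion t).card := by
    intro S
    set N := S.biUnion t with hN
    have hNL : N ⊆ L' := Finset.biUnion_subset.2 fun i _ => Finset.filter_subset _ _
    set S' := S.image f with hS'
    have hS'c : S'.card = S.card := Finset.card_image_of_injective _ hf
    have hS'L : S' ⊆ L := by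
      intro x hx
      obtain ⟨i, _, rfl⟩ := Finset.mem_image.1 hx
      exact (hfL _).2 ⟨i, rfl⟩
    have hout : outNbrs c R j' S' ⊆ N := by
      intro y hy
      obtain ⟨hc, x, hx, hR⟩ := mem_outNbrs.1 hy
      obtain ⟨i, hi, rfl⟩ := Finset.mem_image.1 hx
      exact Finset.mem_biUnion.2 ⟨i, hi, Finset.mem_filter.2
        ⟨hj' (mem_colourClass.2 hc), Or.inl ⟨hR, hc⟩⟩⟩
    have houtc := Finset.card_le_card hout
    by_contra! hlt
    -- In a violation `|N| < |S'|` of Hall's condition neither `S'` nor `L' \ N` can expand by the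
    -- factor `16`, as `|L \ S'| < |L' \ N|` too. So both `N` and `L \ S'` have at least `σ / 2 + β`
    -- elements, although their sizes add up to less than `σ`.
    have h1 := hE.expand j' S' fun x hx hc =>
      Finset.disjoint_left.1 hd (hS'L hx) (hj' (mem_colourClass.2 hc))
    have hT := Finset.card_sdiff_add_card_eq_card hNL
    have hLS := Finset.card_sdiff_add_card_eq_card hS'L
    -- An arc from outside `N` back into `S'` with head of colour `j` would put its tail into `N`.
    have hin : outNbrs c R j (L' \ N) ⊆ L \ S' := by
      intro y hy
      obtain ⟨hc, x, hx, hR⟩ := mem_outNbrs.1 hy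
      rw [Finset.mem_sdiff] at hx ⊢
      refine ⟨hj (mem_colourClass.2 hc), fun hyS => hx.2 ?_⟩
      obtain ⟨i, hi, rfl⟩ := Finset.mem_image.1 hyS
      exact Finset.mem_biUnion.2 ⟨i, hi, Finset.mem_filter.2 ⟨hx.1, Or.inr ⟨hR, hc⟩⟩⟩
    have hinc := Finset.card_le_card hin
    have h2 := hE.expand j (L' \ N) fun x hx hc =>
      Finset.disjoint_right.1 hd (Finset.mem_sdiff.1 hx).1 (hj (mem_colourClass.2 hc))
    omega
  obtain ⟨g, hg, hgt⟩ := (Finset.all_card_le_biUnion_card_iff_exists_injective t).1 hall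
  have hgL : ∀ i, g i ∈ L' := fun i => (Finset.mem_filter.1 (hgt i)).1
  refine ⟨g, hg, ?_, fun i => (Finset.mem_filter.1 (hgt i)).2⟩
  have hcardI : Fintype.card I = σ := by
    rw [← hL, ← Finset.card_univ, ← Finset.card_image_of_injective _ hf]
    congr 1
    ext x
    simp [hfL]
  have himg : Finset.univ.image g = L' := by
    refine Finset.eq_of_subset_of_card_le ?_ ?_
    · intro x hx
      obtain ⟨i, _, rfl⟩ := Finset.mem_image.1 hx
      exact hgL i
    · rw [Finset.card_image_of_injective _ hg, Finset.card_univ, hcardI, hL']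
  intro x
  rw [← himg]
  simp

/-- The matchings between neighbouring layers are composed, so that every layer is indexed by the
same set `I` and the index names the path. -/
lemma exists_layer_system {c : V → J} {R : V → V → Prop} {σ β : ℕ} (hE : IsExpanding c R σ β)
    {L : ℕ → Finset V} {j : ℕ → J} {I : Type*} [Fintype I]
    {f : I → V} (hf : Function.Injective f) (hfL : ∀ x, x ∈ L 0 ↔ ∃ i, f i = x) :
    ∀ k : ℕ, (∀ l ≤ k, (L l).card = σ) → (∀ l ≤ k, colourClass c (j l) ⊆ L l) →
      (∀ l ≤ k, ∀ l' ≤ k, l ≠ l' → Disjoint (L l) (L l')) →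
      ∃ g : ℕ → I → V, g 0 = f ∧
        (∀ l ≤ k, Function.Injective (g l) ∧ ∀ x, x ∈ L l ↔ ∃ i, g l i = x) ∧
        ∀ l < k, ∀ i, (R (g l i) (g (l + 1) i) ∧ c (g (l + 1) i) = j (l + 1)) ∨
          (R (g (l + 1) i) (g l i) ∧ c (g l i) = j l) := by
  intro k
  induction k with
  | zero =>
    intro _ _ _
    refine ⟨fun _ => f, rfl, ?_, by simp⟩
    intro l hl
    obtain rfl : l = 0 := by omega
    exact ⟨hf, hfL⟩
  | succ k ih =>
    intro hcard hsub hdis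
    obtain ⟨g, hg0, hg, harc⟩ := ih (fun l hl => hcard l (by omega)) (fun l hl => hsub l (by omega))
      (fun l hl l' hl' => hdis l (by omega) l' (by omega))
    obtain ⟨g', hg'inj, hg'L, hg'⟩ := exists_layer_matching hE (hcard k (by omega))
      (hcard (k + 1) le_rfl) (hdis k (by omega) (k + 1) le_rfl (by omega)) (hsub k (by omega))
      (hsub (k + 1) le_rfl) (hg k le_rfl).1 (hg k le_rfl).2
    refine ⟨Function.update g (k + 1) g', ?_, ?_, ?_⟩
    · rw [Function.update_of_ne (by omega), hg0]
    · intro l hl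
      rcases Nat.lt_or_ge k l with h | h
      · obtain rfl : l = k + 1 := by omega
        simpa using ⟨hg'inj, hg'L⟩
      · rw [Function.update_of_ne (by omega)]
        exact hg l h
    · intro l hl i
      rcases Nat.lt_or_ge l k with h | h
      · rw [Function.update_of_ne (by omega), Function.update_of_ne (by omega)]
        exact harc l h i
      · obtain rfl : l = k := by omega
        rw [Function.update_of_ne (by omega), Function.update_self]
        exact hg' i

/-- Disjoint paths from the layer `L 0` to the layer `L (m + 1)` that together pass through every
vertex of the layers in between. -/
lemma exists_layer_paths [DecidableEq J] {c : V → J} {R : V → V → Prop} {σ β : ℕ}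
    (hE : IsExpanding c R σ β)
    {L : ℕ → Finset V} {j : ℕ → J} {I : Type*} [Fintype I]
    {f : I → V} (hf : Function.Injective f) (hfL : ∀ x, x ∈ L 0 ↔ ∃ i, f i = x) (m : ℕ)
    (hcard : ∀ l ≤ m + 1, (L l).card = σ) (hsub : ∀ l ≤ m + 1, colourClass c (j l) ⊆ L l)
    (hdis : ∀ l ≤ m + 1, ∀ l' ≤ m + 1, l ≠ l' → Disjoint (L l) (L l'))
    (hj : ∀ l ≤ m + 1, ∀ l' ≤ m + 1, j l = j l' → l = l') :
    ∃ (E : V → V → Prop) (D : I → List V) (e : I → V),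
      IsEmission c R ((Finset.range (m + 2)).image j) E ∧ Function.Injective e ∧
      (∀ i, e i ∈ L (m + 1)) ∧ (∀ i, List.IsChain (SymmOf E) (f i :: (D i ++ [e i]))) ∧
      (∀ i, (D i).Nodup) ∧ (∀ i i', i ≠ i' → List.Disjoint (D i) (D i')) ∧
      ∀ x, (∃ i, x ∈ D i) ↔ ∃ l, l < m ∧ x ∈ L (l + 1) := by
  obtain ⟨g, hg0, hg, harc⟩ := exists_layer_system (j := j) hE hf hfL (m + 1) hcard hsub hdis
  have hgL : ∀ l ≤ m + 1, ∀ i, g l i ∈ L l := fun l hl i => ((hg l hl).2 _).2 ⟨i, rfl⟩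
  have hginj : ∀ l ≤ m + 1, ∀ l' ≤ m + 1, ∀ i i', g l i = g l' i' → l = l' ∧ i = i' := by
    intro l hl l' hl' i i' h
    obtain rfl : l = l' := by
      by_contra hne
      exact Finset.disjoint_left.1 (hdis l hl l' hl' hne) (hgL l hl i) (h ▸ hgL l' hl' i')
    exact ⟨rfl, (hg l hl).1 h⟩
  -- Only arcs between consecutive vertices of one path are kept. A vertex then emits at most one
  -- arc forwards and one backwards, and the colours of their heads differ.
  set E : V → V → Prop := fun x y => R x y ∧ ∃ l ≤ m, ∃ i,
    (x = g l i ∧ y = g (l + 1) i ∧ c y = j (l + 1)) ∨ (x = g (l + 1) i ∧ y = g l i ∧ c y = j l)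
    with hEdef
  refine ⟨E, fun i => (List.range m).map fun l => g (l + 1) i, g (m + 1), ⟨?_, ?_, ?_⟩,
    (hg (m + 1) le_rfl).1, hgL (m + 1) le_rfl, ?_, ?_, ?_, ?_⟩
  · exact fun x y h => h.1
  · rintro x y ⟨_, l, hl, i, ⟨_, _, h⟩ | ⟨_, _, h⟩⟩
    · exact Finset.mem_image.2 ⟨l + 1, Finset.mem_range.2 (by omega), h.symm⟩
    · exact Finset.mem_image.2 ⟨l, Finset.mem_range.2 (by omega), h.symm⟩
  · rintro x y y' ⟨_, l, hl, i, ⟨hx, hy, h⟩ | ⟨hx, hy, h⟩⟩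
      ⟨_, l', hl', i', ⟨hx', hy', h'⟩ | ⟨hx', hy', h'⟩⟩ hc
    · obtain ⟨rfl, rfl⟩ := hginj l (by omega) l' (by omega) i i' (hx.symm.trans hx')
      rw [hy, hy']
    · have := hj _ (by omega) _ (by omega) (h.symm.trans (hc.trans h'))
      obtain ⟨h1, -⟩ := hginj l (by omega) (l' + 1) (by omega) i i' (hx.symm.trans hx')
      omega
    · have := hj _ (by omega) _ (by omega) (h.symm.trans (hc.trans h'))
      obtain ⟨h1, -⟩ := hginj (l + 1) (by omega) l' (by omega) i i' (hx.symm.trans hx')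
      omega
    · obtain ⟨h1, rfl⟩ := hginj (l + 1) (by omega) (l' + 1) (by omega) i i' (hx.symm.trans hx')
      obtain rfl : l = l' := by omega
      rw [hy, hy']
  · intro i
    have e1 : f i :: ((List.range m).map (fun l => g (l + 1) i) ++ [g (m + 1) i]) =
        (List.range (m + 2)).map fun l => g l i := by
      rw [List.range_succ_eq_map, List.range_succ]
      simp [hg0, Function.comp_def]
    rw [e1, List.isChain_map, List.isChain_range_succ]
    intro l hl
    rcases harc l (by omega) i with ⟨h1, h2⟩ | ⟨h1, h2⟩
    · exact Or.inl ⟨h1, l, by omega, i, Or.inl ⟨rfl, rfl, h2⟩⟩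
    · exact Or.inr ⟨h1, l, by omega, i, Or.inr ⟨rfl, rfl, h2⟩⟩
  · intro i
    refine List.Nodup.map_on ?_ List.nodup_range
    intro l hl l' hl' h
    rw [List.mem_range] at hl hl'
    have := (hginj _ (by omega) _ (by omega) _ _ h).1
    omega
  · intro i i' hne x hx hx'
    obtain ⟨l, hl, rfl⟩ := List.mem_map.1 hx
    obtain ⟨l', hl', h⟩ := List.mem_map.1 hx'
    rw [List.mem_range] at hl hl'
    exact hne (hginj _ (by omega) _ (by omega) _ _ h).2.symm
  · intro x
    constructor
    · rintro ⟨i, hx⟩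
      obtain ⟨l, hl, rfl⟩ := List.mem_map.1 hx
      rw [List.mem_range] at hl
      exact ⟨l, hl, hgL _ (by omega) i⟩
    · rintro ⟨l, hl, hx⟩
      obtain ⟨i, rfl⟩ := ((hg (l + 1) (by omega)).2 x).1 hx
      exact ⟨i, List.mem_map.2 ⟨l, List.mem_range.2 hl, rfl⟩⟩

/-- A set can be cut into pieces of size `σ` containing prescribed disjoint small sets. -/
lemma exists_layer_partition {σ : ℕ} :
    ∀ (m : ℕ) (W : Finset V) (P : ℕ → Finset V), W.card = m * σ → (∀ l < m, P l ⊆ W) →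
      (∀ l < m, (P l).card ≤ σ) → (∀ l < m, ∀ l' < m, l ≠ l' → Disjoint (P l) (P l')) →
      ∃ L : ℕ → Finset V, (∀ l < m, (L l).card = σ) ∧ (∀ l < m, P l ⊆ L l) ∧
        (∀ l < m, ∀ l' < m, l ≠ l' → Disjoint (L l) (L l')) ∧
        ∀ x, x ∈ W ↔ ∃ l < m, x ∈ L l := by
  intro m
  induction m with
  | zero =>
    intro W P hW _ _ _
    refine ⟨fun _ => ∅, by simp, by simp, by simp, ?_⟩
    obtain rfl : W = ∅ := by rw [← Finset.card_eq_zero]; simpa using hW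
    simp
  | succ m ih =>
    intro W P hW hP hPc hPd
    have hsub : (Finset.range m).biUnion P ⊆ W :=
      Finset.biUnion_subset.2 fun l hl => hP l (by have := Finset.mem_range.1 hl; omega)
    have hUc : ((Finset.range m).biUnion P).card ≤ m * σ := by
      refine (Finset.card_biUnion_le_card_mul _ _ σ fun l hl => hPc l ?_).trans (by simp)
      have := Finset.mem_range.1 hl; omega
    have hPm : P m ⊆ W \ (Finset.range m).biUnion P := by
      intro x hx
      refine Finset.mem_sdiff.2 ⟨hP m (by omega) hx, fun h => ?_⟩
      obtain ⟨l, hl, hxl⟩ := Finset.mem_biUnion.1 h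
      have := Finset.mem_range.1 hl
      exact Finset.disjoint_left.1 (hPd l (by omega) m (by omega) (by omega)) hxl hx
    have hcc := Finset.card_sdiff_add_card_eq_card hsub
    rw [Nat.succ_mul] at hW
    obtain ⟨M, hPM, hMW, hMc⟩ := Finset.exists_subsuperset_card_eq hPm (hPc m (by omega))
      (show σ ≤ _ by omega)
    have hMW' : M ⊆ W := hMW.trans Finset.sdiff_subset
    have hWM := Finset.card_sdiff_add_card_eq_card hMW'
    obtain ⟨L, hL1, hL2, hL3, hL4⟩ := ih (W \ M) P (by omega)
      (by
        intro l hl x hx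
        refine Finset.mem_sdiff.2 ⟨hP l (by omega) hx, fun hxM => ?_⟩
        exact (Finset.mem_sdiff.1 (hMW hxM)).2
          (Finset.mem_biUnion.2 ⟨l, Finset.mem_range.2 hl, hx⟩))
      (fun l hl => hPc l (by omega)) (fun l hl l' hl' => hPd l (by omega) l' (by omega))
    have hLM : ∀ l < m, Disjoint (L l) M := by
      intro l hl
      refine Finset.disjoint_left.2 fun x hx hxM => ?_
      exact (Finset.mem_sdiff.1 ((hL4 x).2 ⟨l, hl, hx⟩)).2 hxM
    refine ⟨Function.update L m M, ?_, ?_, ?_, ?_⟩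
    · intro l hl
      rcases Nat.lt_succ_iff_lt_or_eq.1 hl with h | rfl
      · rw [Function.update_of_ne h.ne]; exact hL1 l h
      · simpa using hMc
    · intro l hl
      rcases Nat.lt_succ_iff_lt_or_eq.1 hl with h | rfl
      · rw [Function.update_of_ne h.ne]; exact hL2 l h
      · simpa using hPM
    · intro l hl l' hl' hne
      rcases Nat.lt_succ_iff_lt_or_eq.1 hl with h | rfl <;>
        rcases Nat.lt_succ_iff_lt_or_eq.1 hl' with h' | rfl
      · rw [Function.update_of_ne h.ne, Function.update_of_ne h'.ne]; exact hL3 l h l' h' hne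
      · rw [Function.update_of_ne h.ne, Function.update_self]; exact hLM l h
      · rw [Function.update_of_ne h'.ne, Function.update_self]; exact (hLM l' h').symm
      · exact absurd rfl hne
    · intro x
      constructor
      · intro hx
        by_cases hxM : x ∈ M
        · exact ⟨m, by omega, by simpa using hxM⟩
        · obtain ⟨l, hl, hxl⟩ := (hL4 x).1 (Finset.mem_sdiff.2 ⟨hx, hxM⟩)
          exact ⟨l, by omega, by rwa [Function.update_of_ne hl.ne]⟩
      · rintro ⟨l, hl, hx⟩
        rcases Nat.lt_succ_iff_lt_or_eq.1 hl with h | rfl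
        · rw [Function.update_of_ne h.ne] at hx
          exact Finset.sdiff_subset ((hL4 x).2 ⟨l, h, hx⟩)
        · rw [Function.update_self] at hx
          exact hMW' hx

end Layers

/-! ### Merging the cycles of a permutation by transpositions. -/

section Merging

open Equiv

lemma sameCycle_of_forall_step {Ω : Type*} [Finite Ω] {f g : Perm Ω}
    (h : ∀ x, g.SameCycle x (f x)) {x y : Ω} (hxy : f.SameCycle x y) : g.SameCycle x y := by
  obtain ⟨k, rfl⟩ := hxy.exists_nat_pow_eq
  clear hxy
  induction k with
  | zero => exact Perm.SameCycle.refl _ _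
  | succ k ih =>
    rw [pow_succ', Perm.mul_apply]
    exact ih.trans (h _)

/-- After the change `a` is sent to `f b`, from where the old cycle of `b` is followed up to `b`.
That cycle does not contain `a`, so the transposition does not interfere on the way. -/
lemma sameCycle_mul_swap {Ω : Type*} [Finite Ω] [DecidableEq Ω] {f : Perm Ω} {a b : Ω}
    (h : ¬ f.SameCycle a b) : (f * swap a b).SameCycle a b := by
  have key : ∀ k : ℕ, (f * swap a b).SameCycle a b ∨
      (f * swap a b).SameCycle a ((f ^ k) (f b)) := by
    intro k
    induction k with
    | zero =>
      right
      have : (f * swap a b) a = f b := by simp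
      rw [pow_zero, Perm.one_apply, ← this]
      exact (Perm.sameCycle_apply_right).2 (Perm.SameCycle.refl _ _)
    | succ k ih =>
      rcases ih with ih | ih
      · exact Or.inl ih
      · by_cases hb : (f ^ k) (f b) = b
        · left; rwa [hb] at ih
        · right
          have ha : (f ^ k) (f b) ≠ a := by
            intro ha
            apply h
            rw [← ha]
            have : f.SameCycle b ((f ^ k) (f b)) :=
              Perm.sameCycle_pow_right.2 (Perm.sameCycle_apply_right.2 (Perm.SameCycle.refl _ _))
            exact this.symm
          rw [pow_succ', Perm.mul_apply]
          have e : (f * swap a b) ((f ^ k) (f b)) = f ((f ^ k) (f b)) := by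
            rw [Perm.mul_apply, swap_apply_of_ne_of_ne ha hb]
          rw [← e]
          exact Perm.sameCycle_apply_right.2 ih
  have hb : f.SameCycle (f b) b := Perm.sameCycle_apply_left.2 (Perm.SameCycle.refl _ _)
  obtain ⟨k, hk⟩ := hb.exists_nat_pow_eq
  rcases key k with h1 | h1
  · exact h1
  · rwa [hk] at h1

/-- Only the steps out of `a` and `b` are altered, and these two now lie on a common cycle; hence no
old cycle is broken up. -/
lemma sameCycle_mul_swap_mono {Ω : Type*} [Finite Ω] [DecidableEq Ω] {f : Perm Ω} {a b : Ω}
    (h : ¬ f.SameCycle a b) {x y : Ω} (hxy : f.SameCycle x y) :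
    (f * swap a b).SameCycle x y := by
  have hab := sameCycle_mul_swap h
  refine sameCycle_of_forall_step (fun x => ?_) hxy
  by_cases ha : x = a
  · subst ha
    have : f x = (f * swap x b) b := by simp
    rw [this]
    exact Perm.sameCycle_apply_right.2 hab
  by_cases hb : x = b
  · subst hb
    have : f x = (f * swap a x) a := by simp
    rw [this]
    exact Perm.sameCycle_apply_right.2 hab.symm
  have : f x = (f * swap a b) x := by rw [Perm.mul_apply, swap_apply_of_ne_of_ne ha hb]
  rw [this]
  exact Perm.sameCycle_apply_right.2 (Perm.SameCycle.refl _ _)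

/-- Switching suitable pairs `(inl i, inr i)` turns `f` into a single cycle. -/
lemma exists_switching {I : Type*} [Fintype I] [DecidableEq I] (f : Perm (I ⊕ I)) (s : Perm I)
    (hs : ∀ i i', s.SameCycle i i') (hf : ∀ i, f (Sum.inr i) = Sum.inl (s i)) :
    ∃ (β : Finset I) (g : Perm (I ⊕ I)),
      (∀ i ∈ β, g (Sum.inl i) = f (Sum.inr i) ∧ g (Sum.inr i) = f (Sum.inl i)) ∧
      (∀ i ∉ β, g (Sum.inl i) = f (Sum.inl i) ∧ g (Sum.inr i) = f (Sum.inr i)) ∧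
      ∀ x y, g.SameCycle x y := by
  have key : ∀ P : Finset I, ∃ β ⊆ P, ∃ g : Perm (I ⊕ I),
      (∀ i ∈ β, g (Sum.inl i) = f (Sum.inr i) ∧ g (Sum.inr i) = f (Sum.inl i)) ∧
      (∀ i ∉ β, g (Sum.inl i) = f (Sum.inl i) ∧ g (Sum.inr i) = f (Sum.inr i)) ∧
      ∀ i ∈ P, g.SameCycle (Sum.inl i) (Sum.inr i) := by
    intro P
    induction P using Finset.induction_on with
    | empty => exact ⟨∅, by simp, f, by simp, by simp, by simp⟩
    | insert j P hj ih =>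
      obtain ⟨β, hβ, g, h1, h2, h3⟩ := ih
      by_cases hsc : g.SameCycle (Sum.inl j) (Sum.inr j)
      · exact ⟨β, hβ.trans (Finset.subset_insert _ _), g, h1, h2, by simpa [hsc] using h3⟩
      · have hjβ : j ∉ β := fun h => hj (hβ h)
        refine ⟨insert j β, Finset.insert_subset_insert _ hβ,
          g * swap (Sum.inl j) (Sum.inr j), ?_, ?_, ?_⟩
        · intro i hi
          rcases Finset.mem_insert.1 hi with rfl | hi
          · simpa using ⟨(h2 i hjβ).2, (h2 i hjβ).1⟩
          · have hne : i ≠ j := fun h => hjβ (h ▸ hi)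
            rw [Perm.mul_apply, Perm.mul_apply, swap_apply_of_ne_of_ne (by simpa using hne) (by simp),
              swap_apply_of_ne_of_ne (by simp) (by simpa using hne)]
            exact h1 i hi
        · intro i hi
          rw [Finset.mem_insert, not_or] at hi
          rw [Perm.mul_apply, Perm.mul_apply, swap_apply_of_ne_of_ne (by simpa using hi.1) (by simp),
            swap_apply_of_ne_of_ne (by simp) (by simpa using hi.1)]
          exact h2 i hi.2
        · intro i hi
          rcases Finset.mem_insert.1 hi with rfl | hi
          · exact sameCycle_mul_swap hsc
          · exact sameCycle_mul_swap_mono hsc (h3 i hi)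
  obtain ⟨β, -, g, h1, h2, h3⟩ := key Finset.univ
  refine ⟨β, g, h1, h2, ?_⟩
  have h3' : ∀ i, g.SameCycle (Sum.inl i) (Sum.inr i) := fun i => h3 i (Finset.mem_univ i)
  -- Whatever the state of switch `i`, one of `inl i` and `inr i` is sent to `inl (s i)`, and these
  -- two share a cycle. So the single cycle `s` ties all indices together.
  have hstep : ∀ i, g.SameCycle (Sum.inl i) (Sum.inl (s i)) := by
    intro i
    rw [← hf i]
    by_cases hi : i ∈ β
    · rw [← (h1 i hi).1]
      exact Perm.sameCycle_apply_right.2 (Perm.SameCycle.refl _ _)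
    · rw [← (h2 i hi).2]
      exact Perm.sameCycle_apply_right.2 (h3' i)
  have hl : ∀ i i', g.SameCycle (Sum.inl i) (Sum.inl i') := by
    intro i i'
    obtain ⟨k, rfl⟩ := (hs i i').exists_nat_pow_eq
    induction k with
    | zero => exact Perm.SameCycle.refl _ _
    | succ k ih =>
      rw [pow_succ', Perm.mul_apply]
      exact ih.trans (hstep _)
  rintro (i | i) (i' | i')
  · exact hl i i'
  · exact (hl i i').trans (h3' i')
  · exact (h3' i).symm.trans (hl i i')
  · exact (h3' i).symm.trans ((hl i i').trans (h3' i'))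

end Merging

/-! ### From a cyclic permutation of segments to a Hamilton tour. -/

section Assembly

/-- A closed walk visiting every vertex exactly once. -/
def HasHamiltonTour {V : Type*} [Fintype V] (A : V → V → Prop) : Prop :=
  ∃ v : Fin (Fintype.card V) → V, Function.Injective v ∧
    ∀ i, A (v i) (v (finRotate (Fintype.card V) i))

lemma exists_cyclic_enumeration {V : Type*} {A : V → V → Prop} {x : V} {l : List V} {n : ℕ}
    (hlen : (x :: l).length = n) (hnd : (x :: l).Nodup) (hch : List.IsChain A (x :: (l ++ [x]))) :
    ∃ v : Fin n → V, Function.Injective v ∧ ∀ i, A (v i) (v (finRotate n i)) := by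
  subst hlen
  refine ⟨fun i => (x :: l).get i, List.nodup_iff_injective_get.1 hnd, fun i => ?_⟩
  rw [← List.cons_append, List.isChain_iff_getElem] at hch
  obtain ⟨i, hi⟩ := i
  have h := hch i (by simpa using hi)
  rw [List.getElem_append_left hi] at h
  rcases Nat.lt_or_ge (i + 1) (x :: l).length with hlt | hge
  · rw [List.getElem_append_left hlt] at h
    have e : finRotate ((x :: l).length) ⟨i, hi⟩ = ⟨i + 1, hlt⟩ :=
      finRotate_of_lt (n := l.length) (by simpa using hlt)
    simp only [e, List.get_eq_getElem]
    exact h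
  · obtain rfl : i = l.length := by simp at hi hge; omega
    have e : finRotate ((x :: l).length) ⟨l.length, hi⟩ = ⟨0, by simp⟩ := finRotate_last'
    simp only [e, List.get_eq_getElem]
    simpa using h

/-- The segments are concatenated along one period of `g`. As `g` has a single cycle, each segment
occurs exactly once. -/
lemma hasHamiltonTour_of_segments {V Ω : Type*} [Fintype V] [Finite Ω] [Nonempty Ω]
    {A : V → V → Prop} (g : Equiv.Perm Ω) (hg : ∀ x y, g.SameCycle x y) (port : Ω → V)
    (tail : Ω → List V) (hch : ∀ ω, List.IsChain A (port ω :: (tail ω ++ [port (g ω)])))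
    (hnd : ∀ ω, (port ω :: tail ω).Nodup)
    (hdis : ∀ ω ω', ω ≠ ω' → List.Disjoint (port ω :: tail ω) (port ω' :: tail ω'))
    (hcov : ∀ v, ∃ ω, v ∈ port ω :: tail ω) : HasHamiltonTour A := by
  classical
  obtain ⟨ω₀⟩ := ‹Nonempty Ω›
  set k := Function.minimalPeriod g ω₀ with hk
  have hkpos : 0 < k := by
    refine Function.minimalPeriod_pos_of_mem_periodicPts ?_
    obtain ⟨m, hm, hm'⟩ := (isOfFinOrder_of_finite g).exists_pow_eq_one
    exact ⟨m, hm, by rw [Function.IsPeriodicPt, Function.IsFixedPt, ← Equiv.Perm.coe_pow, hm']; rfl⟩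
  have hkper : g^[k] ω₀ = ω₀ := Function.iterate_minimalPeriod
  have hinj : ∀ i < k, ∀ i' < k, g^[i] ω₀ = g^[i'] ω₀ → i = i' := fun i hi i' hi' h =>
    Function.iterate_injOn_Iio_minimalPeriod (Set.mem_Iio.2 hi) (Set.mem_Iio.2 hi') h
  have hchain : ∀ n, List.IsChain A ((List.range n).flatMap (fun i =>
      port (g^[i] ω₀) :: tail (g^[i] ω₀)) ++ [port (g^[n] ω₀)]) := by
    intro n
    induction n with
    | zero => simp
    | succ n ih =>
      have h1 := hch (g^[n] ω₀)
      rw [← Function.iterate_succ_apply' g n ω₀] at h1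
      rw [List.range_succ, List.flatMap_append]
      simp only [List.flatMap_cons, List.flatMap_nil, List.append_nil, List.append_assoc,
        List.cons_append]
      exact List.isChain_split.2 ⟨ih, h1⟩
  set M := (List.range k).flatMap (fun i => port (g^[i] ω₀) :: tail (g^[i] ω₀)) with hM
  have hMnd : M.Nodup := by
    rw [hM, List.nodup_flatMap]
    refine ⟨fun i _ => hnd _, ?_⟩
    refine List.Pairwise.imp_of_mem ?_ (List.nodup_range (n := k))
    intro i i' hi hi' hne
    refine hdis _ _ fun h => hne (hinj i (List.mem_range.1 hi) i' (List.mem_range.1 hi') h)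
  have hMcov : ∀ v, v ∈ M := by
    intro v
    obtain ⟨ω, hω⟩ := hcov v
    obtain ⟨m, rfl⟩ := (hg ω₀ ω).exists_nat_pow_eq
    refine List.mem_flatMap.2 ⟨m % k, List.mem_range.2 (Nat.mod_lt _ hkpos), ?_⟩
    rw [Function.iterate_mod_minimalPeriod_eq]
    rwa [Equiv.Perm.coe_pow] at hω
  have hlen : M.length = Fintype.card V := by
    rw [← List.toFinset_card_of_nodup hMnd, ← Finset.card_univ]
    congr 1
    ext v
    simp [hMcov v]
  have hchM := hchain k
  rw [← hM, hkper] at hchM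
  obtain ⟨k', hk'⟩ : ∃ k', k = k' + 1 := ⟨k - 1, by omega⟩
  have hMcons : ∃ l, M = port ω₀ :: l := by
    rw [hM, hk', List.range_succ_eq_map]
    exact ⟨_, rfl⟩
  obtain ⟨l, hl⟩ := hMcons
  rw [hl] at hchM hlen hMnd
  exact exists_cyclic_enumeration hlen hMnd hchM

end Assembly

/-! ### Traversing a ladder across all its rungs. -/

section Ladder

variable {V : Type*}

/-- The path through a ladder that crosses every rung; a rung is a triple of its two ends and the
list of its inner vertices. -/
def zigzag : Bool → List (V × List V × V) → List V
  | _, [] => []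
  | false, (u, r, w) :: T => u :: (r ++ w :: zigzag true T)
  | true, (u, r, w) :: T => w :: (r.reverse ++ u :: zigzag false T)

/-- The vertices used do not depend on the rail where the traversal starts; hence a switch can be
flipped without changing the covered set. -/
lemma zigzag_perm (b : Bool) (T : List (V × List V × V)) :
    (zigzag b T).Perm (T.map (fun t => t.1) ++ (T.map (fun t => t.2.2) ++
      T.flatMap fun t => t.2.1)) := by
  classical
  rw [List.perm_iff_count]
  intro x
  induction T generalizing b with
  | nil => cases b <;> simp [zigzag]
  | cons t T ih =>
    obtain ⟨u, r, w⟩ := t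
    cases b <;> simp [zigzag, ih, List.count_cons, List.count_append] <;> omega

/-- Both rails are prolonged to the same vertex `z`, so the side on which the traversal ends is
irrelevant and the number of rungs needs no parity condition. -/
lemma zigzag_chain {A : V → V → Prop} (hA : ∀ x y, A x y → A y x) {z : V}
    (T : List (V × List V × V)) (hT : ∀ t ∈ T, List.IsChain A (t.1 :: (t.2.1 ++ [t.2.2])))
    {x x' : V} (b : Bool) (hx : List.IsChain A (x :: (T.map (fun t => t.1) ++ [z])))
    (hx' : List.IsChain A (x' :: (T.map (fun t => t.2.2) ++ [z]))) :
    List.IsChain A ((if b then x' else x) :: (zigzag b T ++ [z])) := by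
  induction T generalizing x x' b with
  | nil =>
    cases b
    · simpa [zigzag] using hx
    · simpa [zigzag] using hx'
  | cons t T ih =>
    obtain ⟨u, r, w⟩ := t
    simp only [List.map_cons, List.cons_append, List.isChain_cons_cons] at hx hx'
    have hr := hT _ List.mem_cons_self
    have ih' := fun b => ih (fun t ht => hT t (List.mem_cons_of_mem _ ht)) b hx.2 hx'.2
    cases b with
    | false =>
      have e : (x :: (zigzag false ((u, r, w) :: T) ++ [z])) =
          x :: u :: (r ++ w :: (zigzag true T ++ [z])) := by simp [zigzag]
      simp only [Bool.false_eq_true, if_false]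
      rw [e, List.isChain_cons_cons, List.isChain_cons_split]
      exact ⟨hx.1, hr, by simpa using ih' true⟩
    | true =>
      have e : (x' :: (zigzag true ((u, r, w) :: T) ++ [z])) =
          x' :: w :: (r.reverse ++ u :: (zigzag false T ++ [z])) := by simp [zigzag]
      simp only [if_true]
      rw [e, List.isChain_cons_cons, List.isChain_cons_split]
      refine ⟨hx'.1, ?_, by simpa using ih' false⟩
      have e2 : w :: (r.reverse ++ [u]) = (u :: (r ++ [w])).reverse := by simp
      rw [e2, List.isChain_reverse]
      exact hr.imp fun a b h => hA a b h

end Ladder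

/-! ### Ladders as switches. -/

section Switches

/-- A cyclic chain of ladders, together with paths `D i` closing them up, contains a Hamilton tour:
every ladder can be traversed in two ways, which exchange its two outgoing ends. -/
lemma hasHamiltonTour_of_ladders {V I : Type*} [Fintype V] [Fintype I] [Nonempty I]
    {A : V → V → Prop} (hA : ∀ x y, A x y → A y x) (s π : Equiv.Perm I)
    (hs : ∀ i i', s.SameCycle i i') (t y z u w : I → V) (OU OW D : I → List V)
    (T : I → List (V × List V × V))
    (hOU : ∀ i, List.IsChain A (u i :: (OU i ++ [z i])))
    (hOW : ∀ i, List.IsChain A (w i :: (OW i ++ [y i])))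
    (hD : ∀ i, List.IsChain A (t i :: (D i ++ [y (π i)])))
    (hU : ∀ i, List.IsChain A (t i :: u i :: ((T i).map (fun a => a.1) ++ [z (s i)])))
    (hW : ∀ i, List.IsChain A (t i :: w i :: ((T i).map (fun a => a.2.2) ++ [z (s i)])))
    (hT : ∀ i, ∀ a ∈ T i, List.IsChain A (a.1 :: (a.2.1 ++ [a.2.2])))
    (base : I → List V)
    (hbase : ∀ i, base i = z i :: y i :: t i :: u i :: w i :: (OU i ++ (OW i ++ (D i ++
      ((T i).map (fun a => a.1) ++ ((T i).map (fun a => a.2.2) ++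
        (T i).flatMap fun a => a.2.1))))))
    (hnd : ∀ i, (base i).Nodup) (hdis : ∀ i i', i ≠ i' → List.Disjoint (base i) (base i'))
    (hcov : ∀ v, ∃ i, v ∈ base i) : HasHamiltonTour A := by
  classical
  -- `inl i` is the entry `z i` and `inr i` the entry `y i`. Unswitched, the route from `z i` leaves
  -- along `D i` towards `y (π i)`, and the route from `y i` crosses the ladder to `z (s i)`;
  -- switching exchanges the two exits.
  set f : Equiv.Perm (I ⊕ I) :=
    (Equiv.sumCongr π s).trans (Equiv.sumComm I I) with hf
  have hfl : ∀ i, f (Sum.inl i) = Sum.inr (π i) := fun i => rfl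
  have hfr : ∀ i, f (Sum.inr i) = Sum.inl (s i) := fun i => rfl
  obtain ⟨β, g, h1, h2, hg⟩ := exists_switching f s hs hfr
  set port : I ⊕ I → V := Sum.elim z y with hport
  -- Each route first runs backwards along its outer path to the beginning of a rail. One of the two
  -- then crosses the ladder, while the other steps back to `t i`, the common neighbour of both rail
  -- beginnings.
  set tail : I ⊕ I → List V := Sum.elim
    (fun i => (OU i).reverse ++ u i :: (if i ∈ β then zigzag false (T i) else t i :: D i))
    (fun i => (OW i).reverse ++ w i :: (if i ∈ β then t i :: D i else zigzag true (T i))) with htail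
  have hOU' : ∀ i, List.IsChain A (z i :: ((OU i).reverse ++ [u i])) := by
    intro i
    have e : z i :: ((OU i).reverse ++ [u i]) = (u i :: (OU i ++ [z i])).reverse := by simp
    rw [e, List.isChain_reverse]
    exact (hOU i).imp fun a b h => hA a b h
  have hOW' : ∀ i, List.IsChain A (y i :: ((OW i).reverse ++ [w i])) := by
    intro i
    have e : y i :: ((OW i).reverse ++ [w i]) = (w i :: (OW i ++ [y i])).reverse := by simp
    rw [e, List.isChain_reverse]
    exact (hOW i).imp fun a b h => hA a b h
  have hperm : ∀ i, ((port (Sum.inl i) :: tail (Sum.inl i)) ++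
      (port (Sum.inr i) :: tail (Sum.inr i))).Perm (base i) := by
    intro i
    have hz0 := zigzag_perm false (T i)
    have hz1 := zigzag_perm true (T i)
    rw [List.perm_iff_count] at hz0 hz1 ⊢
    intro x
    have hz0 := hz0 x
    have hz1 := hz1 x
    rw [hbase]
    by_cases hi : i ∈ β
    · simp only [hport, htail, Sum.elim_inl, Sum.elim_inr, if_pos hi, List.count_append,
        List.count_cons, List.count_reverse] at hz0 hz1 ⊢
      omega
    · simp only [hport, htail, Sum.elim_inl, Sum.elim_inr, if_neg hi, List.count_append,
        List.count_cons, List.count_reverse] at hz0 hz1 ⊢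
      omega
  have hidx : ∀ ω : I ⊕ I, ∀ x ∈ port ω :: tail ω, x ∈ base (Sum.elim id id ω) := by
    rintro (i | i) x hx
    · exact (hperm i).mem_iff.1 (List.mem_append_left _ hx)
    · exact (hperm i).mem_iff.1 (List.mem_append_right _ hx)
  have hboth : ∀ i, ((port (Sum.inl i) :: tail (Sum.inl i)) ++
      (port (Sum.inr i) :: tail (Sum.inr i))).Nodup := fun i => (hperm i).nodup_iff.2 (hnd i)
  refine hasHamiltonTour_of_segments g hg port tail ?_ ?_ ?_ ?_
  · rintro (i | i)
    · by_cases hi : i ∈ β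
      · rw [(h1 i hi).1, hfr]
        simp only [hport, htail, Sum.elim_inl, if_pos hi, List.append_assoc, List.cons_append]
        rw [List.isChain_cons_split]
        refine ⟨hOU' i, ?_⟩
        have := zigzag_chain hA (T i) (hT i) false (hU i).tail (hW i).tail
        simpa using this
      · rw [(h2 i hi).1, hfl]
        simp only [hport, htail, Sum.elim_inl, Sum.elim_inr, if_neg hi, List.append_assoc,
          List.cons_append]
        rw [List.isChain_cons_split, List.isChain_cons_cons]
        exact ⟨hOU' i, hA _ _ (List.isChain_cons_cons.1 (hU i)).1, hD i⟩
    · by_cases hi : i ∈ β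
      · rw [(h1 i hi).2, hfl]
        simp only [hport, htail, Sum.elim_inr, if_pos hi, List.append_assoc, List.cons_append]
        rw [List.isChain_cons_split, List.isChain_cons_cons]
        exact ⟨hOW' i, hA _ _ (List.isChain_cons_cons.1 (hW i)).1, hD i⟩
      · rw [(h2 i hi).2, hfr]
        simp only [hport, htail, Sum.elim_inl, Sum.elim_inr, if_neg hi, List.append_assoc,
          List.cons_append]
        rw [List.isChain_cons_split]
        refine ⟨hOW' i, ?_⟩
        have := zigzag_chain hA (T i) (hT i) true (hU i).tail (hW i).tail
        simpa using this
  · rintro (i | i)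
    · exact (List.nodup_append.1 (hboth i)).1
    · exact (List.nodup_append.1 (hboth i)).2.1
  · rintro ω ω' hne x hx hx'
    by_cases he : (Sum.elim id id ω : I) = Sum.elim id id ω'
    · rcases ω with i | i <;> rcases ω' with i' | i'
      · exact hne (by simpa using he)
      · obtain rfl : i = i' := he
        exact (List.disjoint_of_nodup_append (hboth i)) hx hx'
      · obtain rfl : i = i' := he
        exact (List.disjoint_of_nodup_append (hboth i)) hx' hx
      · exact hne (by simpa using he)
    · exact hdis _ _ he (hidx ω x hx) (hidx ω' x hx')
  · intro v
    obtain ⟨i, hi⟩ := hcov v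
    rcases List.mem_append.1 ((hperm i).mem_iff.2 hi) with h | h
    · exact ⟨_, h⟩
    · exact ⟨_, h⟩

end Switches

/-! ### Disjoint families of duplicate-free lists. -/

section Families

variable {V I : Type*}

/-- Duplicate-free, pairwise disjoint lists with elements in `S`. -/
structure IsDisjointFamily (F : I → List V) (S : Set V) : Prop where
  nodup : ∀ i, (F i).Nodup
  disjoint : ∀ i i', i ≠ i' → List.Disjoint (F i) (F i')
  mem : ∀ i, ∀ x ∈ F i, x ∈ S

lemma IsDisjointFamily.append {F F' : I → List V} {S S' : Set V} (h : IsDisjointFamily F S)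
    (h' : IsDisjointFamily F' S') (hd : Disjoint S S') :
    IsDisjointFamily (fun i => F i ++ F' i) (S ∪ S') where
  nodup i := by
    refine List.nodup_append'.2 ⟨h.nodup i, h'.nodup i, fun x hx hx' => ?_⟩
    exact Set.disjoint_left.1 hd (h.mem i x hx) (h'.mem i x hx')
  disjoint i i' hne x hx hx' := by
    rcases List.mem_append.1 hx with hx | hx <;> rcases List.mem_append.1 hx' with hx' | hx'
    · exact h.disjoint i i' hne hx hx'
    · exact Set.disjoint_left.1 hd (h.mem _ x hx) (h'.mem _ x hx')
    · exact Set.disjoint_left.1 hd (h.mem _ x hx') (h'.mem _ x hx)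
    · exact h'.disjoint i i' hne hx hx'
  mem i _ hx := (List.mem_append.1 hx).imp (h.mem i _) (h'.mem i _)

lemma IsDisjointFamily.perm {F F' : I → List V} {S : Set V} (h : IsDisjointFamily F S)
    (hp : ∀ i, (F' i).Perm (F i)) : IsDisjointFamily F' S where
  nodup i := (hp i).nodup_iff.2 (h.nodup i)
  disjoint i i' hne x hx hx' :=
    h.disjoint i i' hne ((hp i).mem_iff.1 hx) ((hp i').mem_iff.1 hx')
  mem i x hx := h.mem i x ((hp i).mem_iff.1 hx)

lemma IsDisjointFamily.mono {F : I → List V} {S S' : Set V} (h : IsDisjointFamily F S)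
    (hS : S ⊆ S') : IsDisjointFamily F S' where
  nodup := h.nodup
  disjoint := h.disjoint
  mem i x hx := hS (h.mem i x hx)

lemma isDisjointFamily_singleton {f : I → V} (hf : Function.Injective f) :
    IsDisjointFamily (fun i => [f i]) (Set.range f) where
  nodup i := List.nodup_singleton _
  disjoint i i' hne x hx hx' := by
    rw [List.mem_singleton] at hx hx'
    exact hne (hf (hx.symm.trans hx'))
  mem i x hx := ⟨i, (List.mem_singleton.1 hx).symm⟩

lemma IsDisjointFamily.card_biUnion [Fintype I] [DecidableEq V] {F : I → List V} {S : Set V}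
    (h : IsDisjointFamily F S) :
    (Finset.univ.biUnion fun i => (F i).toFinset).card = ∑ i, (F i).length := by
  classical
  rw [Finset.card_biUnion]
  · exact Finset.sum_congr rfl fun i _ => List.toFinset_card_of_nodup (h.nodup i)
  · intro i _ i' _ hne
    refine Finset.disjoint_left.2 fun x hx hx' => ?_
    exact h.disjoint i i' hne (List.mem_toFinset.1 hx) (List.mem_toFinset.1 hx')

lemma IsDisjointFamily.getD_inj {F : I → List V} {S : Set V} (h : IsDisjointFamily F S) {k : ℕ}
    (hk : ∀ i, (F i).length = k) {d : I → V} {i i' : I} {j j' : ℕ} (hj : j < k) (hj' : j' < k)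
    (he : (F i).getD j (d i) = (F i').getD j' (d i')) : i = i' ∧ j = j' := by
  have h1 : (F i).getD j (d i) = (F i)[j]'(by rw [hk]; exact hj) :=
    List.getD_eq_getElem _ _ (by rw [hk]; exact hj)
  have h2 : (F i').getD j' (d i') = (F i')[j']'(by rw [hk]; exact hj') :=
    List.getD_eq_getElem _ _ (by rw [hk]; exact hj')
  obtain rfl : i = i' := by
    by_contra hne
    refine h.disjoint i i' hne (a := (F i).getD j (d i)) ?_ ?_
    · rw [h1]; exact List.getElem_mem _
    · rw [he, h2]; exact List.getElem_mem _
  rw [h1, h2] at he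
  exact ⟨rfl, (List.Nodup.getElem_inj_iff (h.nodup i)).1 he⟩

lemma eq_cons_map_getD {l : List V} {k : ℕ} (hl : l.length = k + 1) (d : V) :
    l = l.getD 0 d :: (List.range k).map fun j => l.getD (j + 1) d := by
  refine List.ext_getElem (by simp [hl]) fun j h1 h2 => ?_
  rcases j with _ | j
  · simp [List.getElem?_eq_getElem h1]
  · simp [List.getElem?_eq_getElem h1]

end Families

/-! ### Building the ladders by linkages. -/

section Ladders

variable {V J ι : Type*}

lemma IsLinkage.congr_len {c : V → J} {R : V → V → Prop} {a b : ι → V} {s : Finset ι}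
    {len len' : ι → ℕ} {C : Finset J} {E : V → V → Prop} {l : ι → List V}
    (h : IsLinkage c R a b s len C E l) (hlen : ∀ i ∈ s, len i = len' i) :
    IsLinkage c R a b s len' C E l where
  emission := h.emission
  chain := h.chain
  length i hi := (h.length i hi).trans (hlen i hi)
  colour := h.colour
  nodup := h.nodup
  disjoint := h.disjoint

lemma IsLinkage.isDisjointFamily [Fintype ι] {c : V → J} {R : V → V → Prop} {a b : ι → V}
    {len : ι → ℕ} {C : Finset J} {E : V → V → Prop} {l : ι → List V}
    (h : IsLinkage c R a b Finset.univ len C E l) :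
    IsDisjointFamily l {x | c x ∈ C} where
  nodup i := h.nodup i (Finset.mem_univ i)
  disjoint i i' := h.disjoint i (Finset.mem_univ i) i' (Finset.mem_univ i')
  mem i x hx := h.colour i (Finset.mem_univ i) x hx

variable [Fintype V] [DecidableEq V] [DecidableEq J]

/-- Construction of a cyclic chain of ladders with prescribed terminals; the total number of inner
vertices can be adjusted by `q`. -/
lemma exists_ladders {c : V → J} {R : V → V → Prop} {σ β : ℕ} (hE : IsExpanding c R σ β)
    (hβ : β ≤ σ) {h B q : ℕ} (hh : σ < 2 ^ (h + 1)) (hB : σ * (2 * h + 2) ≤ B * β) (hq : q ≤ σ)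
    (s : Equiv.Perm (Fin σ)) {t y z : Fin σ → V} (ht : Function.Injective t)
    (hy : Function.Injective y) (hz : Function.Injective z) (htz : ∀ i i', t i ≠ z i')
    (hyz : ∀ i i', y i ≠ z i')
    {C₁ C₂ C₃ C₄ : Finset J} (h1 : B * (h + 1) * (2 * h + 2) ≤ C₁.card)
    (h2 : B * (h + 1) * (2 * h + 2) ≤ C₂.card) (h3 : B * (h + 1) * (2 * h + 2) ≤ C₃.card)
    (h4 : B * (h + 1) * (2 * h + 2) ≤ C₄.card) (h12 : Disjoint C₁ C₂) (h34 : Disjoint C₃ C₄)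
    (h1234 : Disjoint (C₁ ∪ C₂) (C₃ ∪ C₄))
    (htC : ∀ i, c (t i) ∉ (C₁ ∪ C₂) ∪ (C₃ ∪ C₄)) (hyC : ∀ i, c (y i) ∉ (C₁ ∪ C₂) ∪ (C₃ ∪ C₄))
    (hzC : ∀ i, c (z i) ∉ (C₁ ∪ C₂) ∪ (C₃ ∪ C₄)) :
    ∃ (E : V → V → Prop) (u w : Fin σ → V) (OU OW : Fin σ → List V)
      (T : Fin σ → List (V × List V × V)),
      IsEmission c R ((C₁ ∪ C₂) ∪ (C₃ ∪ C₄)) E ∧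
      (∀ i, List.IsChain (SymmOf E) (u i :: (OU i ++ [z i]))) ∧
      (∀ i, List.IsChain (SymmOf E) (w i :: (OW i ++ [y i]))) ∧
      (∀ i, List.IsChain (SymmOf E) (t i :: u i :: ((T i).map (fun a => a.1) ++ [z (s i)]))) ∧
      (∀ i, List.IsChain (SymmOf E) (t i :: w i :: ((T i).map (fun a => a.2.2) ++ [z (s i)]))) ∧
      (∀ i, ∀ a ∈ T i, List.IsChain (SymmOf E) (a.1 :: (a.2.1 ++ [a.2.2]))) ∧
      ∃ F : Fin σ → List V,
        (∀ i, F i = u i :: w i :: (OU i ++ (OW i ++ ((T i).map (fun a => a.1) ++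
          ((T i).map (fun a => a.2.2) ++ (T i).flatMap fun a => a.2.1))))) ∧
        IsDisjointFamily F {x | c x ∈ (C₁ ∪ C₂) ∪ (C₃ ∪ C₄)} ∧
        ∑ i, (F i).length = σ * (2 * (2 * h + 1) + (2 * h + 2) * (2 * h + 1)) + q := by
  classical
  set k := 2 * h + 1 with hk
  have hβk : β < 2 ^ (h + 1) := by omega
  have hQ : B * (h + 1) * k ≤ B * (h + 1) * (2 * h + 2) := Nat.mul_le_mul le_rfl (by omega)
  have hk' : h + 1 + h = k := by omega
  have hσB : σ ≤ B * β := le_trans (Nat.le_mul_of_pos_right _ (by omega)) hB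
  simp only [Finset.mem_union, not_or] at htC hyC hzC
  obtain ⟨EU, U, hU⟩ := exists_linkage hE hβ (a := t) (b := z ∘ s) hh hh hβk B C₁ Finset.univ
    ht.injOn (hz.comp s.injective).injOn (fun i _ i' _ => htz i _) (fun i _ => (htC i).1.1)
    (fun i _ => (hzC _).1.1) (by simpa using hσB) (by rw [hk']; omega)
  obtain ⟨EW, W, hW⟩ := exists_linkage hE hβ (a := t) (b := z ∘ s) hh hh hβk B C₂ Finset.univ
    ht.injOn (hz.comp s.injective).injOn (fun i _ i' _ => htz i _) (fun i _ => (htC i).1.2)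
    (fun i _ => (hzC _).1.2) (by simpa using hσB) (by rw [hk']; omega)
  have hUl : ∀ i, (U i).length = k := fun i => (hU.length i (Finset.mem_univ i)).trans hk'
  have hWl : ∀ i, (W i).length = k := fun i => (hW.length i (Finset.mem_univ i)).trans hk'
  have hUf := hU.isDisjointFamily
  have hWf := hW.isDisjointFamily
  -- The default `t i` is never the value used: positions below the rail length `k` are the only
  -- ones that occur.
  set u : Fin σ → ℕ → V := fun i j => (U i).getD j (t i) with hu
  set w : Fin σ → ℕ → V := fun i j => (W i).getD j (t i) with hw
  have huinj : ∀ i i' j j', j < k → j' < k → u i j = u i' j' → i = i' ∧ j = j' :=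
    fun i i' j j' hj hj' he => hUf.getD_inj hUl (d := t) hj hj' he
  have hwinj : ∀ i i' j j', j < k → j' < k → w i j = w i' j' → i = i' ∧ j = j' :=
    fun i i' j j' hj hj' he => hWf.getD_inj hWl (d := t) hj hj' he
  have huC : ∀ i j, j < k → c (u i j) ∈ C₁ := by
    intro i j hj
    refine hUf.mem i _ ?_
    simp only [hu]
    rw [List.getD_eq_getElem _ _ (by rw [hUl]; exact hj)]
    exact List.getElem_mem _
  have hwC : ∀ i j, j < k → c (w i j) ∈ C₂ := by
    intro i j hj
    refine hWf.mem i _ ?_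
    simp only [hw]
    rw [List.getD_eq_getElem _ _ (by rw [hWl]; exact hj)]
    exact List.getElem_mem _
  have hUeq : ∀ i, U i = u i 0 :: (List.range (k - 1)).map fun j => u i (j + 1) :=
    fun i => eq_cons_map_getD (by rw [hUl]; omega) _
  have hWeq : ∀ i, W i = w i 0 :: (List.range (k - 1)).map fun j => w i (j + 1) :=
    fun i => eq_cons_map_getD (by rw [hWl]; omega) _
  have hC12 : ∀ {x x' : V}, c x ∈ C₁ → c x' ∈ C₂ → x ≠ x' := fun hx hx' he =>
    Finset.disjoint_left.1 h12 hx (he ▸ hx')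
  have hC1_34 : ∀ {j : J}, j ∈ C₁ → j ∉ C₃ ∪ C₄ := fun hj =>
    Finset.disjoint_left.1 h1234 (Finset.mem_union_left _ hj)
  have hC2_34 : ∀ {j : J}, j ∈ C₂ → j ∉ C₃ ∪ C₄ := fun hj =>
    Finset.disjoint_left.1 h1234 (Finset.mem_union_right _ hj)
  -- the pairs to be linked by rungs and by the connections to `z` and `y`
  set a : Fin σ × ℕ → V := fun p => if p.2 < k then u p.1 p.2 else w p.1 0 with ha
  set b : Fin σ × ℕ → V := fun p =>
    if p.2 < k then (if p.2 = 0 then z p.1 else w p.1 p.2) else y p.1 with hb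
  set full : Finset (Fin σ × ℕ) := Finset.univ ×ˢ Finset.range (k + 1) with hfull
  -- For `q` of the indices, the connection from `w i 0` to `y i` (second coordinate `k`) receives
  -- one extra vertex. This tunes the total number of vertices.
  set Qs : Finset (Fin σ × ℕ) := (Finset.univ.filter fun i : Fin σ => i.val < q) ×ˢ {k} with hQs
  have hQsub : Qs ⊆ full := by
    rintro ⟨i, j⟩ hp
    simp only [hQs, Finset.mem_product, Finset.mem_singleton, hfull, Finset.mem_range,
      Finset.mem_univ, true_and] at hp ⊢
    omega
  have hlt : ∀ p ∈ full, p.2 < k + 1 := fun p hp =>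
    Finset.mem_range.1 (Finset.mem_product.1 hp).2
  have hainj : Set.InjOn a full := by
    rintro ⟨i, j⟩ hp ⟨i', j'⟩ hp' he
    have h1 := hlt _ hp
    have h2 := hlt _ hp'
    simp only [ha] at he h1 h2
    split_ifs at he with hj hj' hj'
    · obtain ⟨rfl, rfl⟩ := huinj _ _ _ _ hj hj' he; rfl
    · exact absurd he (hC12 (huC i j hj) (hwC i' 0 (by omega)))
    · exact absurd he.symm (hC12 (huC i' j' hj') (hwC i 0 (by omega)))
    · obtain ⟨rfl, -⟩ := hwinj _ _ _ _ (by omega) (by omega) he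
      rw [show j = j' by omega]
  have hzw : ∀ i i' j, j < k → z i ≠ w i' j := fun i i' j hj he =>
    (hzC i).1.2 (he ▸ hwC i' j hj)
  have hyw : ∀ i i' j, j < k → y i ≠ w i' j := fun i i' j hj he =>
    (hyC i).1.2 (he ▸ hwC i' j hj)
  have hbinj : Set.InjOn b full := by
    rintro ⟨i, j⟩ hp ⟨i', j'⟩ hp' he
    have h1 := hlt _ hp
    have h2 := hlt _ hp'
    simp only [hb] at he h1 h2
    split_ifs at he with hj hj0 hj' hj0' hj' hj0' hj'
    · rw [hz he, hj0, hj0']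
    · exact absurd he (hzw _ _ _ hj')
    · exact absurd he.symm (hyz _ _)
    · exact absurd he.symm (hzw _ _ _ hj)
    · obtain ⟨rfl, rfl⟩ := hwinj _ _ _ _ hj hj' he; rfl
    · exact absurd he.symm (hyw _ _ _ hj)
    · exact absurd he (hyz _ _)
    · exact absurd he (hyw _ _ _ (by assumption))
    · rw [hy he, show j = j' by omega]
  have hab : ∀ p ∈ full, ∀ p' ∈ full, a p ≠ b p' := by
    rintro ⟨i, j⟩ hp ⟨i', j'⟩ hp' he
    have h1 := hlt _ hp
    have h2 := hlt _ hp'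
    simp only [ha, hb] at he h1 h2
    split_ifs at he with hj hj' hj0 hj' hj0
    · exact (hzC _).1.1 (he ▸ huC i j hj)
    · exact hC12 (huC i j hj) (hwC i' j' hj') he
    · exact (hyC _).1.1 (he ▸ huC i j hj)
    · exact hzw _ _ _ (by omega) he.symm
    · exact hj0 (hwinj _ _ _ _ (by omega) hj' he).2.symm
    · exact hyw _ _ _ (by omega) he.symm
  have haC : ∀ p ∈ full, c (a p) ∉ C₃ ∪ C₄ := by
    rintro ⟨i, j⟩ hp
    simp only [ha]
    split_ifs with hj
    · exact hC1_34 (huC i j hj)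
    · exact hC2_34 (hwC i 0 (by omega))
  have hbC : ∀ p ∈ full, c (b p) ∉ C₃ ∪ C₄ := by
    rintro ⟨i, j⟩ hp
    simp only [hb]
    split_ifs with hj hj0
    · simpa using (hzC i).2
    · exact hC2_34 (hwC i j hj)
    · simpa using (hyC i).2
  simp only [Finset.mem_union, not_or] at haC hbC
  have hfullc : full.card = σ * (k + 1) := by simp [hfull]
  have hss : full \ Qs ⊆ full := Finset.sdiff_subset
  obtain ⟨E3, L3, hL3⟩ := exists_linkage hE hβ (a := a) (b := b) hh hh hβk B C₃ (full \ Qs)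
    (hainj.mono (by exact_mod_cast hss)) (hbinj.mono (by exact_mod_cast hss))
    (fun p hp p' hp' => hab p (hss hp) p' (hss hp')) (fun p hp => (haC p (hss hp)).1)
    (fun p hp => (hbC p (hss hp)).1)
    ((Finset.card_le_card hss).trans (by rw [hfullc, hk]; exact hB)) (by rw [hk']; omega)
  -- Lengthening the half-walk on the `a` side to `h + 1` colours gives paths with `k + 1` inner
  -- vertices.
  obtain ⟨E4, L4, hL4⟩ := exists_linkage hE hβ (a := a) (b := b) (p := h + 1) (q := h)
    (hh.trans (Nat.pow_lt_pow_right (by norm_num) (by omega))) hh hβk B C₄ Qs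
    (hainj.mono (by exact_mod_cast hQsub)) (hbinj.mono (by exact_mod_cast hQsub))
    (fun p hp p' hp' => hab p (hQsub hp) p' (hQsub hp')) (fun p hp => (haC p (hQsub hp)).2)
    (fun p hp => (hbC p (hQsub hp)).2)
    ((Finset.card_le_card hQsub).trans (by rw [hfullc, hk]; exact hB))
    (by rw [show h + 1 + 1 + h = 2 * h + 2 by ring]; exact h4)
  set len : Fin σ × ℕ → ℕ := fun p => if p ∈ Qs then k + 1 else k with hlen
  have hL := (hL3.congr_len (len' := len) (fun p hp => by
      simp only [hlen, if_neg (Finset.mem_sdiff.1 hp).2]; omega)).union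
    (hL4.congr_len (len' := len) (fun p hp => by simp only [hlen, if_pos hp]; omega))
    Finset.sdiff_disjoint h34
  rw [Finset.sdiff_union_of_subset hQsub] at hL
  set L : Fin σ × ℕ → List V := fun p => if p ∈ full \ Qs then L3 p else L4 p with hLdef
  have hmemfull : ∀ i j, j < k + 1 → (i, j) ∈ full := fun i j hj => by
    simp [hfull, hj]
  set EL : V → V → Prop := fun x y => E3 x y ∨ E4 x y with hEL
  set E : V → V → Prop := fun x y => (EU x y ∨ EW x y) ∨ EL x y with hEdef
  have hemit : IsEmission c R ((C₁ ∪ C₂) ∪ (C₃ ∪ C₄)) E :=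
    (hU.emission.union hW.emission h12).union hL.emission h1234
  have hUE : ∀ x y, SymmOf EU x y → SymmOf E x y := fun x y =>
    SymmOf.mono fun x y hxy => Or.inl (Or.inl hxy)
  have hWE : ∀ x y, SymmOf EW x y → SymmOf E x y := fun x y =>
    SymmOf.mono fun x y hxy => Or.inl (Or.inr hxy)
  have hLE : ∀ x y, SymmOf EL x y → SymmOf E x y := fun x y =>
    SymmOf.mono fun x y hxy => Or.inr hxy
  set T : Fin σ → List (V × List V × V) := fun i =>
    (List.range (k - 1)).map fun j => (u i (j + 1), L (i, j + 1), w i (j + 1)) with hTdef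
  have hT1 : ∀ i, (T i).map (fun a => a.1) = (List.range (k - 1)).map fun j => u i (j + 1) := by
    intro i; simp [hTdef, Function.comp_def]
  have hT2 : ∀ i, (T i).map (fun a => a.2.2) = (List.range (k - 1)).map fun j => w i (j + 1) := by
    intro i; simp [hTdef, Function.comp_def]
  have hT3 : ∀ i, (T i).flatMap (fun a => a.2.1) =
      (List.range (k - 1)).flatMap fun j => L (i, j + 1) := by
    intro i; simp [hTdef, List.flatMap_map]
  have hkpos : 0 < k := by omega
  have hrange : List.range (k + 1) = 0 :: ((List.range (k - 1)).map (· + 1) ++ [k]) := by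
    obtain ⟨k', hk'⟩ : ∃ k', k = k' + 1 := ⟨k - 1, by omega⟩
    rw [hk', List.range_succ_eq_map, List.range_succ]
    simp
  refine ⟨E, fun i => u i 0, fun i => w i 0, fun i => L (i, 0), fun i => L (i, k), T, hemit,
    ?_, ?_, ?_, ?_, ?_, ?_⟩
  · intro i
    have := (hL.chain (i, 0) (hmemfull i 0 (by omega))).imp hLE
    simpa [ha, hb, hkpos, hLdef] using this
  · intro i
    have := (hL.chain (i, k) (hmemfull i k (by omega))).imp hLE
    simpa [ha, hb, hLdef] using this
  · intro i
    have := (hU.chain i (Finset.mem_univ i)).imp hUE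
    rw [hUeq i] at this
    rw [hT1]
    simpa using this
  · intro i
    have := (hW.chain i (Finset.mem_univ i)).imp hWE
    rw [hWeq i] at this
    rw [hT2]
    simpa using this
  · intro i x hx
    obtain ⟨j, hj, rfl⟩ := List.mem_map.1 hx
    rw [List.mem_range] at hj
    have := (hL.chain (i, j + 1) (hmemfull i (j + 1) (by omega))).imp hLE
    have hj1 : j + 1 < k := by omega
    simpa [ha, hb, hj1, hLdef] using this
  · set F' : Fin σ → List V := fun i => (U i ++ W i) ++
      (List.range (k + 1)).flatMap fun j => L (i, j) with hF'
    have hFL : IsDisjointFamily (fun i => (List.range (k + 1)).flatMap fun j => L (i, j))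
        {x | c x ∈ C₃ ∪ C₄} := by
      refine ⟨?_, ?_, ?_⟩
      · intro i
        rw [List.nodup_flatMap]
        refine ⟨fun j hj => hL.nodup (i, j) (hmemfull i j (List.mem_range.1 hj)), ?_⟩
        refine List.Pairwise.imp_of_mem ?_ (List.nodup_range (n := k + 1))
        intro j j' hj hj' hne
        exact hL.disjoint (i, j) (hmemfull i j (List.mem_range.1 hj)) (i, j')
          (hmemfull i j' (List.mem_range.1 hj')) (by simpa using hne)
      · intro i i' hne x hx hx'
        obtain ⟨j, hj, hx⟩ := List.mem_flatMap.1 hx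
        obtain ⟨j', hj', hx'⟩ := List.mem_flatMap.1 hx'
        exact hL.disjoint (i, j) (hmemfull i j (List.mem_range.1 hj)) (i', j')
          (hmemfull i' j' (List.mem_range.1 hj')) (by simp [hne]) hx hx'
      · intro i x hx
        obtain ⟨j, hj, hx⟩ := List.mem_flatMap.1 hx
        exact hL.colour (i, j) (hmemfull i j (List.mem_range.1 hj)) x hx
    have hF'fam := (hUf.append hWf (Set.disjoint_left.2 fun x hx hx' =>
      Finset.disjoint_left.1 h12 hx hx')).append hFL (Set.disjoint_left.2 fun x hx hx' =>
        hx.elim (fun h => hC1_34 h hx') (fun h => hC2_34 h hx'))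
    refine ⟨_, fun i => rfl, ?_, ?_⟩
    · refine (hF'fam.perm fun i => ?_).mono ?_
      · rw [List.perm_iff_count]
        intro x
        rw [hT1, hT2, hT3, hUeq i, hWeq i, hrange]
        simp only [List.count_append, List.count_cons, List.flatMap_cons, List.flatMap_append,
          List.flatMap_map, List.flatMap_nil, List.append_nil]
        omega
      · rintro x ((hx | hx) | hx)
        · exact Finset.mem_union_left _ (Finset.mem_union_left _ hx)
        · exact Finset.mem_union_left _ (Finset.mem_union_right _ hx)
        · exact Finset.mem_union_right _ hx
    · have hLlen : ∀ i j, j < k + 1 → (L (i, j)).length = len (i, j) := fun i j hj =>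
        hL.length (i, j) (hmemfull i j hj)
      have hlenj : ∀ i : Fin σ, ∀ j, j < k → len (i, j) = k := by
        intro i j hj
        have : (i, j) ∉ Qs := by
          simp only [hQs, Finset.mem_product, Finset.mem_singleton]
          omega
        simp only [hlen, if_neg this]
      have hlenk : ∀ i : Fin σ, len (i, k) = k + if i.val < q then 1 else 0 := by
        intro i
        by_cases hi : i.val < q
        · have : (i, k) ∈ Qs := by simp [hQs, hi]
          simp only [hlen, if_pos this, if_pos hi]
        · have : (i, k) ∉ Qs := by simp [hQs, hi]
          simp only [hlen, if_neg this, if_neg hi, add_zero]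
      have hsum : ∀ i : Fin σ, (u i 0 :: w i 0 :: (L (i, 0) ++ (L (i, k) ++
          ((T i).map (fun a => a.1) ++ ((T i).map (fun a => a.2.2) ++
            (T i).flatMap fun a => a.2.1))))).length =
          2 * k + (k + 1) * k + if i.val < q then 1 else 0 := by
        intro i
        rw [hT1, hT2, hT3]
        have hmid : ((List.range (k - 1)).flatMap fun j => L (i, j + 1)).length = (k - 1) * k := by
          rw [List.length_flatMap]
          have : (List.range (k - 1)).map (fun j => (L (i, j + 1)).length) =
              (List.range (k - 1)).map fun _ => k := by
            refine List.map_congr_left fun j hj => ?_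
            rw [List.mem_range] at hj
            rw [hLlen i (j + 1) (by omega), hlenj i (j + 1) (by omega)]
          rw [this]
          simp
        simp only [List.length_cons, List.length_append, List.length_map, List.length_range, hmid,
          hLlen i 0 (by omega), hlenj i 0 hkpos, hLlen i k (by omega), hlenk i]
        obtain ⟨k', hk'⟩ : ∃ k', k = k' + 1 := ⟨k - 1, by omega⟩
        rw [hk']
        simp only [Nat.add_sub_cancel]
        ring
      rw [Finset.sum_congr rfl fun i _ => hsum i, Finset.sum_add_distrib, Finset.sum_const,
        Finset.card_univ, Fintype.card_fin, ← Finset.card_filter, smul_eq_mul]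
      congr 1
      rw [Fin.card_filter_val_lt]
      omega

end Ladders

/-! ### The Hamilton tour in an expanding coloured digraph. -/

section Core

variable {V J : Type*} [Fintype V] [DecidableEq V] [DecidableEq J]

/-- Layers must have exactly `σ` vertices, but classes only have between `σ / 2` and `σ`. The second
colour serves to fill up. -/
lemma exists_enumerated_set {c : V → J} {σ : ℕ} {j j' : J} (hj : j ≠ j')
    (h1 : (colourClass c j).card ≤ σ) (h2 : σ ≤ 2 * (colourClass c j).card)
    (h3 : σ ≤ 2 * (colourClass c j').card) :
    ∃ (X : Finset V) (f : Fin σ → V), X.card = σ ∧ colourClass c j ⊆ X ∧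
      (∀ x ∈ X, c x = j ∨ c x = j') ∧ Function.Injective f ∧ ∀ x, x ∈ X ↔ ∃ i, f i = x := by
  have hd : Disjoint (colourClass c j) (colourClass c j') := by
    rw [Finset.disjoint_left]
    intro x hx hx'
    exact hj ((mem_colourClass.1 hx).symm.trans (mem_colourClass.1 hx'))
  obtain ⟨X, hX1, hX2, hXc⟩ := Finset.exists_subsuperset_card_eq
    (Finset.subset_union_left (s₁ := colourClass c j) (s₂ := colourClass c j')) h1
    (by rw [Finset.card_union_of_disjoint hd]; omega)
  refine ⟨X, fun i => ((X.equivFinOfCardEq hXc).symm i : V), hXc, hX1, ?_, ?_, ?_⟩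
  · intro x hx
    simpa [mem_colourClass] using hX2 hx
  · exact Subtype.val_injective.comp (Equiv.injective _)
  · intro x
    constructor
    · intro hx
      exact ⟨X.equivFinOfCardEq hXc ⟨x, hx⟩, by simp⟩
    · rintro ⟨i, rfl⟩
      exact Subtype.prop _

/-- In a coloured digraph in which every set expands well into every colour class, the arcs contain
a Hamilton tour in which no vertex emits two arcs into the same colour. -/
theorem exists_hamiltonTour_of_isExpanding [Fintype J] {c : V → J} {R : V → V → Prop} {σ β : ℕ}
    (hE : IsExpanding c R σ β) (hβ : β ≤ σ) (hσ : 2 ≤ σ)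
    (hlow : ∀ j, σ ≤ 2 * (colourClass c j).card) {h B : ℕ} (hh : σ < 2 ^ (h + 1))
    (hB : σ * (2 * h + 2) ≤ B * β)
    (hcap : 3 + (2 * (2 * h + 1) + (2 * h + 2) * (2 * h + 1)) ≤ Fintype.card V / σ)
    (hcol : Fintype.card V / σ + 6 + 4 * (B * (h + 1) * (2 * h + 2)) ≤ Fintype.card J) :
    ∃ (C : Finset J) (E : V → V → Prop), IsEmission c R C E ∧ HasHamiltonTour (SymmOf E) := by
  classical
  set n := Fintype.card V with hn
  set G := 2 * (2 * h + 1) + (2 * h + 2) * (2 * h + 1) with hG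
  set Q := B * (h + 1) * (2 * h + 2) with hQ
  -- Per index, `3` vertices are terminals and `G` belong to the ladder; each of the `m` inner
  -- layers contributes one more. The remainder `q` goes into the longer connections.
  set m := n / σ - (3 + G) with hm
  set q := n % σ with hq
  have hqσ : q < σ := Nat.mod_lt _ (by omega)
  have hnsum : n = σ * (3 + G) + m * σ + q := by
    have h1 := Nat.div_add_mod n σ
    have h2 : n / σ = (3 + G) + m := by omega
    rw [h2] at h1
    rw [← h1]
    ring
  have hN : m + 9 + 4 * Q ≤ Fintype.card J := by omega
  -- numbering of the colours
  set N := Fintype.card J with hNdef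
  set κ : J → ℕ := fun j => (Fintype.equivFin J j).val with hκ
  have : Nonempty J := Fintype.card_pos_iff.1 (by omega)
  obtain ⟨ε, hε⟩ : ∃ ε : ℕ → J, ∀ i < N, κ (ε i) = i := by
    refine ⟨fun i => if hi : i < N then (Fintype.equivFin J).symm ⟨i, hi⟩ else Classical.arbitrary J,
      fun i hi => ?_⟩
    simp [hκ, hi]
  have hεinj : ∀ i < N, ∀ i' < N, ε i = ε i' → i = i' := fun i hi i' hi' he => by
    rw [← hε i hi, ← hε i' hi', he]
  -- Numbering of the colours: `0` and `1` fill up the first and last layer, `2` and `3` supply the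
  -- vertices `z`, the colours `4` to `m + 5` belong to the layers, and four blocks of `Q` colours
  -- from `m + 6` on serve the ladders.
  set C : ℕ → Finset J := fun r => (Finset.Ico (m + 6 + r * Q) (m + 6 + (r + 1) * Q)).image ε with hC
  have hCcard : ∀ r < 4, (C r).card = Q := by
    intro r hr
    have hr1 : (r + 1) * Q ≤ 4 * Q := Nat.mul_le_mul (by omega) le_rfl
    rw [hC]
    simp only
    rw [Finset.card_image_of_injOn, Nat.card_Ico, Nat.succ_mul]
    · omega
    · intro i hi i' hi' he
      simp only [Finset.coe_Ico, Set.mem_Ico] at hi hi'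
      exact hεinj i (by omega) i' (by omega) he
  have hCmem : ∀ r < 4, ∀ j ∈ C r, m + 6 + r * Q ≤ κ j ∧ κ j < m + 6 + (r + 1) * Q := by
    intro r hr j hj
    have hr1 : (r + 1) * Q ≤ 4 * Q := Nat.mul_le_mul (by omega) le_rfl
    obtain ⟨i, hi, rfl⟩ := Finset.mem_image.1 hj
    rw [Finset.mem_Ico] at hi
    rw [hε i (by omega)]
    exact hi
  have hCdis : ∀ r < 4, ∀ r' < 4, r < r' → Disjoint (C r) (C r') := by
    intro r hr r' hr' hlt
    rw [Finset.disjoint_left]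
    intro j hj hj'
    have h1 := (hCmem r hr j hj).2
    have h2 := (hCmem r' hr' j hj').1
    have h3 : (r + 1) * Q ≤ r' * Q := Nat.mul_le_mul (by omega) le_rfl
    omega
  set CC := (C 0 ∪ C 1) ∪ (C 2 ∪ C 3) with hCC
  have hCCmem : ∀ j ∈ CC, m + 6 ≤ κ j := by
    intro j hj
    simp only [hCC, Finset.mem_union] at hj
    rcases hj with (hj | hj) | (hj | hj)
    · have := (hCmem 0 (by omega) j hj).1; omega
    · have := (hCmem 1 (by omega) j hj).1; omega
    · have := (hCmem 2 (by omega) j hj).1; omega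
    · have := (hCmem 3 (by omega) j hj).1; omega
  have hεne : ∀ i < N, ∀ i' < N, i ≠ i' → ε i ≠ ε i' := fun i hi i' hi' hne he =>
    hne (hεinj i hi i' hi' he)
  -- terminals
  obtain ⟨X, t, hXc, hXsub, hXcol, htinj, htX⟩ := exists_enumerated_set (c := c)
    (hεne 4 (by omega) 0 (by omega) (by omega)) (hE.card_class_le _) (hlow _) (hlow _)
  obtain ⟨Y, y, hYc, hYsub, hYcol, hyinj, hyY⟩ := exists_enumerated_set (c := c)
    (hεne (m + 5) (by omega) 1 (by omega) (by omega)) (hE.card_class_le _) (hlow _) (hlow _)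
  obtain ⟨Z, z, hZc, hZsub, hZcol, hzinj, hzZ⟩ := exists_enumerated_set (c := c)
    (hεne 2 (by omega) 3 (by omega) (by omega)) (hE.card_class_le _) (hlow _) (hlow _)
  have hXκ : ∀ x ∈ X, κ (c x) = 4 ∨ κ (c x) = 0 := fun x hx => by
    rcases hXcol x hx with e | e
    · left; rw [e]; exact hε _ (by omega)
    · right; rw [e]; exact hε _ (by omega)
  have hYκ : ∀ x ∈ Y, κ (c x) = m + 5 ∨ κ (c x) = 1 := fun x hx => by
    rcases hYcol x hx with e | e
    · left; rw [e]; exact hε _ (by omega)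
    · right; rw [e]; exact hε _ (by omega)
  have hZκ : ∀ x ∈ Z, κ (c x) = 2 ∨ κ (c x) = 3 := fun x hx => by
    rcases hZcol x hx with e | e
    · left; rw [e]; exact hε _ (by omega)
    · right; rw [e]; exact hε _ (by omega)
  have htκ : ∀ i, κ (c (t i)) = 4 ∨ κ (c (t i)) = 0 := fun i => hXκ _ ((htX _).2 ⟨i, rfl⟩)
  have hyκ : ∀ i, κ (c (y i)) = m + 5 ∨ κ (c (y i)) = 1 := fun i => hYκ _ ((hyY _).2 ⟨i, rfl⟩)
  have hzκ : ∀ i, κ (c (z i)) = 2 ∨ κ (c (z i)) = 3 := fun i => hZκ _ ((hzZ _).2 ⟨i, rfl⟩)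
  have htz : ∀ i i', t i ≠ z i' := fun i i' he => by
    have h1 := htκ i; have h2 := hzκ i'; rw [he] at h1; omega
  have hyz : ∀ i i', y i ≠ z i' := fun i i' he => by
    have h1 := hyκ i; have h2 := hzκ i'; rw [he] at h1; omega
  have hty : ∀ i i', t i ≠ y i' := fun i i' he => by
    have h1 := htκ i; have h2 := hyκ i'; rw [he] at h1; omega
  obtain ⟨σ', rfl⟩ : ∃ σ', σ = σ' + 2 := ⟨σ - 2, by omega⟩
  have hs : ∀ i i', (finRotate (σ' + 2)).SameCycle i i' := by
    intro i i'
    have hsup := support_finRotate (n := σ')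
    refine isCycle_finRotate.sameCycle ?_ ?_
    · rw [← Equiv.Perm.mem_support, hsup]; exact Finset.mem_univ _
    · rw [← Equiv.Perm.mem_support, hsup]; exact Finset.mem_univ _
  have h1234 : Disjoint (C 0 ∪ C 1) (C 2 ∪ C 3) := by
    rw [Finset.disjoint_union_left, Finset.disjoint_union_right, Finset.disjoint_union_right]
    exact ⟨⟨hCdis 0 (by omega) 2 (by omega) (by omega), hCdis 0 (by omega) 3 (by omega) (by omega)⟩,
      ⟨hCdis 1 (by omega) 2 (by omega) (by omega), hCdis 1 (by omega) 3 (by omega) (by omega)⟩⟩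
  obtain ⟨E1, u, w, OU, OW, T, hE1, hOU, hOW, hU, hW, hT, F, hF, hFfam, hFlen⟩ :=
    exists_ladders hE hβ hh hB hqσ.le (finRotate (σ' + 2)) htinj hyinj hzinj htz hyz
      (C₁ := C 0) (C₂ := C 1) (C₃ := C 2) (C₄ := C 3)
      (hCcard 0 (by omega)).ge (hCcard 1 (by omega)).ge (hCcard 2 (by omega)).ge
      (hCcard 3 (by omega)).ge (hCdis 0 (by omega) 1 (by omega) (by omega))
      (hCdis 2 (by omega) 3 (by omega) (by omega)) h1234
      (fun i hi => by have h1 := hCCmem _ hi; have h2 := htκ i; omega)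
      (fun i hi => by have h1 := hCCmem _ hi; have h2 := hyκ i; omega)
      (fun i hi => by have h1 := hCCmem _ hi; have h2 := hzκ i; omega)
  -- the vertices outside the ladders
  set K : Fin (σ' + 2) → List V := fun i => (([z i] ++ [y i]) ++ [t i]) ++ F i with hK
  have hKfam : IsDisjointFamily K
      (((Set.range z ∪ Set.range y) ∪ Set.range t) ∪ {x | c x ∈ CC}) := by
    refine (((isDisjointFamily_singleton hzinj).append (isDisjointFamily_singleton hyinj) ?_).append
      (isDisjointFamily_singleton htinj) ?_).append hFfam ?_
    · rw [Set.disjoint_left]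
      rintro _ ⟨i, rfl⟩ ⟨i', he⟩
      exact hyz i' i he
    · rw [Set.disjoint_left]
      rintro _ (⟨i, rfl⟩ | ⟨i, rfl⟩) ⟨i', he⟩
      · exact htz i' i he
      · exact hty i' i he
    · rw [Set.disjoint_left]
      rintro _ ((⟨i, rfl⟩ | ⟨i, rfl⟩) | ⟨i, rfl⟩) hx
      · have h1 := hCCmem _ hx; have h2 := hzκ i; omega
      · have h1 := hCCmem _ hx; have h2 := hyκ i; omega
      · have h1 := hCCmem _ hx; have h2 := htκ i; omega
  have hKκ : ∀ i, ∀ x ∈ K i, κ (c x) ≤ 4 ∨ m + 5 ≤ κ (c x) := by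
    intro i x hx
    rcases hKfam.mem i x hx with ((⟨i', rfl⟩ | ⟨i', rfl⟩) | ⟨i', rfl⟩) | hx
    · have := hzκ i'; omega
    · have := hyκ i'; omega
    · have := htκ i'; omega
    · have := hCCmem _ hx; omega
  set U := Finset.univ.biUnion fun i => (K i).toFinset with hUdef
  have hUmem : ∀ x, x ∈ U ↔ ∃ i, x ∈ K i := by intro x; simp [hUdef]
  have hUcard : U.card = (σ' + 2) * (3 + G) + q := by
    rw [hKfam.card_biUnion]
    have : ∀ i, (K i).length = 3 + (F i).length := by
      intro i; simp [hK]; omega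
    rw [Finset.sum_congr rfl fun i _ => this i, Finset.sum_add_distrib, hFlen, Finset.sum_const,
      Finset.card_univ, Fintype.card_fin, smul_eq_mul]
    ring
  have hWcard : (Finset.univ \ U).card = m * (σ' + 2) := by
    have := Finset.card_sdiff_add_card_eq_card (Finset.subset_univ U)
    rw [Finset.card_univ] at this
    omega
  -- All vertices not yet used, of whatever colour, go into the inner layers. The class of the
  -- colour numbered `5 + l` lies entirely in layer `l`, as the matchings require.
  obtain ⟨L', hL'c, hL'sub, hL'dis, hL'mem⟩ := exists_layer_partition m (Finset.univ \ U)
    (fun l => colourClass c (ε (5 + l))) hWcard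
    (by
      intro l hl x hx
      refine Finset.mem_sdiff.2 ⟨Finset.mem_univ _, fun hxU => ?_⟩
      obtain ⟨i, hi⟩ := (hUmem x).1 hxU
      have h1 := hKκ i x hi
      rw [mem_colourClass.1 hx, hε _ (by omega)] at h1
      omega)
    (fun l _ => hE.card_class_le _)
    (by
      intro l hl l' hl' hne
      rw [Finset.disjoint_left]
      intro x hx hx'
      have h1 := hεinj _ (by omega) _ (by omega)
        ((mem_colourClass.1 hx).symm.trans (mem_colourClass.1 hx'))
      omega)
  have htU : ∀ i, t i ∈ U := fun i => (hUmem _).2 ⟨i, by simp [hK]⟩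
  have hyU : ∀ i, y i ∈ U := fun i => (hUmem _).2 ⟨i, by simp [hK]⟩
  have hL'U : ∀ l < m, ∀ x ∈ L' l, x ∉ U := fun l hl x hx =>
    (Finset.mem_sdiff.1 ((hL'mem x).2 ⟨l, hl, hx⟩)).2
  have hXL' : ∀ l < m, Disjoint X (L' l) := fun l hl => Finset.disjoint_left.2 fun x hx hx' => by
    obtain ⟨i, rfl⟩ := (htX x).1 hx
    exact hL'U l hl _ hx' (htU i)
  have hYL' : ∀ l < m, Disjoint Y (L' l) := fun l hl => Finset.disjoint_left.2 fun x hx hx' => by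
    obtain ⟨i, rfl⟩ := (hyY x).1 hx
    exact hL'U l hl _ hx' (hyU i)
  have hXY : Disjoint X Y := Finset.disjoint_left.2 fun x hx hx' => by
    have h1 := hXκ x hx; have h2 := hYκ x hx'; omega
  set L : ℕ → Finset V := fun l => if l = 0 then X else if l ≤ m then L' (l - 1) else Y with hL
  have hLcases : ∀ l ≤ m + 1, (l = 0 ∧ L l = X) ∨ (∃ l' < m, l = l' + 1 ∧ L l = L' l') ∨
      (l = m + 1 ∧ L l = Y) := by
    intro l hl
    rcases Nat.eq_zero_or_pos l with h0 | h0
    · left; exact ⟨h0, by simp [hL, h0]⟩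
    · rcases Nat.lt_or_ge m l with h1 | h1
      · right; right
        refine ⟨by omega, ?_⟩
        simp only [hL]
        rw [if_neg (by omega), if_neg (by omega)]
      · right; left
        refine ⟨l - 1, by omega, by omega, ?_⟩
        simp only [hL]
        rw [if_neg (by omega), if_pos h1]
  have hL0 : L 0 = X := by simp [hL]
  obtain ⟨E2, D, e, hE2, heinj, heL, hD, hDnd, hDdis, hDmem⟩ := exists_layer_paths hE
    (L := L) (j := fun l => ε (4 + l)) htinj (by rw [hL0]; exact htX) m
    (by
      intro l hl
      rcases hLcases l hl with ⟨-, e⟩ | ⟨l', hl', -, e⟩ | ⟨-, e⟩ <;> rw [e]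
      · exact hXc
      · exact hL'c l' hl'
      · exact hYc)
    (by
      intro l hl
      rcases hLcases l hl with ⟨rfl, e⟩ | ⟨l', hl', rfl, e⟩ | ⟨rfl, e⟩ <;> rw [e]
      · exact hXsub
      · have := hL'sub l' hl'
        rwa [show 4 + (l' + 1) = 5 + l' by ring]
      · rwa [show 4 + (m + 1) = m + 5 by ring])
    (by
      intro l hl l' hl' hne
      rcases hLcases l hl with ⟨h1, e⟩ | ⟨k, hk, h1, e⟩ | ⟨h1, e⟩ <;>
        rcases hLcases l' hl' with ⟨h2, e'⟩ | ⟨k', hk', h2, e'⟩ | ⟨h2, e'⟩ <;> rw [e, e']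
      · omega
      · exact hXL' k' hk'
      · exact hXY
      · exact (hXL' k hk).symm
      · exact hL'dis k hk k' hk' (by omega)
      · exact (hYL' k hk).symm
      · exact hXY.symm
      · exact hYL' k' hk'
      · omega)
    (by
      intro l hl l' hl' he
      have := hεinj _ (by omega) _ (by omega) he
      omega)
  have hLm : L (m + 1) = Y := by
    rcases hLcases (m + 1) le_rfl with ⟨h1, -⟩ | ⟨l', h1, h2, -⟩ | ⟨-, e⟩
    · omega
    · omega
    · exact e
  have hLsucc : ∀ l < m, L (l + 1) = L' l := by
    intro l hl
    rcases hLcases (l + 1) (by omega) with ⟨h1, -⟩ | ⟨l', h1, h2, e⟩ | ⟨h1, e⟩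
    · omega
    · rw [e]; congr 1; omega
    · omega
  have hπ : ∀ i, ∃ i', y i' = e i := fun i => (hyY _).1 (hLm ▸ heL i)
  choose π₀ hπ₀ using hπ
  have hπinj : Function.Injective π₀ := fun i i' he => heinj (by rw [← hπ₀, ← hπ₀, he])
  -- `π` records where the layer paths happen to end. Nothing is known about it beyond bijectivity;
  -- the switches compensate for its cycle structure.
  set π := Equiv.ofBijective π₀ (Finite.injective_iff_bijective.1 hπinj) with hπdef
  have hDU : ∀ x, (∃ i, x ∈ D i) ↔ x ∉ U := by
    intro x
    rw [hDmem]
    constructor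
    · rintro ⟨l, hl, hx⟩
      exact hL'U l hl x (hLsucc l hl ▸ hx)
    · intro hx
      obtain ⟨l, hl, hxl⟩ := (hL'mem x).1 (Finset.mem_sdiff.2 ⟨Finset.mem_univ x, hx⟩)
      exact ⟨l, hl, by rwa [hLsucc l hl]⟩
  have hDfam : IsDisjointFamily D {x | x ∉ U} :=
    ⟨hDnd, hDdis, fun i x hx => (hDU x).1 ⟨i, hx⟩⟩
  have hKU : IsDisjointFamily K {x | x ∈ U} :=
    ⟨hKfam.nodup, hKfam.disjoint, fun i x hx => (hUmem x).2 ⟨i, hx⟩⟩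
  have hall := hKU.append hDfam (Set.disjoint_left.2 fun x hx hx' => hx' hx)
  set E : V → V → Prop := fun x y => E1 x y ∨ E2 x y with hEdef
  have hemit : IsEmission c R (CC ∪ (Finset.range (m + 2)).image fun l => ε (4 + l)) E := by
    refine hE1.union hE2 ?_
    rw [Finset.disjoint_left]
    intro j hj hj'
    obtain ⟨l, hl, rfl⟩ := Finset.mem_image.1 hj'
    rw [Finset.mem_range] at hl
    have := hCCmem _ hj
    rw [hε _ (by omega)] at this
    omega
  have hm1 : ∀ x y, SymmOf E1 x y → SymmOf E x y := fun x y =>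
    SymmOf.mono fun _ _ hxy => Or.inl hxy
  have hm2 : ∀ x y, SymmOf E2 x y → SymmOf E x y := fun x y =>
    SymmOf.mono fun _ _ hxy => Or.inr hxy
  set base : Fin (σ' + 2) → List V := fun i =>
    z i :: y i :: t i :: u i :: w i :: (OU i ++ (OW i ++ (D i ++
      ((T i).map (fun a => a.1) ++ ((T i).map (fun a => a.2.2) ++
        (T i).flatMap fun a => a.2.1))))) with hbase
  have hbperm : ∀ i, (base i).Perm (K i ++ D i) := by
    intro i
    rw [List.perm_iff_count]
    intro x
    simp only [hbase, hK, hF, List.count_append, List.count_cons, List.count_nil]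
    omega
  have hbfam := hall.perm hbperm
  refine ⟨_, E, hemit, hasHamiltonTour_of_ladders (fun x y h => h.symm) (finRotate (σ' + 2)) π hs
    t y z u w OU OW D T (fun i => (hOU i).imp hm1) (fun i => (hOW i).imp hm1) ?_
    (fun i => (hU i).imp hm1) (fun i => (hW i).imp hm1) (fun i a ha => (hT i a ha).imp hm1)
    base (fun i => rfl) hbfam.nodup hbfam.disjoint ?_⟩
  · intro i
    have : y (π i) = e i := hπ₀ i
    rw [this]
    exact (hD i).imp hm2
  · intro v
    by_cases hv : v ∈ U
    · obtain ⟨i, hi⟩ := (hUmem v).1 hv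
      exact ⟨i, (hbperm i).mem_iff.2 (List.mem_append_left _ hi)⟩
    · obtain ⟨i, hi⟩ := (hDU v).2 hv
      exact ⟨i, (hbperm i).mem_iff.2 (List.mem_append_right _ hi)⟩

end Core

/-! ### Arcs of a coloured hypergraph: distinct hyperedges and expansion. -/

namespace UniformHypergraph

/-- `H.Arc c x y`: some hyperedge contains `x` and `y`, and all its vertices but `x` have the colour
of `y`. -/
def Arc {V J : Type*} {r : ℕ} (H : UniformHypergraph V r) (c : V → J) (x y : V) : Prop :=
  c x ≠ c y ∧ ∃ e ∈ H.edges, x ∈ e ∧ y ∈ e ∧ ∀ z ∈ e, z ≠ x → c z = c y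

/-- The hyperedges at `v` all of whose other vertices have colour `j`. -/
noncomputable def colourLink {V J : Type*} [DecidableEq V] [DecidableEq J] {r : ℕ}
    (H : UniformHypergraph V r) (c : V → J) (v : V) (j : J) : Finset (Finset V) :=
  H.edges.filter fun e => v ∈ e ∧ ∀ z ∈ e, z ≠ v → c z = j

lemma mem_colourLink {V J : Type*} [DecidableEq V] [DecidableEq J] {r : ℕ}
    {H : UniformHypergraph V r} {c : V → J} {v : V} {j : J} {e : Finset V} :
    e ∈ H.colourLink c v j ↔ e ∈ H.edges ∧ v ∈ e ∧ ∀ z ∈ e, z ≠ v → c z = j :=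
  Finset.mem_filter

/-- A third vertex of `e`, different from `x` and `x'`, has both colours `j` and `j'`. If `x` were
not `x'`, it would have that colour as well. -/
lemma eq_of_arc_edge {V J : Type*} {c : V → J} {e : Finset V} (he : 3 ≤ e.card) {x x' : V}
    {j j' : J} (hx : x ∈ e) (hxj : c x ≠ j) (h : ∀ z ∈ e, z ≠ x → c z = j)
    (h' : ∀ z ∈ e, z ≠ x' → c z = j') : x = x' ∧ j = j' := by
  classical
  obtain ⟨z, hz, hzx⟩ : ∃ z ∈ e, z ∉ ({x, x'} : Finset V) :=
    Finset.exists_mem_notMem_of_card_lt_card (lt_of_le_of_lt Finset.card_le_two (by omega))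
  simp only [Finset.mem_insert, Finset.mem_singleton, not_or] at hzx
  have hjj : j = j' := (h z hz hzx.1).symm.trans (h' z hz hzx.2)
  refine ⟨?_, hjj⟩
  by_contra hne
  exact hxj ((h' x hx hne).trans hjj.symm)

/-- A Hamilton tour along arcs, no two of which leave the same vertex towards the same colour, gives
a Hamilton Berge cycle. -/
lemma hasHamiltonBergeCycle_of_tour {V J : Type*} [Fintype V] {r : ℕ} (hr : 3 ≤ r)
    (hV : 3 ≤ Fintype.card V) {H : UniformHypergraph V r} {c : V → J} {C : Finset J}
    {E : V → V → Prop} (hE : IsEmission c (H.Arc c) C E) (ht : HasHamiltonTour (SymmOf E)) :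
    H.HasHamiltonBergeCycle := by
  obtain ⟨v, hv, hvE⟩ := ht
  have hex : ∀ i, ∃ x y : V, E x y ∧ ((x = v i ∧ y = v (finRotate _ i)) ∨
      (y = v i ∧ x = v (finRotate _ i))) := by
    intro i
    rcases hvE i with h | h
    · exact ⟨_, _, h, Or.inl ⟨rfl, rfl⟩⟩
    · exact ⟨_, _, h, Or.inr ⟨rfl, rfl⟩⟩
  choose x y hxy hv' using hex
  have hedge : ∀ i, ∃ e ∈ H.edges, x i ∈ e ∧ y i ∈ e ∧ ∀ z ∈ e, z ≠ x i → c z = c (y i) :=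
    fun i => (hE.le _ _ (hxy i)).2
  choose e he hxe hye hze using hedge
  refine ⟨v, e, hv, ?_, he, ?_, ?_⟩
  · intro i i' hii
    have hcard : 3 ≤ (e i).card := (H.sized (he i)).symm ▸ hr
    obtain ⟨h1, h2⟩ := eq_of_arc_edge hcard (hxe i) (hE.le _ _ (hxy i)).1 (hze i)
      (fun z hz => hze i' z (hii ▸ hz))
    have h3 : y i = y i' := hE.functional _ _ _ (hxy i) (h1 ▸ hxy i') h2
    obtain ⟨n, hn⟩ : ∃ n, Fintype.card V = n + 3 := ⟨Fintype.card V - 3, by omega⟩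
    -- Equal arcs at two positions could still be traversed in opposite directions. That would make
    -- two steps of the rotation return to the start, which is impossible for at least three
    -- vertices.
    have hrot : ∀ k : Fin (Fintype.card V), finRotate _ (finRotate _ k) ≠ k := by
      rw [hn]
      intro k hk
      rw [finRotate_apply, finRotate_apply, add_assoc] at hk
      have h0 : (1 + 1 : Fin (n + 3)) = 0 := by simpa using hk
      have := congrArg Fin.val h0
      simp [Fin.val_add] at this
      rw [Nat.mod_eq_of_lt (by omega)] at this
      omega
    rcases hv' i with ⟨a1, a2⟩ | ⟨a1, a2⟩ <;> rcases hv' i' with ⟨b1, b2⟩ | ⟨b1, b2⟩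
    · exact hv (a1.symm.trans (h1.trans b1))
    · exfalso
      have e1 := hv (a1.symm.trans (h1.trans b2))
      have e2 := hv (a2.symm.trans (h3.trans b1))
      exact hrot i' (by rw [← e1, e2])
    · exfalso
      have e1 := hv (a1.symm.trans (h3.trans b2))
      have e2 := hv (a2.symm.trans (h1.trans b1))
      exact hrot i' (by rw [← e1, e2])
    · exact hv (a1.symm.trans (h3.trans b1))
  · intro i
    rcases hv' i with ⟨a1, -⟩ | ⟨a1, -⟩
    · rw [← a1]; exact hxe i
    · rw [← a1]; exact hye i
  · intro i
    rcases hv' i with ⟨-, a2⟩ | ⟨-, a2⟩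
    · rw [← a2]; exact hye i
    · rw [← a2]; exact hxe i

/-- Each counted hyperedge has exactly one vertex not coloured `j`, its tail in `S`, so none is
counted twice. Its other vertices are themselves out-neighbours of that tail, so it is a crossing
hyperedge for every `T ⊇ S` disjoint from the out-neighbourhood. -/
lemma sum_card_colourLink_le {V J : Type*} [Fintype V] [DecidableEq V] [DecidableEq J] {r : ℕ}
    {G H : UniformHypergraph V r} (hHG : H.IsSpanningSubgraph G) {c : V → J} {j : J}
    {S T : Finset V} (hST : S ⊆ T) (hS : ∀ x ∈ S, c x ≠ j)
    (hT : Disjoint T (outNbrs c (H.Arc c) j S)) :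
    ∑ x ∈ S, (H.colourLink c x j).card ≤ G.crossEdges T (outNbrs c (H.Arc c) j S) := by
  rw [← Finset.card_biUnion]
  · refine Finset.card_le_card fun e he => ?_
    obtain ⟨x, hx, he⟩ := Finset.mem_biUnion.1 he
    obtain ⟨heH, hxe, hez⟩ := mem_colourLink.1 he
    have hsub : e.erase x ⊆ outNbrs c (H.Arc c) j S := by
      intro z hz
      obtain ⟨hzx, hze⟩ := Finset.mem_erase.1 hz
      have hcz := hez z hze hzx
      exact mem_outNbrs.2 ⟨hcz, x, hx, hcz ▸ hS x hx, e, heH, hxe, hze, hcz ▸ hez⟩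
    have h1 : e ∩ T = {x} := by
      ext z
      rw [Finset.mem_inter, Finset.mem_singleton]
      constructor
      · rintro ⟨hze, hzT⟩
        by_contra hzx
        exact Finset.disjoint_left.1 hT hzT (hsub (Finset.mem_erase.2 ⟨hzx, hze⟩))
      · rintro rfl
        exact ⟨hxe, hST hx⟩
    have h2 : e ∩ outNbrs c (H.Arc c) j S = e.erase x := by
      ext z
      rw [Finset.mem_inter, Finset.mem_erase]
      constructor
      · rintro ⟨hze, hzU⟩
        refine ⟨?_, hze⟩
        rintro rfl
        exact hS z hx (mem_outNbrs.1 hzU).1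
      · rintro ⟨hzx, hze⟩
        exact ⟨hze, hsub (Finset.mem_erase.2 ⟨hzx, hze⟩)⟩
    refine Finset.mem_filter.2 ⟨hHG heH, by rw [h1, Finset.card_singleton], ?_⟩
    rw [h2, Finset.card_erase_of_mem hxe, H.sized heH]
  · intro x hx x' hx' hne
    refine Finset.disjoint_left.2 fun e he he' => ?_
    obtain ⟨_, hxe, hez⟩ := mem_colourLink.1 he
    obtain ⟨_, hxe', hez'⟩ := mem_colourLink.1 he'
    exact hS x' hx' (hez x' hxe' hne.symm)

/-- Pseudorandomness of `G` makes the arcs of `H ⊆ G` expanding, if every vertex of `H` has many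
hyperedges into every colour class. -/
lemma isExpanding_arc {V J : Type*} [Fintype V] [DecidableEq V] [DecidableEq J] {r : ℕ}
    {G H : UniformHypergraph V r} (hHG : H.IsSpanningSubgraph G) {ε p : ℝ}
    (hG : G.IsPseudorandom ε p) (hε : 0 < ε) (hε16 : ε ≤ 1 / 16) (hp : 0 ≤ p)
    {c : V → J} {σ β : ℕ} {D : ℝ}
    (hD : ∀ v j, c v ≠ j → D ≤ (H.colourLink c v j).card)
    (hclass : ∀ j, (colourClass c j).card ≤ σ) (hσ : 2 * σ ≤ Fintype.card V)
    (hhalf : ∀ u : ℕ, 2 * u < σ + 2 * β → u ≤ σ →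
      (1 + ε) * p * (u.choose (r - 1) : ℝ) + Real.log (Fintype.card V) ^ (1 + ε) < D)
    (hsmall : ∀ u : ℕ, (u : ℝ) < (13 * ((r - 1).factorial : ℝ) * Real.log (Fintype.card V : ℝ) /
        (ε ^ 3 * p)) ^ (1 / ((r : ℝ) - 1)) →
      16 * ((1 + ε) * p * (u.choose (r - 1) : ℝ) + Real.log (Fintype.card V) ^ (1 + ε)) < D) :
    IsExpanding c (H.Arc c) σ β where
  card_class_le := hclass
  expand j S hS := by
    by_contra! hcon
    obtain ⟨hc1, hc2⟩ := hcon
    set U := outNbrs c (H.Arc c) j S with hU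
    have hUP : U ⊆ colourClass c j := fun y hy => mem_colourClass.2 (mem_outNbrs.1 hy).1
    have hUσ : U.card ≤ σ := (Finset.card_le_card hUP).trans (hclass j)
    have hSU : Disjoint S U := Finset.disjoint_left.2 fun x hx hxU =>
      hS x hx (mem_outNbrs.1 hxU).1
    have hSpos : 0 < (S.card : ℝ) := by
      have : 0 < S.card := by omega
      exact_mod_cast this
    have hcount : ∀ T, S ⊆ T → Disjoint T U → D * S.card ≤ G.crossEdges T U := by
      intro T hST hT
      have h1 := sum_card_colourLink_le hHG hST hS hT
      have h2 : D * S.card ≤ ∑ x ∈ S, ((H.colourLink c x j).card : ℝ) := by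
        rw [mul_comm, ← nsmul_eq_mul]
        exact Finset.card_nsmul_le_sum _ _ _ fun x hx => hD x j (hS x hx)
      calc D * S.card ≤ ∑ x ∈ S, ((H.colourLink c x j).card : ℝ) := h2
        _ = ((∑ x ∈ S, (H.colourLink c x j).card : ℕ) : ℝ) := by push_cast; rfl
        _ ≤ _ := by exact_mod_cast h1
    have hlog : 0 ≤ Real.log (Fintype.card V) ^ (1 + ε) :=
      Real.rpow_nonneg (Real.log_natCast_nonneg _) _
    have hh := hhalf U.card hc2 hUσ
    -- Three ranges: for `|U| ≤ |S|` and for large `U` the two pseudorandomness bounds apply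
    -- directly. The ratio condition of the second follows from `|U| < 16 |S|` and `ε ≤ 1 / 16`.
    rcases le_or_gt U.card S.card with hle | hgt
    · have h1 := hcount S subset_rfl hSU
      have h2 := hG.upper_small S U hSU hle
      nlinarith
    · by_cases hbig : (13 * ((r - 1).factorial : ℝ) * Real.log (Fintype.card V : ℝ) /
          (ε ^ 3 * p)) ^ (1 / ((r : ℝ) - 1)) ≤ (U.card : ℝ)
      · have h1 := hcount S subset_rfl hSU
        have h16 : (U.card : ℝ) ≤ 16 * S.card := by exact_mod_cast hc1.le
        have h2 := hG.upper_large S U hSU (by nlinarith) hgt.le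
          (by
            rw [le_div_iff₀ (by norm_num)]
            have : U.card * 2 ≤ Fintype.card V := by omega
            exact_mod_cast this) hbig
        nlinarith
      · have hsub : S ⊆ Finset.univ \ U := fun x hx =>
          Finset.mem_sdiff.2 ⟨Finset.mem_univ x, Finset.disjoint_left.1 hSU hx⟩
        have huc := Finset.card_sdiff_add_card_eq_card (Finset.subset_univ U)
        rw [Finset.card_univ] at huc
        -- A small `U` with `|U| > |S|` fits neither bound, so `S` is enlarged to `T` with `|T| =
        -- |U|`. This costs at most the factor `16` in `hsmall`.
        obtain ⟨T, hST, hTU, hTc⟩ := Finset.exists_subsuperset_card_eq hsub hgt.le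
          (show U.card ≤ _ by omega)
        have hT : Disjoint T U := Finset.disjoint_left.2 fun x hx =>
          (Finset.mem_sdiff.1 (hTU hx)).2
        have h1 := hcount T hST hT
        have h2 := hG.upper_small T U hT hTc.ge
        rw [hTc] at h2
        have h3 := hsmall U.card (not_le.1 hbig)
        have h16 : (U.card : ℝ) ≤ 16 * S.card := by exact_mod_cast hc1.le
        set X := (1 + ε) * p * (U.card.choose (r - 1) : ℝ) + Real.log (Fintype.card V) ^ (1 + ε)
        have hX : 0 ≤ X := by positivity
        have h4 : (U.card : ℝ) * X ≤ 16 * S.card * X := mul_le_mul_of_nonneg_right h16 hX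
        have h5 : D * S.card ≤ U.card * X := by
          refine h1.trans (h2.trans (le_of_eq ?_))
          simp only [X]; ring
        nlinarith

end UniformHypergraph

/-! ### The bounded differences inequality. -/

section BoundedDifferences

/-- By convexity, the exponential lies below its chord over `[-d, d]`. -/
lemma exp_le_cosh_add {d x : ℝ} (hd : 0 < d) (h : |x| ≤ d) :
    Real.exp x ≤ Real.cosh d + x * (Real.sinh d / d) := by
  obtain ⟨h1, h2⟩ := abs_le.1 h
  have hc := convexOn_exp.2 (Set.mem_univ d) (Set.mem_univ (-d))
    (show 0 ≤ (d + x) / (2 * d) by apply div_nonneg <;> linarith)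
    (show 0 ≤ (d - x) / (2 * d) by apply div_nonneg <;> linarith) (by field_simp; ring)
  have e : ((d + x) / (2 * d)) • d + ((d - x) / (2 * d)) • (-d) = x := by
    simp only [smul_eq_mul]; field_simp; ring
  rw [e] at hc
  refine hc.trans (le_of_eq ?_)
  rw [Real.cosh_eq, Real.sinh_eq]
  simp only [smul_eq_mul]
  field_simp
  ring

lemma sum_exp_le_of_sum_eq_zero {C : Type*} [Fintype C] {g : C → ℝ} {d : ℝ} (hd : 0 ≤ d)
    (hg : ∀ a, |g a| ≤ d) (hsum : ∑ a, g a = 0) :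
    ∑ a, Real.exp (g a) ≤ Fintype.card C * Real.exp (d ^ 2 / 2) := by
  rcases hd.eq_or_lt with rfl | hd
  · have : ∀ a, g a = 0 := fun a => abs_nonpos_iff.1 (hg a)
    simp [this]
  · calc ∑ a, Real.exp (g a) ≤ ∑ a, (Real.cosh d + g a * (Real.sinh d / d)) :=
        Finset.sum_le_sum fun a _ => exp_le_cosh_add hd (hg a)
      _ = Fintype.card C * Real.cosh d := by
        rw [Finset.sum_add_distrib, ← Finset.sum_mul, hsum]
        simp
      _ ≤ _ := mul_le_mul_of_nonneg_left (Real.cosh_le_exp_half_sq d) (Nat.cast_nonneg _)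

/-- Induction on the number of coordinates. The means `μ a` conditional on the first coordinate
average to `M` and differ pairwise by at most `d 0`, so they contribute `exp (d 0 ^ 2 / 2)`; the
fluctuation around `μ a` is covered by the induction hypothesis. -/
lemma sum_exp_sub_mean_le_fin {C : Type*} [Fintype C] [Nonempty C] :
    ∀ (n : ℕ) (f : (Fin n → C) → ℝ) (d : Fin n → ℝ),
      (∀ x i a, |f (Function.update x i a) - f x| ≤ d i) →
      ∑ x, Real.exp (f x - (∑ y, f y) / (Fintype.card C : ℝ) ^ n) ≤
        (Fintype.card C : ℝ) ^ n * Real.exp ((∑ i, d i ^ 2) / 2) := by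
  intro n
  have hC : (0 : ℝ) < Fintype.card C := by exact_mod_cast Fintype.card_pos
  induction n with
  | zero => intro f d _; simp
  | succ n ih =>
    intro f d hf
    have hsplit : ∀ F : (Fin (n + 1) → C) → ℝ, ∑ x, F x = ∑ a, ∑ x : Fin n → C, F (Fin.cons a x) := by
      intro F
      rw [← (Fin.consEquiv fun _ => C).sum_comp, Fintype.sum_prod_type]
      rfl
    set N : ℝ := (Fintype.card C : ℝ) ^ n with hN
    have hNpos : 0 < N := by positivity
    set μ : C → ℝ := fun a => (∑ x : Fin n → C, f (Fin.cons a x)) / N with hμ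
    set M : ℝ := (∑ y, f y) / (Fintype.card C : ℝ) ^ (n + 1) with hM
    have hMμ : M * Fintype.card C = ∑ a, μ a := by
      rw [hM, hμ, ← Finset.sum_div, hsplit f, pow_succ]
      field_simp
      rw [hN]
    have hd0 : 0 ≤ d 0 := (abs_nonneg _).trans
      (hf (fun _ => Classical.arbitrary C) 0 (Classical.arbitrary C))
    have hμdiff : ∀ a b, |μ a - μ b| ≤ d 0 := by
      intro a b
      have : μ a - μ b = (∑ x : Fin n → C, (f (Fin.cons a x) - f (Fin.cons b x))) / N := by
        rw [hμ, Finset.sum_sub_distrib, sub_div]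
      rw [this, abs_div, abs_of_pos hNpos, div_le_iff₀ hNpos]
      refine (Finset.abs_sum_le_sum_abs _ _).trans ?_
      calc ∑ x : Fin n → C, |f (Fin.cons a x) - f (Fin.cons b x)| ≤ ∑ _x : Fin n → C, d 0 := by
            refine Finset.sum_le_sum fun x _ => ?_
            have := hf (Fin.cons b x) 0 a
            rwa [Fin.update_cons_zero] at this
        _ = d 0 * N := by
            rw [Finset.sum_const, Finset.card_univ, nsmul_eq_mul, Fintype.card_fun,
              Fintype.card_fin, hN]
            push_cast; ring
    have hg : ∀ a, |μ a - M| ≤ d 0 := by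
      intro a
      have : μ a - M = (∑ b, (μ a - μ b)) / Fintype.card C := by
        rw [Finset.sum_sub_distrib, ← hMμ, Finset.sum_const, Finset.card_univ, nsmul_eq_mul]
        field_simp
      rw [this, abs_div, abs_of_pos hC, div_le_iff₀ hC]
      refine (Finset.abs_sum_le_sum_abs _ _).trans ?_
      calc ∑ b, |μ a - μ b| ≤ ∑ _b : C, d 0 := Finset.sum_le_sum fun b _ => hμdiff a b
        _ = d 0 * Fintype.card C := by
            rw [Finset.sum_const, Finset.card_univ, nsmul_eq_mul]; ring
    have hg0 : ∑ a, (μ a - M) = 0 := by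
      rw [Finset.sum_sub_distrib, ← hMμ, Finset.sum_const, Finset.card_univ, nsmul_eq_mul]
      ring
    have hmean := sum_exp_le_of_sum_eq_zero hd0 hg hg0
    have hin : ∀ a, ∑ x : Fin n → C, Real.exp (f (Fin.cons a x) - M) ≤
        Real.exp (μ a - M) * (N * Real.exp ((∑ i : Fin n, d i.succ ^ 2) / 2)) := by
      intro a
      have h1 := ih (fun x => f (Fin.cons a x)) (fun i => d i.succ) (by
        intro x i b
        have := hf (Fin.cons a x) i.succ b
        rwa [← Fin.cons_update] at this)
      refine le_trans (le_of_eq ?_) (mul_le_mul_of_nonneg_left h1 (Real.exp_nonneg _))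
      rw [Finset.mul_sum]
      refine Finset.sum_congr rfl fun x _ => ?_
      rw [← Real.exp_add]
      congr 1
      simp only [hμ, hN]
      ring
    rw [hsplit]
    calc ∑ a, ∑ x : Fin n → C, Real.exp (f (Fin.cons a x) - M)
        ≤ ∑ a, Real.exp (μ a - M) * (N * Real.exp ((∑ i : Fin n, d i.succ ^ 2) / 2)) :=
          Finset.sum_le_sum fun a _ => hin a
      _ = (∑ a, Real.exp (μ a - M)) * (N * Real.exp ((∑ i : Fin n, d i.succ ^ 2) / 2)) := by
          rw [Finset.sum_mul]
      _ ≤ (Fintype.card C * Real.exp (d 0 ^ 2 / 2)) *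
            (N * Real.exp ((∑ i : Fin n, d i.succ ^ 2) / 2)) :=
          mul_le_mul_of_nonneg_right hmean (by positivity)
      _ = _ := by
          rw [Fin.sum_univ_succ, add_div, Real.exp_add, pow_succ, hN]
          ring

lemma sum_exp_sub_mean_le {ι C : Type*} [Fintype ι] [DecidableEq ι] [Fintype C] [Nonempty C]
    (f : (ι → C) → ℝ) (d : ι → ℝ) (hf : ∀ x i a, |f (Function.update x i a) - f x| ≤ d i) :
    ∑ x, Real.exp (f x - (∑ y, f y) / (Fintype.card C : ℝ) ^ Fintype.card ι) ≤
      (Fintype.card C : ℝ) ^ Fintype.card ι * Real.exp ((∑ i, d i ^ 2) / 2) := by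
  set e := Fintype.equivFin ι with he
  set Φ : (Fin (Fintype.card ι) → C) ≃ (ι → C) := Equiv.arrowCongr e.symm (Equiv.refl C) with hΦ
  have hΦapp : ∀ x i, Φ x i = x (e i) := fun x i => rfl
  have h := sum_exp_sub_mean_le_fin (Fintype.card ι) (fun x => f (Φ x)) (fun i => d (e.symm i)) (by
    intro x i a
    have := hf (Φ x) (e.symm i) a
    have e1 : Function.update (Φ x) (e.symm i) a = Φ (Function.update x i a) := by
      ext j
      rw [hΦapp]
      by_cases hj : j = e.symm i
      · subst hj; simp
      · have : e j ≠ i := fun h => hj (by rw [← h, Equiv.symm_apply_apply])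
        rw [Function.update_of_ne hj, Function.update_of_ne this, hΦapp]
    rwa [e1] at this)
  rw [Φ.sum_comp f] at h
  rw [Φ.sum_comp (fun x => Real.exp (f x - (∑ y, f y) / (Fintype.card C : ℝ) ^ Fintype.card ι)),
    e.symm.sum_comp (fun i => d i ^ 2)] at h
  exact h

/-- **McDiarmid's inequality** (lower tail, uniform measure, with a non-optimal constant). -/
lemma card_le_mean_sub_le {ι C : Type*} [Fintype ι] [DecidableEq ι] [Fintype C] [Nonempty C]
    (f : (ι → C) → ℝ) (d : ι → ℝ) (hf : ∀ x i a, |f (Function.update x i a) - f x| ≤ d i)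
    {s t : ℝ} (hs : 0 < s) (hd : ∑ i, d i ^ 2 ≤ s) (ht : 0 ≤ t) :
    ((Finset.univ.filter fun x => f x ≤ (∑ y, f y) / (Fintype.card C : ℝ) ^ Fintype.card ι - t).card
      : ℝ) ≤ (Fintype.card C : ℝ) ^ Fintype.card ι * Real.exp (-(t ^ 2 / (2 * s))) := by
  set N : ℝ := (Fintype.card C : ℝ) ^ Fintype.card ι with hN
  set μ := (∑ y, f y) / N with hμ
  -- This choice minimises the exponent `lam ^ 2 * s / 2 - lam * t` of the Chernoff bound.
  set lam := t / s with hlam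
  have hlam0 : 0 ≤ lam := div_nonneg ht hs.le
  have h := sum_exp_sub_mean_le (fun x => -lam * f x) (fun i => lam * d i) (by
    intro x i a
    have : -lam * f (Function.update x i a) - -lam * f x =
        -(lam * (f (Function.update x i a) - f x)) := by ring
    rw [this, abs_neg, abs_mul, abs_of_nonneg hlam0]
    exact mul_le_mul_of_nonneg_left (hf x i a) hlam0)
  have e1 : (∑ i, (lam * d i) ^ 2) / 2 ≤ lam ^ 2 * s / 2 := by
    have : ∑ i, (lam * d i) ^ 2 = lam ^ 2 * ∑ i, d i ^ 2 := by
      rw [Finset.mul_sum]; exact Finset.sum_congr rfl fun i _ => by ring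
    rw [this]
    have := mul_le_mul_of_nonneg_left hd (sq_nonneg lam)
    linarith
  have h2 : ∑ x, Real.exp (-lam * (f x - μ)) ≤ N * Real.exp (lam ^ 2 * s / 2) := by
    refine le_trans (le_of_eq ?_) (h.trans (mul_le_mul_of_nonneg_left (Real.exp_le_exp.2 e1)
      (by positivity)))
    refine Finset.sum_congr rfl fun x _ => ?_
    congr 1
    rw [← Finset.mul_sum, hμ, hN]
    ring
  set S := Finset.univ.filter fun x => f x ≤ μ - t with hS
  have h3 : (S.card : ℝ) * Real.exp (lam * t) ≤ ∑ x, Real.exp (-lam * (f x - μ)) := by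
    calc (S.card : ℝ) * Real.exp (lam * t) = ∑ _x ∈ S, Real.exp (lam * t) := by
          rw [Finset.sum_const, nsmul_eq_mul]
      _ ≤ ∑ x ∈ S, Real.exp (-lam * (f x - μ)) := by
          refine Finset.sum_le_sum fun x hx => Real.exp_le_exp.2 ?_
          have := (Finset.mem_filter.1 hx).2
          nlinarith
      _ ≤ _ := Finset.sum_le_univ_sum_of_nonneg fun x => Real.exp_nonneg _
  have h4 : (S.card : ℝ) * Real.exp (lam * t) ≤ N * Real.exp (lam ^ 2 * s / 2) := h3.trans h2
  have e2 : Real.exp (-(t ^ 2 / (2 * s))) = Real.exp (lam ^ 2 * s / 2) / Real.exp (lam * t) := by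
    rw [← Real.exp_sub]
    congr 1
    rw [hlam]
    field_simp
    ring
  rw [e2, ← mul_div_assoc, le_div_iff₀ (Real.exp_pos _)]
  exact h4

end BoundedDifferences

/-! ### Degrees into the classes of a random colouring. -/

section RandomColouring

lemma card_filter_forall_eq {V C : Type*} [Fintype V] [DecidableEq V] [Fintype C] [DecidableEq C]
    (A : Finset V) (j : C) :
    (Finset.univ.filter fun x : V → C => ∀ z ∈ A, x z = j).card =
      Fintype.card C ^ (Fintype.card V - A.card) := by
  have : (Finset.univ.filter fun x : V → C => ∀ z ∈ A, x z = j) =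
      Fintype.piFinset fun z => if z ∈ A then {j} else Finset.univ := by
    ext x
    simp only [Finset.mem_filter, Finset.mem_univ, true_and, Fintype.mem_piFinset]
    refine forall_congr' fun z => ?_
    by_cases hz : z ∈ A <;> simp [hz]
  rw [this, Fintype.card_piFinset]
  have h2 : ∀ z, (if z ∈ A then ({j} : Finset C) else Finset.univ).card =
      if z ∈ A then 1 else Fintype.card C := by
    intro z; split_ifs <;> simp
  simp only [h2]
  rw [Finset.prod_ite, Finset.prod_const_one, Finset.prod_const, one_mul]
  congr 1
  have h3 : (Finset.univ.filter fun z => z ∉ A) = Finset.univ \ A := by ext; simp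
  rw [h3, Finset.card_sdiff_of_subset (Finset.subset_univ A), Finset.card_univ]

namespace UniformHypergraph

variable {V : Type*} [Fintype V] [DecidableEq V] {r : ℕ}

/-- A hyperedge at `v` is counted when its other `r - 1` vertices have the colour `j`; the colour of
`v` itself is free. -/
lemma sum_card_colourLink {C : Type*} [Fintype C] [DecidableEq C] (H : UniformHypergraph V r)
    (v : V) (j : C) :
    ∑ x : V → C, (H.colourLink x v j).card =
      H.degree v * Fintype.card C ^ (Fintype.card V - (r - 1)) := by
  have h1 : ∀ x : V → C, (H.colourLink x v j).card =
      ∑ e ∈ H.edges.filter (fun e => v ∈ e), if ∀ z ∈ e.erase v, x z = j then 1 else 0 := by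
    intro x
    rw [← Finset.card_filter]
    congr 1
    ext e
    simp only [mem_colourLink, Finset.mem_filter, Finset.mem_erase]
    constructor
    · rintro ⟨h1, h2, h3⟩
      exact ⟨⟨h1, h2⟩, fun z hz => h3 z hz.2 hz.1⟩
    · rintro ⟨⟨h1, h2⟩, h3⟩
      exact ⟨h1, h2, fun z hz hzv => h3 z ⟨hzv, hz⟩⟩
  simp only [h1]
  rw [Finset.sum_comm]
  have h2 : ∀ e ∈ H.edges.filter (fun e => v ∈ e),
      (∑ x : V → C, if ∀ z ∈ e.erase v, x z = j then 1 else 0) =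
        Fintype.card C ^ (Fintype.card V - (r - 1)) := by
    intro e he
    obtain ⟨he, hv⟩ := Finset.mem_filter.1 he
    rw [← Finset.card_filter, card_filter_forall_eq, Finset.card_erase_of_mem hv, H.sized he]
  rw [Finset.sum_congr rfl h2, Finset.sum_const, smul_eq_mul, degree]

/-- The number of hyperedges containing both `v` and `w`. -/
def codegree (H : UniformHypergraph V r) (v w : V) : ℕ :=
  (H.edges.filter fun e => v ∈ e ∧ w ∈ e).card

lemma sum_codegree (H : UniformHypergraph V r) (v : V) :
    ∑ w ∈ Finset.univ.erase v, H.codegree v w = H.degree v * (r - 1) := by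
  have h1 : ∀ w, H.codegree v w =
      ∑ e ∈ H.edges.filter (fun e => v ∈ e), if w ∈ e then 1 else 0 := by
    intro w
    rw [codegree, ← Finset.card_filter, Finset.filter_filter]
  simp only [h1]
  rw [Finset.sum_comm, degree, ← smul_eq_mul, ← Finset.sum_const]
  refine Finset.sum_congr rfl fun e he => ?_
  obtain ⟨he, hv⟩ := Finset.mem_filter.1 he
  rw [← Finset.card_filter]
  have : (Finset.univ.erase v).filter (fun w => w ∈ e) = e.erase v := by
    ext w; simp
  rw [this, Finset.card_erase_of_mem hv, H.sized he]

lemma card_colourLink_update_le {C : Type*} [DecidableEq C] (H : UniformHypergraph V r)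
    (x : V → C) (v w : V) (j a : C) :
    (H.colourLink (Function.update x w a) v j).card ≤ (H.colourLink x v j).card +
      if w = v then 0 else H.codegree v w := by
  have hsub : H.colourLink (Function.update x w a) v j ⊆ H.colourLink x v j ∪
      (if w = v then ∅ else H.edges.filter fun e => v ∈ e ∧ w ∈ e) := by
    intro e he
    obtain ⟨h1, h2, h3⟩ := mem_colourLink.1 he
    by_cases hwe : w ∈ e ∧ w ≠ v
    · rw [if_neg hwe.2]
      exact Finset.mem_union_right _ (Finset.mem_filter.2 ⟨h1, h2, hwe.1⟩)
    · refine Finset.mem_union_left _ (mem_colourLink.2 ⟨h1, h2, fun z hz hzv => ?_⟩)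
      have hzw : z ≠ w := by rintro rfl; exact hwe ⟨hz, hzv⟩
      have := h3 z hz hzv
      rwa [Function.update_of_ne hzw] at this
  refine (Finset.card_le_card hsub).trans ((Finset.card_union_le _ _).trans (le_of_eq ?_))
  split_ifs <;> rfl

lemma abs_card_colourLink_update_sub_le {C : Type*} [DecidableEq C] (H : UniformHypergraph V r)
    (x : V → C) (v w : V) (j a : C) :
    |((H.colourLink (Function.update x w a) v j).card : ℝ) - (H.colourLink x v j).card| ≤
      if w = v then 0 else (H.codegree v w : ℝ) := by
  have h1 := H.card_colourLink_update_le x v w j a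
  have h2 := H.card_colourLink_update_le (Function.update x w a) v w j (x w)
  -- Undoing the recolouring is again a recolouring, which gives the reverse inequality.
  rw [Function.update_idem, Function.update_eq_self] at h2
  have h1' : ((H.colourLink (Function.update x w a) v j).card : ℝ) ≤ (H.colourLink x v j).card +
      if w = v then 0 else (H.codegree v w : ℝ) := by
    split_ifs with hw
    · rw [if_pos hw] at h1; exact_mod_cast h1
    · rw [if_neg hw] at h1; exact_mod_cast h1
  have h2' : ((H.colourLink x v j).card : ℝ) ≤ (H.colourLink (Function.update x w a) v j).card +
      if w = v then 0 else (H.codegree v w : ℝ) := by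
    split_ifs with hw
    · rw [if_pos hw] at h2; exact_mod_cast h2
    · rw [if_neg hw] at h2; exact_mod_cast h2
  rw [abs_le]
  constructor <;> linarith

/-- Recolouring `w` changes the count by at most the codegree of `v` and `w`. The squared codegrees
sum to at most `Δ` times the sum of the codegrees, that is to `(r - 1) * Δ` times the degree. So the
bound on codegrees makes the variance proxy linear in the degree. -/
lemma card_small_colourLink_le {C : Type*} [Fintype C] [Nonempty C] [DecidableEq C]
    (H : UniformHypergraph V r) (hr : 2 ≤ r) {Δ α L : ℝ} (hΔ : 0 < Δ) (hα : 0 ≤ α)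
    (hcod : ∀ v w, v ≠ w → (H.codegree v w : ℝ) ≤ Δ) (v : V) (j : C) (hdeg : 0 < H.degree v)
    (hL : L ≤ α ^ 2 * H.degree v / (2 * ((r - 1 : ℕ) * Δ) * (Fintype.card C : ℝ) ^ (2 * (r - 1)))) :
    ((Finset.univ.filter fun x : V → C => ((H.colourLink x v j).card : ℝ) ≤
      (1 - α) * H.degree v / (Fintype.card C : ℝ) ^ (r - 1)).card : ℝ) ≤
      (Fintype.card C : ℝ) ^ Fintype.card V * Real.exp (-L) := by
  set M : ℝ := (Fintype.card C : ℝ) with hM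
  have hMpos : 0 < M := by rw [hM]; exact_mod_cast Fintype.card_pos
  have hdegpos : (0 : ℝ) < H.degree v := by exact_mod_cast hdeg
  have hrpos : (0 : ℝ) < ((r - 1 : ℕ) : ℝ) := by
    have : 0 < r - 1 := by omega
    exact_mod_cast this
  have hrn : r - 1 ≤ Fintype.card V := by
    obtain ⟨e, he⟩ := Finset.card_pos.1 hdeg
    have h1 := H.sized (Finset.mem_filter.1 he).1
    have h2 := Finset.card_le_univ e
    omega
  have hmean : (∑ x : V → C, ((H.colourLink x v j).card : ℝ)) / M ^ Fintype.card V =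
      H.degree v / M ^ (r - 1) := by
    have h1 : (∑ x : V → C, ((H.colourLink x v j).card : ℝ)) =
        H.degree v * M ^ (Fintype.card V - (r - 1)) := by
      rw [hM]; exact_mod_cast H.sum_card_colourLink v j
    rw [h1, div_eq_div_iff (by positivity) (by positivity), mul_assoc, ← pow_add]
    congr 2
    omega
  have hs : ∑ w, (if w = v then 0 else (H.codegree v w : ℝ)) ^ 2 ≤
      (r - 1 : ℕ) * Δ * H.degree v := by
    rw [← Finset.add_sum_erase _ _ (Finset.mem_univ v)]
    have h1 : ∑ w ∈ Finset.univ.erase v, (if w = v then 0 else (H.codegree v w : ℝ)) ^ 2 ≤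
        ∑ w ∈ Finset.univ.erase v, Δ * (H.codegree v w : ℝ) := by
      refine Finset.sum_le_sum fun w hw => ?_
      have hwv := Finset.ne_of_mem_erase hw
      rw [if_neg hwv, sq]
      exact mul_le_mul_of_nonneg_right (hcod v w hwv.symm) (Nat.cast_nonneg _)
    have h2 : ∑ w ∈ Finset.univ.erase v, (H.codegree v w : ℝ) = H.degree v * (r - 1 : ℕ) := by
      exact_mod_cast H.sum_codegree v
    rw [← Finset.mul_sum, h2] at h1
    simp only [if_true]
    linarith
  have h := card_le_mean_sub_le (fun x : V → C => ((H.colourLink x v j).card : ℝ))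
    (fun w => if w = v then 0 else (H.codegree v w : ℝ))
    (fun x w a => H.abs_card_colourLink_update_sub_le x v w j a)
    (s := (r - 1 : ℕ) * Δ * H.degree v) (t := α * H.degree v / M ^ (r - 1)) (by positivity) hs
    (by positivity)
  rw [hmean] at h
  have e1 : (H.degree v : ℝ) / M ^ (r - 1) - α * H.degree v / M ^ (r - 1) =
      (1 - α) * H.degree v / M ^ (r - 1) := by ring
  rw [e1] at h
  refine h.trans (mul_le_mul_of_nonneg_left (Real.exp_le_exp.2 (neg_le_neg ?_)) (by positivity))
  refine hL.trans (le_of_eq ?_)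
  rw [pow_mul']
  field_simp

end UniformHypergraph

/-! ### Sizes of the colour classes. -/

section ClassSizes

variable {V C : Type*} [Fintype V] [DecidableEq V] [Fintype C] [DecidableEq C]

lemma card_colourClass_eq_sum (x : V → C) (j : C) :
    (colourClass x j).card = ∑ v, if x v = j then 1 else 0 := by
  classical
  rw [← Finset.card_filter]
  congr 1
  ext v
  simp [mem_colourClass]

lemma sum_card_colourClass (j : C) :
    ∑ x : V → C, (colourClass x j).card =
      Fintype.card V * Fintype.card C ^ (Fintype.card V - 1) := by
  simp only [card_colourClass_eq_sum]
  rw [Finset.sum_comm]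
  have h2 : ∀ v : V, (∑ x : V → C, if x v = j then 1 else 0) =
      Fintype.card C ^ (Fintype.card V - 1) := by
    intro v
    rw [← Finset.card_filter]
    have := card_filter_forall_eq ({v} : Finset V) j
    simpa using this
  rw [Finset.sum_congr rfl fun v _ => h2 v]
  simp

lemma abs_card_colourClass_update_sub_le (x : V → C) (w : V) (j a : C) :
    |((colourClass (Function.update x w a) j).card : ℝ) - (colourClass x j).card| ≤ 1 := by
  have key : ∀ (x : V → C) (a : C), (colourClass (Function.update x w a) j).card ≤
      (colourClass x j).card + 1 := by
    intro x a
    have hsub : colourClass (Function.update x w a) j ⊆ colourClass x j ∪ {w} := by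
      intro z hz
      rw [mem_colourClass] at hz
      by_cases hzw : z = w
      · simp [hzw]
      · rw [Function.update_of_ne hzw] at hz
        exact Finset.mem_union_left _ (mem_colourClass.2 hz)
    exact (Finset.card_le_card hsub).trans ((Finset.card_union_le _ _).trans (by simp))
  have h1 := key x a
  have h2 := key (Function.update x w a) (x w)
  rw [Function.update_idem, Function.update_eq_self] at h2
  have h1' : ((colourClass (Function.update x w a) j).card : ℝ) ≤ (colourClass x j).card + 1 := by
    exact_mod_cast h1
  have h2' : ((colourClass x j).card : ℝ) ≤ (colourClass (Function.update x w a) j).card + 1 := by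
    exact_mod_cast h2
  rw [abs_le]
  constructor <;> linarith

lemma card_unbalanced_le [Nonempty C] {η L : ℝ} (hη : 0 ≤ η) (hV : 0 < Fintype.card V) (j : C)
    (hL : L ≤ η ^ 2 * Fintype.card V / (2 * (Fintype.card C : ℝ) ^ 2)) :
    ((Finset.univ.filter fun x : V → C => ((colourClass x j).card : ℝ) ≤
      (1 - η) * Fintype.card V / Fintype.card C).card : ℝ) ≤
        (Fintype.card C : ℝ) ^ Fintype.card V * Real.exp (-L) ∧
    ((Finset.univ.filter fun x : V → C => (1 + η) * Fintype.card V / Fintype.card C ≤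
      ((colourClass x j).card : ℝ)).card : ℝ) ≤
        (Fintype.card C : ℝ) ^ Fintype.card V * Real.exp (-L) := by
  set M : ℝ := (Fintype.card C : ℝ) with hM
  have hMpos : 0 < M := by rw [hM]; exact_mod_cast Fintype.card_pos
  set n : ℝ := (Fintype.card V : ℝ) with hn
  have hnpos : 0 < n := by rw [hn]; exact_mod_cast hV
  have hmean : (∑ x : V → C, ((colourClass x j).card : ℝ)) / M ^ Fintype.card V = n / M := by
    have h1 : (∑ x : V → C, ((colourClass x j).card : ℝ)) = n * M ^ (Fintype.card V - 1) := by
      rw [hM, hn]; exact_mod_cast sum_card_colourClass j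
    rw [h1, div_eq_div_iff (by positivity) (by positivity), mul_assoc, ← pow_succ]
    congr 2
    omega
  have hs : ∑ _w : V, (1 : ℝ) ^ 2 ≤ n := by simp [hn]
  have hexp : Real.exp (-((η * n / M) ^ 2 / (2 * n))) ≤ Real.exp (-L) := by
    refine Real.exp_le_exp.2 (neg_le_neg (hL.trans (le_of_eq ?_)))
    field_simp
  constructor
  · have h := card_le_mean_sub_le (fun x : V → C => ((colourClass x j).card : ℝ)) (fun _ => 1)
      (fun x w a => abs_card_colourClass_update_sub_le x w j a) (s := n) (t := η * n / M) hnpos hs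
      (by positivity)
    rw [hmean, show n / M - η * n / M = (1 - η) * n / M by ring] at h
    exact h.trans (mul_le_mul_of_nonneg_left hexp (by positivity))
  -- The upper tail is the lower tail of the negated class size.
  · have h := card_le_mean_sub_le (fun x : V → C => -((colourClass x j).card : ℝ)) (fun _ => 1)
      (fun x w a => by
        have := abs_card_colourClass_update_sub_le x w j a
        rw [show -((colourClass (Function.update x w a) j).card : ℝ) - -((colourClass x j).card : ℝ)
          = -(((colourClass (Function.update x w a) j).card : ℝ) - (colourClass x j).card) by ring,
          abs_neg]
        exact this) (s := n) (t := η * n / M) hnpos hs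
      (by positivity)
    rw [Finset.sum_neg_distrib, neg_div, hmean] at h
    refine le_trans (le_of_eq ?_) (h.trans (mul_le_mul_of_nonneg_left hexp (by positivity)))
    congr 2
    ext x
    simp only [Finset.mem_filter, Finset.mem_univ, true_and]
    rw [show -(n / M) - η * n / M = -((1 + η) * n / M) by ring, neg_le_neg_iff]

end ClassSizes

/-- A random colouring is balanced, and splits the hyperedges at every vertex evenly. -/
lemma UniformHypergraph.exists_balanced_colouring {V : Type*} [Fintype V] [DecidableEq V] {r : ℕ}
    (H : UniformHypergraph V r) (hr : 2 ≤ r) {Δ α η : ℝ} (hΔ : 0 < Δ) (hα : 0 ≤ α) (hη : 0 ≤ η)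
    (hcod : ∀ v w, v ≠ w → (H.codegree v w : ℝ) ≤ Δ) (hdeg : ∀ v, 0 < H.degree v)
    {M : ℕ} (hM : 0 < M) (hV : 3 ≤ Fintype.card V) (hMV : M ≤ Fintype.card V)
    (h1 : ∀ v, 3 * Real.log (Fintype.card V) ≤
      α ^ 2 * H.degree v / (2 * ((r - 1 : ℕ) * Δ) * (M : ℝ) ^ (2 * (r - 1))))
    (h2 : 3 * Real.log (Fintype.card V) ≤ η ^ 2 * Fintype.card V / (2 * (M : ℝ) ^ 2)) :
    ∃ c : V → Fin M,
      (∀ v j, (1 - α) * H.degree v / (M : ℝ) ^ (r - 1) ≤ (H.colourLink c v j).card) ∧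
      ∀ j, (1 - η) * Fintype.card V / M ≤ (colourClass c j).card ∧
        ((colourClass c j).card : ℝ) ≤ (1 + η) * Fintype.card V / M := by
  have : Nonempty (Fin M) := ⟨⟨0, hM⟩⟩
  set n := Fintype.card V with hn
  have hnpos : (0 : ℝ) < n := by exact_mod_cast (by omega : 0 < n)
  by_contra! hcon
  set A : V × Fin M → Finset (V → Fin M) := fun q => Finset.univ.filter fun x =>
    ((H.colourLink x q.1 q.2).card : ℝ) ≤ (1 - α) * H.degree q.1 / (M : ℝ) ^ (r - 1) with hA
  set B : Fin M → Finset (V → Fin M) := fun j => Finset.univ.filter fun x =>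
    ((colourClass x j).card : ℝ) ≤ (1 - η) * n / M with hB
  set D : Fin M → Finset (V → Fin M) := fun j => Finset.univ.filter fun x =>
    (1 + η) * n / M ≤ ((colourClass x j).card : ℝ) with hD
  set N : ℝ := (M : ℝ) ^ n with hN
  have hNpos : 0 < N := by positivity
  set X : ℝ := N * Real.exp (-(3 * Real.log n)) with hX
  have hAc : ∀ q, ((A q).card : ℝ) ≤ X := fun q => by
    have := H.card_small_colourLink_le (C := Fin M) hr hΔ hα hcod q.1 q.2 (hdeg q.1)
      (L := 3 * Real.log n) (by simpa using h1 q.1)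
    simpa [hA, hX, hN] using this
  have hBD : ∀ j, ((B j).card : ℝ) ≤ X ∧ ((D j).card : ℝ) ≤ X := fun j => by
    have := card_unbalanced_le (V := V) (C := Fin M) hη (by omega) j (L := 3 * Real.log n)
      (by simpa using h2)
    simpa [hB, hD, hX, hN] using this
  have hcover : (Finset.univ : Finset (V → Fin M)) ⊆
      Finset.univ.biUnion A ∪ (Finset.univ.biUnion B ∪ Finset.univ.biUnion D) := by
    intro x _
    by_contra hx
    simp only [Finset.mem_union, Finset.mem_biUnion, Finset.mem_univ, true_and, not_or, not_exists,
      hA, hB, hD, Finset.mem_filter, not_le] at hx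
    obtain ⟨ha, hb, hd⟩ := hx
    obtain ⟨j, hj⟩ := hcon x fun v j => (ha (v, j)).le
    exact absurd (hj (hb j).le) (not_lt.2 (hd j).le)
  have hcard := (Finset.card_le_card hcover).trans (Finset.card_union_le _ _)
  have hcard2 := hcard.trans (Nat.add_le_add_left (Finset.card_union_le _ _) _)
  have hcard3 : (Fintype.card (V → Fin M) : ℝ) ≤ ∑ q, ((A q).card : ℝ) +
      (∑ j, ((B j).card : ℝ) + ∑ j, ((D j).card : ℝ)) := by
    have h3 := hcard2.trans (Nat.add_le_add Finset.card_biUnion_le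
      (Nat.add_le_add Finset.card_biUnion_le Finset.card_biUnion_le))
    rw [Finset.card_univ] at h3
    exact_mod_cast h3
  have hA' : ∑ q, ((A q).card : ℝ) ≤ n * M * X := by
    refine (Finset.sum_le_sum fun q _ => hAc q).trans (le_of_eq ?_)
    simp [hn]
  have hB' : ∑ j, ((B j).card : ℝ) ≤ M * X := by
    refine (Finset.sum_le_sum fun q _ => (hBD q).1).trans (le_of_eq ?_)
    simp
  have hD' : ∑ j, ((D j).card : ℝ) ≤ M * X := by
    refine (Finset.sum_le_sum fun q _ => (hBD q).2).trans (le_of_eq ?_)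
    simp
  have hcN : (Fintype.card (V → Fin M) : ℝ) = N := by
    rw [Fintype.card_fun, Fintype.card_fin, hN]; push_cast; rfl
  have hexp : Real.exp (-(3 * Real.log n)) = 1 / (n : ℝ) ^ 3 := by
    rw [Real.exp_neg, show (3 : ℝ) * Real.log n = ((3 : ℕ) : ℝ) * Real.log n by norm_num,
      Real.exp_nat_mul, Real.exp_log hnpos, one_div]
  rw [hcN] at hcard3
  have hMn : (M : ℝ) ≤ n := by exact_mod_cast hMV
  have hn3 : (3 : ℝ) ≤ n := by exact_mod_cast hV
  have hXpos : 0 < X := by positivity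
  have hfin : N ≤ (n * M + 2 * M) * X := by linarith
  have hXn : X * (n : ℝ) ^ 3 = N := by
    rw [hX, hexp]; field_simp
  -- Union bound: there are `n * M + 2 * M ≤ n ^ 2 + 2 * n` bad events, each of probability at most
  -- `n ^ (-3)`, too few to cover all colourings once `n ≥ 3`.
  have : (n : ℝ) ^ 3 ≤ n * M + 2 * M := by
    by_contra! hlt
    have := mul_lt_mul_of_pos_right hlt hXpos
    nlinarith
  have hMn' := mul_le_mul_of_nonneg_left hMn hnpos.le
  have hn2 := mul_le_mul_of_nonneg_right hn3 hnpos.le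
  have hn4 := mul_le_mul_of_nonneg_right hn3 (mul_nonneg hnpos.le hnpos.le)
  linarith [show (n : ℝ) ^ 3 = n * (n * n) by ring]

end RandomColouring

/-! ### Choice of the numerical parameters. -/

section Parameters

set_option maxHeartbeats 1000000 in
/-- The numerical parameters of the colouring: `M` colours, classes of size about `σ`, expansion
deficiency `β`, path length `h`, and batch size `B`. -/
lemma exists_parameters {n : ℕ} {L η : ℝ} (hL : L = Real.log n) (hη : 0 < η) (hη' : η ≤ 1 / 10)
    (hL4 : 4 ≤ L) (hLη : 1884 / η ^ 2 ≤ L) (hn : 6 / η ^ 2 * L ^ 17 ≤ n) :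
    ∃ M σ β h B : ℕ, 0 < M ∧ M ≤ n ∧ (M : ℝ) ≤ L ^ 8 ∧
      3 * L ≤ η ^ 2 * n / (2 * (M : ℝ) ^ 2) ∧
      (1 + η) * n / M ≤ σ ∧ (σ : ℝ) ≤ (1 + 3 * η) * n / M ∧ (σ : ℝ) ≤ 2 * ((1 - η) * n / M) ∧
      2 * σ ≤ n ∧ 2 ≤ σ ∧ β ≤ σ ∧ (β : ℝ) ≤ η * σ ∧ σ < 2 ^ (h + 1) ∧
      σ * (2 * h + 2) ≤ B * β ∧
      3 + (2 * (2 * h + 1) + (2 * h + 2) * (2 * h + 1)) ≤ n / σ ∧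
      n / σ + 6 + 4 * (B * (h + 1) * (2 * h + 2)) ≤ M := by
  have hL1 : 1 ≤ L := by linarith
  have hL0 : 0 < L := by linarith
  have hη2 : 0 < η ^ 2 := by positivity
  have hpow8 : ∀ k ≤ 17, L ^ k ≤ L ^ 17 := fun k hk => pow_le_pow_right₀ hL1 hk
  have hη2' : η ^ 2 ≤ η * (1 / 10) := by rw [sq]; exact mul_le_mul_of_nonneg_left hη' hη.le
  have hn' : 6 * L ^ 17 ≤ η ^ 2 * n := by
    rw [div_mul_eq_mul_div, div_le_iff₀ hη2] at hn; linarith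
  have hn0 : (0 : ℝ) ≤ n := Nat.cast_nonneg n
  have hL17 : 0 < L ^ 17 := by positivity
  have hnpos : (0 : ℝ) < n := by
    rcases hn0.eq_or_lt with h | h
    · rw [← h] at hn'; linarith
    · exact h
  have hηn : 60 * L ^ 17 ≤ η * n := by
    have := mul_le_mul_of_nonneg_right hη2' hn0
    linarith
  have hnL : 600 * L ^ 17 ≤ n := by
    have := mul_le_mul_of_nonneg_right hη' hn0
    linarith
  have h8 := hpow8 8 (by norm_num)
  have hL8 : (4 : ℝ) ^ 8 ≤ L ^ 8 := pow_le_pow_left₀ (by norm_num) hL4 8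
  -- The power `8` leaves ample room above the `O(L ^ 3)` colours and the `O(L ^ 2)` vertices per
  -- index spent on ladders, while `L * M ^ 2 ≤ L ^ 17` stays small against `n`.
  set M := ⌊L ^ 8⌋₊ with hM
  have hMle : (M : ℝ) ≤ L ^ 8 := Nat.floor_le (by positivity)
  have hMge : L ^ 8 / 2 ≤ M := by
    have := Nat.lt_floor_add_one (L ^ 8)
    rw [← hM] at this
    linarith
  have hM4 : (4 : ℝ) ≤ M := by linarith
  have hMpos : (0 : ℝ) < M := by linarith
  -- Exceeding the average class size by the factor `1 + 2 * η` bounds every class and forces `n / σ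
  -- ≤ (1 - η) * M`; at least `η * M` colours are then spare for the ladders and terminals.
  set σ := ⌈(1 + 2 * η) * n / M⌉₊ with hσ
  have hσge : (1 + 2 * η) * n / M ≤ σ := Nat.le_ceil _
  have hσle : (σ : ℝ) ≤ (1 + 3 * η) * n / M := by
    have h1 := Nat.ceil_lt_add_one (a := (1 + 2 * η) * n / M) (by positivity)
    have h2 : 1 ≤ η * n / M := by
      rw [le_div_iff₀ hMpos]; linarith
    have h3 : (1 + 3 * η) * n / M = (1 + 2 * η) * n / M + η * n / M := by ring
    rw [h3]; linarith
  have hnM : 0 < n / (M : ℝ) := by positivity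
  have hnM2 : 60 ≤ η * (n / M) := by
    rw [← mul_div_assoc, le_div_iff₀ hMpos]; linarith
  have e1 : ∀ a : ℝ, a * n / M = a * (n / M) := fun a => by ring
  rw [e1] at hσge hσle
  have hησ : 60 ≤ η * σ := by
    refine hnM2.trans (mul_le_mul_of_nonneg_left ?_ hη.le)
    refine le_trans ?_ hσge
    have := mul_pos hη hnM
    linarith
  have hσ0 : (0 : ℝ) ≤ σ := Nat.cast_nonneg _
  have hσ600 : 600 ≤ (σ : ℝ) := by
    have := mul_le_mul_of_nonneg_right hη' hσ0
    linarith
  have hσpos : (0 : ℝ) < σ := by linarith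
  have hη1 := mul_le_mul_of_nonneg_right hη' hnM.le
  have h2σ : 2 * (σ : ℝ) ≤ n := by
    have h1 : n / (M : ℝ) ≤ n / 4 := by gcongr
    linarith
  set β := ⌊η * σ⌋₊ with hβ
  have hβle : (β : ℝ) ≤ η * σ := Nat.floor_le (by positivity)
  have hβge : η * σ / 2 ≤ β := by
    have := Nat.lt_floor_add_one (η * σ)
    rw [← hβ] at this
    linarith
  -- With at most logarithmically many colours a walk that doubles in each step outgrows every
  -- class.
  set h := Nat.log 2 n with hh
  have hhL : (h : ℝ) ≤ 2 * L := by
    have h1 : (2 : ℕ) ^ h ≤ n := Nat.pow_log_le_self 2 (by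
      have : (0 : ℝ) < n := hnpos
      have := Nat.cast_pos.1 this
      omega)
    have h2 : (2 : ℝ) ^ h ≤ n := by exact_mod_cast h1
    have h3 := Real.log_le_log (by positivity) h2
    rw [Real.log_pow, ← hL] at h3
    have h4 : (1 : ℝ) / 2 ≤ Real.log 2 := by linarith [Real.log_two_gt_d9]
    have h5 := mul_le_mul_of_nonneg_left h4 (Nat.cast_nonneg (α := ℝ) h)
    linarith
  -- The largest linkage has `σ * (2 * h + 2)` pairs, and a batch holds `β ≥ η * σ / 2` of them.
  set B := ⌈2 / η * (2 * h + 2)⌉₊ with hB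
  have hBge : 2 / η * (2 * h + 2) ≤ B := Nat.le_ceil _
  have hh0 : (0 : ℝ) ≤ h := Nat.cast_nonneg _
  have hBle : (B : ℝ) ≤ 13 * L / η := by
    have h1 := Nat.ceil_lt_add_one (a := 2 / η * (2 * (h : ℝ) + 2)) (by positivity)
    have h2 : 2 / η * (2 * (h : ℝ) + 2) ≤ 2 / η * (6 * L) := by
      gcongr; linarith
    have h3 : 1 ≤ L / η := by
      rw [le_div_iff₀ hη]; linarith
    have h4 : 13 * L / η = 2 / η * (6 * L) + L / η := by ring
    rw [h4]; linarith
  have hdivle : ((n / σ : ℕ) : ℝ) ≤ (1 - η) * M := by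
    refine Nat.cast_div_le.trans ?_
    rw [div_le_iff₀ hσpos]
    have h1 : (1 - η) * M * ((1 + 2 * η) * (n / M)) ≤ (1 - η) * M * σ :=
      mul_le_mul_of_nonneg_left hσge (mul_nonneg (by linarith) hMpos.le)
    have h2 : (1 - η) * M * ((1 + 2 * η) * (n / M)) = (1 - η) * (1 + 2 * η) * n := by
      field_simp
    have h3 : (1 : ℝ) ≤ (1 - η) * (1 + 2 * η) := by nlinarith
    have h4 := mul_le_mul_of_nonneg_right h3 hn0
    linarith
  have hdivge : (M : ℝ) / 2 - 1 ≤ ((n / σ : ℕ) : ℝ) := by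
    have h1 : (n : ℝ) / σ < (n / σ : ℕ) + 1 := by
      rw [div_lt_iff₀ hσpos]
      have := Nat.lt_div_mul_add (a := n) (b := σ) (Nat.cast_pos.1 hσpos)
      have h2 : (n : ℝ) < (n / σ : ℕ) * σ + σ := by exact_mod_cast this
      linarith
    have h2 : (M : ℝ) / 2 ≤ n / σ := by
      rw [le_div_iff₀ hσpos]
      have h3 : (M : ℝ) / 2 * σ ≤ M / 2 * (2 * (n / M)) :=
        mul_le_mul_of_nonneg_left (by linarith) (by positivity)
      have h4 : (M : ℝ) / 2 * (2 * (n / M)) = n := by field_simp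
      linarith
    linarith
  refine ⟨M, σ, β, h, B, Nat.cast_pos.1 hMpos, ?_, hMle, ?_, ?_, ?_, ?_, ?_, ?_, ?_, hβle, ?_, ?_,
    ?_, ?_⟩
  · exact_mod_cast (show (M : ℝ) ≤ n by linarith)
  · rw [le_div_iff₀ (by positivity)]
    have h1 : (M : ℝ) ^ 2 ≤ (L ^ 8) ^ 2 := pow_le_pow_left₀ hMpos.le hMle 2
    have h2 := mul_le_mul_of_nonneg_left h1 hL0.le
    have h3 : L * (L ^ 8) ^ 2 = L ^ 17 := by ring
    linarith
  · rw [e1]; linarith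
  · rw [e1]; exact hσle
  · rw [e1]; linarith
  · exact_mod_cast h2σ
  · exact_mod_cast (show (2 : ℝ) ≤ σ by linarith)
  · have : (β : ℝ) ≤ σ := by
      have := mul_le_mul_of_nonneg_right hη' hσ0
      linarith
    exact_mod_cast this
  · refine lt_of_le_of_lt ?_ (Nat.lt_pow_succ_log_self (by norm_num) n)
    exact_mod_cast (show (σ : ℝ) ≤ n by linarith)
  · have h1 := mul_le_mul hBge hβge (by positivity) (by positivity)
    have h2 : 2 / η * (2 * (h : ℝ) + 2) * (η * σ / 2) = σ * (2 * h + 2) := by field_simp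
    rw [h2] at h1
    exact_mod_cast h1
  · have h1 : (3 : ℝ) + (2 * (2 * h + 1) + (2 * h + 2) * (2 * h + 1)) ≤ M / 2 - 1 := by
      have h2 : (2 * (h : ℝ) + 2) * (2 * h + 1) ≤ (6 * L) * (5 * L) := by
        gcongr <;> linarith
      have h3 : L ≤ L ^ 2 := by rw [sq]; exact le_mul_of_one_le_right hL0.le hL1
      have h4 : (4 : ℝ) ^ 6 * L ^ 2 ≤ L ^ 8 := by
        rw [show L ^ 8 = L ^ 6 * L ^ 2 by ring]
        exact mul_le_mul_of_nonneg_right (pow_le_pow_left₀ (by norm_num) hL4 6) (by positivity)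
      linarith
    exact_mod_cast h1.trans hdivge
  · have h1 : (B : ℝ) * (h + 1) * (2 * h + 2) ≤ 13 * L / η * (3 * L) * (6 * L) := by
      gcongr <;> linarith
    have h2 : 13 * L / η * (3 * L) * (6 * L) = 234 / η * L ^ 3 := by ring
    -- The demand `6 + 4 * B * (h + 1) * (2 * h + 2)` is at most `(6 + 4 * 13 * 3 * 6) * L ^ 3 / η`,
    -- which gives `942`; the spare colours supply the right side. Halving `L ^ 8` accounts for
    -- `1884 = 2 * 942`.
    have h3 : 942 / η * L ^ 3 ≤ η * (L ^ 8 / 2) := by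
      have h5 : 1884 ≤ L * η ^ 2 := by rwa [div_le_iff₀ hη2] at hLη
      have h6 : L * L ^ 3 ≤ L ^ 8 := by
        rw [← pow_succ']; exact pow_le_pow_right₀ hL1 (by norm_num)
      rw [div_mul_eq_mul_div, div_le_iff₀ hη]
      have h7 := mul_le_mul_of_nonneg_right h5 (show 0 ≤ L ^ 3 by positivity)
      have h8 := mul_le_mul_of_nonneg_right h6 hη2.le
      have h9 : η * (L ^ 8 / 2) * η = L ^ 8 * η ^ 2 / 2 := by ring
      have h10 : L * η ^ 2 * L ^ 3 = L * L ^ 3 * η ^ 2 := by ring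
      rw [h9]
      linarith
    have h4 : 6 ≤ 6 / η * L ^ 3 := by
      have h5 : (1 : ℝ) ≤ L ^ 3 := one_le_pow₀ hL1
      have h6 : 6 ≤ 6 / η := by rw [le_div_iff₀ hη]; linarith
      exact h6.trans (le_mul_of_one_le_right (by linarith) h5)
    have h5 := mul_le_mul_of_nonneg_left hMge hη.le
    have h6 : 942 / η * L ^ 3 = 6 / η * L ^ 3 + 4 * (234 / η * L ^ 3) := by ring
    have h7 : ((n / σ : ℕ) : ℝ) + 6 + 4 * (B * (h + 1) * (2 * h + 2)) ≤ M := by linarith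
    exact_mod_cast h7

end Parameters

/-! ### Asymptotic inequalities for large `n`. -/

section Estimates

variable {r n M : ℕ} {γ τ c L p : ℝ}

/-- At `τ = 0` the right side equals `γ`, and continuity does the rest. All later errors
(concentration, class sizes, `ε`) are paid from this one `τ`. -/
lemma exists_deficiency (r : ℕ) (hγ : 0 < γ) : ∃ τ : ℝ, 0 < τ ∧ τ ≤ 1 / 16 ∧
    γ / 2 ≤ (1 - τ) ^ 2 * (1 / 2 ^ (r - 1) + γ) - (1 + τ) * ((1 + τ) / 2) ^ (r - 1) := by
  have hcont : Continuous fun τ : ℝ =>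
      (1 - τ) ^ 2 * (1 / 2 ^ (r - 1) + γ) - (1 + τ) * ((1 + τ) / 2) ^ (r - 1) := by fun_prop
  have h0 := hcont.tendsto 0
  have h1 : γ / 2 < (1 - 0 : ℝ) ^ 2 * (1 / 2 ^ (r - 1) + γ) -
      (1 + 0) * ((1 + 0) / 2) ^ (r - 1) := by
    rw [add_zero, div_pow, one_pow]; linarith
  have h2 := (h0.eventually (lt_mem_nhds h1)).filter_mono
    (nhdsWithin_le_nhds (s := Set.Ioi (0 : ℝ)))
  have h3 : ∀ᶠ τ : ℝ in nhdsWithin 0 (Set.Ioi 0), τ ∈ Set.Ioo (0 : ℝ) (1 / 16) :=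
    Ioo_mem_nhdsGT (by norm_num)
  obtain ⟨τ, ha, hb⟩ := (h2.and h3).exists
  exact ⟨τ, hb.1, hb.2.le, ha.le⟩

lemma le_density_mul_choose (hn : 0 < n) (hc : 0 ≤ c) (hL : 0 ≤ L)
    (hp : p = L ^ (17 * r) / (n : ℝ) ^ (r - 1))
    (hch : (1 - τ) * ((n : ℝ) ^ (r - 1) / (r - 1).factorial) ≤ n.choose (r - 1)) :
    c * ((1 - τ) * (L ^ (17 * r) / (r - 1).factorial)) ≤ c * p * (n.choose (r - 1) : ℝ) := by
  have hn' : (0 : ℝ) < n := by exact_mod_cast hn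
  rw [mul_assoc]
  refine mul_le_mul_of_nonneg_left ?_ hc
  have hp0 : 0 ≤ p := by rw [hp]; positivity
  refine le_trans (le_of_eq ?_) (mul_le_mul_of_nonneg_left hch hp0)
  rw [hp]
  field_simp

lemma density_mul_choose_le (hp0 : 0 ≤ p) (u k : ℕ) :
    p * (u.choose k : ℝ) ≤ p * (u : ℝ) ^ k / k.factorial := by
  rw [mul_div_assoc]
  exact mul_le_mul_of_nonneg_left (Nat.choose_le_pow_div k u) hp0

lemma rpow_one_add_le_sq (hL : 1 ≤ L) (hτ : τ ≤ 1) : L ^ (1 + τ) ≤ L ^ 2 := by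
  rw [← Real.rpow_natCast]
  exact Real.rpow_le_rpow_of_exponent_le hL (by push_cast; linarith)

/-- Because of `3 + 8 * (r - 1) ≤ 17 * r`, a vertex keeps at least order `L ^ 3` hyperedges into
each class, enough to dominate the error term `L ^ (1 + τ) ≤ L ^ 2`. -/
lemma pow_le_pow_div_pow (hr : 1 ≤ r) (hL : 1 ≤ L) (hM : 0 < M) (hML : (M : ℝ) ≤ L ^ 8) :
    L ^ 3 ≤ L ^ (17 * r) / (M : ℝ) ^ (r - 1) := by
  have hM' : (0 : ℝ) < M := by exact_mod_cast hM
  rw [le_div_iff₀ (by positivity)]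
  calc L ^ 3 * (M : ℝ) ^ (r - 1) ≤ L ^ 3 * (L ^ 8) ^ (r - 1) := by gcongr
    _ = L ^ (3 + 8 * (r - 1)) := by rw [← pow_mul, ← pow_add]
    _ ≤ L ^ (17 * r) := pow_le_pow_right₀ hL (by omega)

/-- Counting powers of `L`: one each from the union bound and the codegree, `16 * (r - 1)` from `M ^
(2 * (r - 1))`, and one for the constants; the total is at most `17 * r`. -/
lemma concentration_bound (hr : 2 ≤ r) (hτ : 0 < τ) (hL : 1 ≤ L) (hM : 0 < M)
    (hML : (M : ℝ) ≤ L ^ 8) {b d : ℝ} (hb : 0 < b) (hd : b * L ^ (17 * r) ≤ d)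
    (hLb : 12 * (r - 1 : ℕ) / (τ ^ 2 * b) ≤ L) :
    3 * L ≤ τ ^ 2 * d / (2 * ((r - 1 : ℕ) * (2 * L)) * (M : ℝ) ^ (2 * (r - 1))) := by
  have hM' : (0 : ℝ) < M := by exact_mod_cast hM
  have hL0 : 0 < L := by linarith
  have hk : (0 : ℝ) < (r - 1 : ℕ) := by exact_mod_cast (by omega : 0 < r - 1)
  rw [le_div_iff₀ (by positivity)]
  rw [div_le_iff₀ (by positivity)] at hLb
  have h1 : (M : ℝ) ^ (2 * (r - 1)) ≤ L ^ (16 * (r - 1)) := by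
    calc (M : ℝ) ^ (2 * (r - 1)) ≤ (L ^ 8) ^ (2 * (r - 1)) := by gcongr
      _ = L ^ (16 * (r - 1)) := by rw [← pow_mul]; congr 1; ring
  calc 3 * L * (2 * ((r - 1 : ℕ) * (2 * L)) * (M : ℝ) ^ (2 * (r - 1)))
      ≤ 3 * L * (2 * ((r - 1 : ℕ) * (2 * L)) * L ^ (16 * (r - 1))) := by gcongr
    _ = 12 * (r - 1 : ℕ) * L ^ (2 + 16 * (r - 1)) := by rw [pow_add]; ring
    _ ≤ L * (τ ^ 2 * b) * L ^ (2 + 16 * (r - 1)) := by gcongr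
    _ = τ ^ 2 * (b * L ^ (3 + 16 * (r - 1))) := by
      rw [show 3 + 16 * (r - 1) = (2 + 16 * (r - 1)) + 1 by ring, pow_succ]; ring
    _ ≤ τ ^ 2 * (b * L ^ (17 * r)) := by
      gcongr
      omega
    _ ≤ τ ^ 2 * d := by gcongr

/-- A set of barely more than half a class takes up the fraction `((1 + τ) / 2) ^ (r - 1)` of the
main term `Q`. The gap leaves `γ / 2 * Q`, of order at least `L ^ 3`, for the error term. -/
lemma half_class_bound (hr : 1 ≤ r) (hn : 0 < n) (hτ : 0 < τ) (hτ' : τ ≤ 1) (hL : 1 ≤ L)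
    (hM : 0 < M) (hML : (M : ℝ) ≤ L ^ 8) (hp : p = L ^ (17 * r) / (n : ℝ) ^ (r - 1)) (hγ : 0 < γ)
    (hgap : γ / 2 ≤ (1 - τ) ^ 2 * c - (1 + τ) * ((1 + τ) / 2) ^ (r - 1))
    (hLγ : 4 * (r - 1).factorial / γ ≤ L) {u : ℕ} (hu : (u : ℝ) ≤ (1 + τ) / 2 * (n / M)) :
    (1 + τ) * p * (u.choose (r - 1) : ℝ) + L ^ (1 + τ) <
      (1 - τ) ^ 2 * c * (L ^ (17 * r) / (M : ℝ) ^ (r - 1) / (r - 1).factorial) := by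
  have hM' : (0 : ℝ) < M := by exact_mod_cast hM
  have hn' : (0 : ℝ) < n := by exact_mod_cast hn
  have hL0 : 0 < L := by linarith
  have hp0 : 0 ≤ p := by rw [hp]; positivity
  set F : ℝ := ((r - 1).factorial : ℝ) with hF
  have hFpos : 0 < F := by rw [hF]; positivity
  set Q := L ^ (17 * r) / (M : ℝ) ^ (r - 1) / F with hQ
  have h1 : p * (u.choose (r - 1) : ℝ) ≤ ((1 + τ) / 2) ^ (r - 1) * Q := by
    refine (density_mul_choose_le hp0 u (r - 1)).trans ?_
    calc p * (u : ℝ) ^ (r - 1) / F ≤ p * ((1 + τ) / 2 * (n / M)) ^ (r - 1) / F := by gcongr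
      _ = ((1 + τ) / 2) ^ (r - 1) * Q := by
        rw [hp, hQ, mul_pow, div_pow (n : ℝ)]; field_simp
  have h2 : L ^ 3 / F ≤ Q := by
    rw [hQ]
    exact div_le_div_of_nonneg_right (pow_le_pow_div_pow hr hL hM hML) hFpos.le
  have h3 : L ^ 2 < γ / 2 * Q := by
    refine lt_of_lt_of_le ?_ (mul_le_mul_of_nonneg_left h2 (by positivity))
    rw [div_le_iff₀ hγ] at hLγ
    rw [← mul_div_assoc, lt_div_iff₀ hFpos]
    have h4 := mul_le_mul_of_nonneg_right hLγ (show 0 ≤ L ^ 2 by positivity)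
    have h5 : 0 < L ^ 2 * F := by positivity
    linarith [show L * γ * L ^ 2 = γ * L ^ 3 by ring]
  have h4 := rpow_one_add_le_sq hL hτ'
  have hQ0 : 0 < Q := by positivity
  have h5 := mul_le_mul_of_nonneg_right hgap hQ0.le
  have h6 := mul_le_mul_of_nonneg_left h1 (show 0 ≤ 1 + τ by linarith)
  linarith

/-- Below the threshold `p * u ^ (r - 1)` is of order `L`, so the whole left side is `O(L ^ 2)`,
against order `L ^ 3` on the right. In the constant, `416 = 16 * 2 * 13`, and `17` makes the
inequality strict. -/
lemma small_set_bound (hr : 2 ≤ r) (hτ : 0 < τ) (hτ' : τ ≤ 1) (hL : 1 ≤ L)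
    (hM : 0 < M) (hML : (M : ℝ) ≤ L ^ 8) (hp : 0 < p) {b : ℝ} (hb : 0 < b)
    (hLb : (416 / τ ^ 3 + 17) / (b / (r - 1).factorial) ≤ L) {u : ℕ}
    (hu : (u : ℝ) < (13 * ((r - 1).factorial : ℝ) * L / (τ ^ 3 * p)) ^ (1 / ((r : ℝ) - 1))) :
    16 * ((1 + τ) * p * (u.choose (r - 1) : ℝ) + L ^ (1 + τ)) <
      b * (L ^ (17 * r) / (M : ℝ) ^ (r - 1) / (r - 1).factorial) := by
  have hL0 : 0 < L := by linarith
  set F : ℝ := ((r - 1).factorial : ℝ) with hF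
  have hFpos : 0 < F := by rw [hF]; positivity
  set A := 13 * F * L / (τ ^ 3 * p) with hA
  have hA0 : 0 < A := by positivity
  have hk : ((r - 1 : ℕ) : ℝ) = (r : ℝ) - 1 := by rw [Nat.cast_sub (by omega)]; simp
  have hk0 : (0 : ℝ) < (r - 1 : ℕ) := by exact_mod_cast (by omega : 0 < r - 1)
  have h1 : (u : ℝ) ^ (r - 1) ≤ A := by
    calc (u : ℝ) ^ (r - 1) ≤ (A ^ (1 / ((r : ℝ) - 1))) ^ (r - 1) := by gcongr
      _ = A := by
        rw [← hk, one_div, Real.rpow_inv_natCast_pow hA0.le (by omega)]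
  have h2 : p * (u.choose (r - 1) : ℝ) ≤ 13 * L / τ ^ 3 := by
    refine (density_mul_choose_le hp.le u (r - 1)).trans ?_
    calc p * (u : ℝ) ^ (r - 1) / F ≤ p * A / F := by gcongr
      _ = 13 * L / τ ^ 3 := by rw [hA]; field_simp
  have h3 := rpow_one_add_le_sq hL hτ'
  have h4 : (1 + τ) * (p * (u.choose (r - 1) : ℝ)) ≤ 2 * (13 * L / τ ^ 3) :=
    mul_le_mul (by linarith) h2 (by positivity) (by norm_num)
  have h5 : b * (L ^ 3 / F) ≤ b * (L ^ (17 * r) / (M : ℝ) ^ (r - 1) / F) :=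
    mul_le_mul_of_nonneg_left
      (div_le_div_of_nonneg_right (pow_le_pow_div_pow (by omega) hL hM hML) hFpos.le) hb.le
  rw [div_le_iff₀ (by positivity)] at hLb
  have h6 := mul_le_mul_of_nonneg_right hLb (show 0 ≤ L ^ 2 by positivity)
  have h7 : L * (b / F) * L ^ 2 = b * (L ^ 3 / F) := by ring
  have h8 : 416 / τ ^ 3 * L ≤ 416 / τ ^ 3 * L ^ 2 := by
    gcongr
    rw [sq]; exact le_mul_of_one_le_right hL0.le hL
  have h9 : 0 < L ^ 2 := by positivity
  have h10 : 2 * (13 * L / τ ^ 3) * 16 = 416 / τ ^ 3 * L := by ring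
  linarith

/-- Eventually, `ln n` is large, every power of `ln n` is small against `n`, and `n.choose k` is
close to `n ^ k / k!`. -/
lemma exists_forall_large (k m : ℕ) (hτ : 0 < τ) (K K' : ℝ) : ∃ n₀ : ℕ, ∀ n : ℕ, n₀ ≤ n →
    K ≤ Real.log n ∧ K' * Real.log n ^ m ≤ n ∧
      (1 - τ) * ((n : ℝ) ^ k / k.factorial) ≤ n.choose k := by
  rw [← Filter.eventually_atTop]
  refine Filter.Eventually.and ?_ (Filter.Eventually.and ?_ ?_)
  · exact (Real.tendsto_log_atTop.comp tendsto_natCast_atTop_atTop).eventually_ge_atTop K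
  · have h1 := (Real.isLittleO_pow_log_id_atTop (n := m)).bound
      (show (0 : ℝ) < (|K'| + 1)⁻¹ by positivity)
    filter_upwards [tendsto_natCast_atTop_atTop.eventually h1] with n hn
    have hK : 0 < |K'| + 1 := by positivity
    rw [Real.norm_eq_abs, id, Real.norm_eq_abs, Nat.abs_cast, inv_mul_eq_div, le_div_iff₀ hK] at hn
    have h2 := le_abs_self (Real.log n ^ m)
    calc K' * Real.log n ^ m ≤ |K' * Real.log n ^ m| := le_abs_self _
      _ = |Real.log n ^ m| * |K'| := by rw [abs_mul, mul_comm]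
      _ ≤ |Real.log n ^ m| * (|K'| + 1) := by gcongr; linarith
      _ ≤ n := hn
  · have h1 := (isEquivalent_choose k).bound hτ
    filter_upwards [h1] with n hn
    rw [Pi.sub_apply, Real.norm_eq_abs, Real.norm_of_nonneg (by positivity)] at hn
    have := (abs_le.1 hn).1
    linarith

end Estimates

/-! ### Assembling the proof of the theorem. -/

lemma UniformHypergraph.codegree_le_maxCollectiveDegree {V : Type*} [Fintype V] [DecidableEq V]
    {r : ℕ} {G H : UniformHypergraph V r} (hHG : H.IsSpanningSubgraph G) {v w : V} (hvw : v ≠ w) :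
    H.codegree v w ≤ G.maxCollectiveDegree 2 := by
  have h1 : H.codegree v w ≤ G.setDegree {v, w} := by
    refine Finset.card_le_card fun e he => ?_
    rw [Finset.mem_filter] at he ⊢
    refine ⟨hHG he.1, fun z hz => ?_⟩
    rcases Finset.mem_insert.1 hz with rfl | hz
    · exact he.2.1
    · rw [Finset.mem_singleton.1 hz]; exact he.2.2
  refine h1.trans (Finset.le_sup (f := G.setDegree) (Finset.mem_powersetCard.2 ⟨?_, ?_⟩))
  · exact Finset.subset_univ _
  · exact Finset.card_pair hvw

lemma UniformHypergraph.minDegree_le_degree {V : Type*} [DecidableEq V] {r : ℕ}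
    (H : UniformHypergraph V r) (v : V) : H.minDegree ≤ H.degree v :=
  ciInf_le (OrderBot.bddBelow _) v

theorem theorem6p1 (r : ℕ) (hr : 3 ≤ r) (γ : ℝ) (hγ : 0 < γ) :
    ∃ ε : ℝ, 0 < ε ∧ ε < 3 / 2 ∧ ∃ n₀ : ℕ, ∀ n : ℕ, n₀ ≤ n →
      ∀ (V : Type*) [Fintype V] [DecidableEq V], Fintype.card V = n →
      ∀ p : ℝ, p = Real.log (n : ℝ) ^ (17 * r) / (n : ℝ) ^ (r - 1) →
      ∀ G : UniformHypergraph V r, G.IsPseudorandom ε p →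
        (G.maxCollectiveDegree 2 : ℝ) ≤ 2 * Real.log (n : ℝ) →
      ∀ H : UniformHypergraph V r, H.IsSpanningSubgraph G →
        (1 / 2 ^ (r - 1) + γ) * p * (n.choose (r - 1) : ℝ) ≤ (H.minDegree : ℝ) →
        H.HasHamiltonBergeCycle := by
  obtain ⟨τ, hτ, hτ16, hgap⟩ := exists_deficiency r hγ
  set c₀ : ℝ := 1 / 2 ^ (r - 1) + γ with hc₀
  have hc₀pos : 0 < c₀ := by positivity
  set F : ℝ := ((r - 1).factorial : ℝ) with hF
  have hFpos : 0 < F := by rw [hF]; positivity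
  have hτ1 : 0 < 1 - τ := by linarith
  -- Small enough that `(1 + 2 * η) * (1 + 3 * η) ≤ 1 + τ`, so that twice a set counted as half a
  -- class stays below `(1 + τ) * n / M`.
  set η := τ / 10 with hη
  have hηpos : 0 < η := by positivity
  set b₁ := c₀ * ((1 - τ) / F) with hb₁
  -- One factor `1 - τ` pays for replacing the binomial coefficient by a power, the other for the
  -- concentration of the links.
  set b₂ := (1 - τ) ^ 2 * c₀ with hb₂
  have hb₁pos : 0 < b₁ := by positivity
  have hb₂pos : 0 < b₂ := by positivity
  set K₁ := 1884 / η ^ 2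
  set K₂ := 12 * (r - 1 : ℕ) / (τ ^ 2 * b₁)
  set K₃ := 4 * F / γ
  set K₄ := (416 / τ ^ 3 + 17) / (b₂ / F)
  obtain ⟨n₀, hn₀⟩ := exists_forall_large (r - 1) 17 hτ (max 4 (max K₁ (max K₂ (max K₃ K₄))))
    (6 / η ^ 2)
  refine ⟨τ, hτ, by linarith, max n₀ 3, fun n hn V _ _ hV p hp G hG hΔ H hHG hdeg => ?_⟩
  obtain ⟨hK, hnL, hch⟩ := hn₀ n (le_of_max_le_left hn)
  have hn3 : 3 ≤ n := le_of_max_le_right hn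
  set L := Real.log n with hL
  simp only [max_le_iff] at hK
  obtain ⟨hL4, hK₁, hK₂, hK₃, hK₄⟩ := hK
  have hL1 : 1 ≤ L := by linarith
  have hL0 : 0 < L := by linarith
  have hnpos : 0 < n := by omega
  have hn' : (0 : ℝ) < n := by exact_mod_cast hnpos
  have hppos : 0 < p := by rw [hp]; positivity
  obtain ⟨M, σ, β, h, B, hMpos, hMn, hML, hconc, hσge, hσle, hσ2, hσn, hσ2', hβσ, hβη, hh, hB, hcap,
    hcol⟩ := exists_parameters hL hηpos (by linarith) hL4 hK₁ hnL
  have hM' : (0 : ℝ) < M := by exact_mod_cast hMpos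
  have hdegb : ∀ v, b₁ * L ^ (17 * r) ≤ H.degree v := by
    intro v
    have h1 : (H.minDegree : ℝ) ≤ H.degree v := by exact_mod_cast H.minDegree_le_degree v
    refine le_trans (le_of_eq ?_)
      ((le_density_mul_choose hnpos hc₀pos.le hL0.le hp hch).trans (hdeg.trans h1))
    rw [hb₁]; ring
  have hdegpos : ∀ v, 0 < H.degree v := by
    intro v
    have : (0 : ℝ) < H.degree v := lt_of_lt_of_le (by positivity) (hdegb v)
    exact_mod_cast this
  obtain ⟨c, hlink, hclass⟩ := H.exists_balanced_colouring (Δ := 2 * L) (α := τ) (η := η)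
    (by omega) (by positivity) hτ.le hηpos.le
    (fun v w hvw => le_trans (by
      exact_mod_cast UniformHypergraph.codegree_le_maxCollectiveDegree hHG hvw) hΔ)
    hdegpos hMpos (by omega) (by omega)
    (fun v => by
      rw [hV]
      exact concentration_bound (by omega) hτ hL1 hMpos hML hb₁pos (hdegb v) hK₂)
    (by rw [hV]; exact hconc)
  rw [hV] at hclass
  have hE : IsExpanding c (H.Arc c) σ β := by
    refine UniformHypergraph.isExpanding_arc hHG hG hτ hτ16 hppos.le
      (D := b₂ * (L ^ (17 * r) / (M : ℝ) ^ (r - 1) / F)) ?_ ?_ ?_ ?_ ?_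
    · intro v j _
      refine le_trans ?_ (hlink v j)
      calc b₂ * (L ^ (17 * r) / (M : ℝ) ^ (r - 1) / F)
          = (1 - τ) * (b₁ * L ^ (17 * r)) / (M : ℝ) ^ (r - 1) := by
            rw [hb₁, hb₂]; field_simp
        _ ≤ (1 - τ) * H.degree v / (M : ℝ) ^ (r - 1) := by
            gcongr
            exact hdegb v
    · intro j
      exact_mod_cast (hclass j).2.trans hσge
    · rw [hV]; exact hσn
    · intro u hu _
      rw [hV]
      refine half_class_bound (by omega) hnpos hτ (by linarith) hL1 hMpos hML hp hγ hgap hK₃ ?_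
      have h1 : 2 * (u : ℝ) < σ + 2 * β := by exact_mod_cast hu
      have h2 : 0 < n / (M : ℝ) := by positivity
      rw [mul_div_assoc] at hσle
      have h3 : 2 * (u : ℝ) ≤ (1 + 2 * η) * σ := by linarith
      have h4 : (1 + 2 * η) * (σ : ℝ) ≤ (1 + 2 * η) * ((1 + 3 * η) * (n / M)) := by gcongr
      have h5 : (1 + 2 * η) * (1 + 3 * η) ≤ 1 + τ := by
        rw [hη]; nlinarith
      have h6 := mul_le_mul_of_nonneg_right h5 h2.le
      linarith
    · intro u hu
      rw [hV] at hu ⊢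
      exact small_set_bound (by omega) hτ (by linarith) hL1 hMpos hML hppos hb₂pos hK₄ hu
  obtain ⟨C, E, hCE, htour⟩ := exists_hamiltonTour_of_isExpanding hE hβσ hσ2' (fun j => by
    have h1 := (hclass j).1
    have h2 : (σ : ℝ) ≤ 2 * (colourClass c j).card := by linarith
    exact_mod_cast h2) hh hB (by rw [hV]; exact hcap) (by rw [hV, Fintype.card_fin]; exact hcol)
  exact UniformHypergraph.hasHamiltonBergeCycle_of_tour hr (by omega) hCE htour
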